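/- \textbf{Setting.} Let $(\Omega,\mathcal A,\mathbb P)$ be a probability space, $\theta:\Omega\to\Omega$ a bijective bimeasurable transformation preserving $\mathbb P$, $\mathcal M_0\subseteq\mathcal A$ a sub-$\sigma$-algebra with $\mathcal M_0\subseteq\theta^{-1}(\mathcal M_0)$, $Y_0$ a real-valued $\mathcal M_0$-measurable random variable with distribution $P_{Y_0}$, and $Y_i=Y_0\circ\theta^i$. For an integrable random variable $X$ write $X^{(0)}=X-\mathbb E(X)$. For integers $k\ge 1$, $m\geq 0$ put $$\alpha_{k,\mathbf Y}(m)=\max_{1\le l\le k}\ \sup_{m\le i_1\le\dots\le i_l}\ \sup_{(x_1,\dots,x_l)\in\mathbb R^l}\Big\|\mathbb E\Big(\prod_{j=1}^l(\mathbf 1_{Y_{i_j}\le x_j})^{(0)}\Big|\mathcal M_0\Big)^{(0)}\Big\|_1 .$$ The quantile function of a nonnegative random variable $X$ is $Q_X(u)=\inf\{t\ge 0:\mathbb P(X>t)\le u\}$, $u\in[0,1]$ (with the value $+\infty$ at $u=0$ if $X$ is not essentially bounded). Let $Q$ be a square integrable quantile function, i.e. $Q$ is the quantile function of some nonnegative random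 variable and $\int_0^1Q^2(u)\,du<\infty$. Let $\mu=P_{Y_0}$, and let $\widetilde{\mathcal F}(Q,\mu)$ be the closure in $\mathbb L^1(\mu)$ of the set of functions $\sum_{\ell=1}^La_\ell f_\ell$ with $\sum_{\ell=1}^L|a_\ell|\le 1$, where each $f_\ell:\mathbb R\to\mathbb R$ is monotonic on some open interval, null elsewhere, and satisfies $Q_{|f_\ell(Y_0)|}\le Q$ on $[0,1]$. \textbf{Proposition.} Let $f\in\widetilde{\mathcal F}(Q,P_{Y_0})$, $X_i=f(Y_i)-\mathbb E(f(Y_i))$ and $S_k=\sum_{i=1}^kX_i$. Let $n\in\mathbb N=\{0,1,2,\dots\}$ and, with $\min\emptyset=\infty$ and $0\cdot\infty=0$, let $$R(u)=\big(\min\{q\in\mathbb N:\alpha_{2,\mathbf Y}(q)\le u\}\wedge n\big)\,Q(u),\qquad S(v)=\inf\{u\in[0,1]:R(u)\le v\}.$$ Then for any $x>0$, $r\ge 1$ and $s_n>0$ with $s_n^2\ge 4n\sum_{i=0}^{n-1}\int_0^{\alpha_{1,\mathbf Y}(i)}Q^2(u)\,du$, $$\mathbb P\Big(\max_{1\le k\le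 n}|S_k|\ge 5x\Big)\le 4\exp\Big(-\frac{r^2s_n^2}{8x^2}\,h\Big(\frac{2x^2}{rs_n^2}\Big)\Big)+n\Big(\frac6x+\frac{16x}{rs_n^2}\Big)\int_0^{S(x/r)}Q(u)\,du,$$ where $h(u)=(1+u)\ln(1+u)-u$ (for $n=0$ the event on the left is empty). -/

import Mathlib

open MeasureTheory
open scoped ENNReal

namespace FukNagaev

noncomputable section

/-- The upper tail quantile function `Q_X(u) = inf {t ≥ 0 : P(X > t) ≤ u}` of a nonnegative random
variable `X`, for `u ∈ [0,1]`. It takes values in `[0,∞]`: it is `∞` at `u = 0` if `X` is not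
essentially bounded. -/
def quantile {Ω : Type*} [MeasurableSpace Ω] (P : Measure Ω) (X : Ω → ℝ) (u : ℝ) : ℝ≥0∞ :=
  ⨅ t ∈ {t : ℝ | 0 ≤ t ∧ P {ω | t < X ω} ≤ ENNReal.ofReal u}, ENNReal.ofReal t

/-- `Q` is, on `[0,1]`, the quantile function of some nonnegative random variable; `ρ` is the law of
that random variable. -/
def IsQuantileFunction (Q : ℝ → ℝ≥0∞) : Prop :=
  ∃ ρ : Measure ℝ, IsProbabilityMeasure ρ ∧ ρ (Set.Iio 0) = 0 ∧
    ∀ u ∈ Set.Icc (0 : ℝ) 1, Q u = quantile ρ id u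

/-- The functions `g` that are monotonic on some open interval of `ℝ` (possibly unbounded), null
elsewhere, and such that `Q_{|g(X)|} ≤ Q` on `[0,1]`, where `X` has law `μ`. -/
def MonClass (Q : ℝ → ℝ≥0∞) (μ : Measure ℝ) : Set (ℝ → ℝ) :=
  {g | (∃ I : Set ℝ, IsOpen I ∧ I.OrdConnected ∧ (MonotoneOn g I ∨ AntitoneOn g I) ∧
          ∀ x ∉ I, g x = 0) ∧
        ∀ u ∈ Set.Icc (0 : ℝ) 1, quantile μ (fun x => |g x|) u ≤ Q u}

/-- The closure in `L¹(μ)` of the set of functions `∑ a_ℓ f_ℓ` with `∑ |a_ℓ| ≤ 1` and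
`f_ℓ ∈ MonClass Q μ`. -/
def closedClass (Q : ℝ → ℝ≥0∞) (μ : Measure ℝ) : Set (Lp ℝ 1 μ) :=
  closure {g | ∃ (L : ℕ) (a : Fin L → ℝ) (f : Fin L → ℝ → ℝ),
    ∑ l, |a l| ≤ 1 ∧ (∀ l, f l ∈ MonClass Q μ) ∧ g =ᵐ[μ] fun x => ∑ l, a l * f l x}

/-- The function `f : ℝ → ℝ` belongs to the class above: its class modulo `μ`-a.e. equality does. -/
def MemClosedClass (Q : ℝ → ℝ≥0∞) (μ : Measure ℝ) (f : ℝ → ℝ) : Prop :=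
  ∃ g ∈ closedClass Q μ, f =ᵐ[μ] g

/-- The centred variable `X⁽⁰⁾ = X - E X`. -/
def center {Ω : Type*} [MeasurableSpace Ω] (P : Measure Ω) (X : Ω → ℝ) : Ω → ℝ :=
  fun ω => X ω - ∫ ω', X ω' ∂P

/-- `α(𝓕, Y) = sup_x ‖E(∏_j (1_{Y_j ≤ x_j})⁽⁰⁾ | 𝓕)⁽⁰⁾‖₁` for `Y = (Y_1, …, Y_k)`. -/
def alpha {Ω : Type*} (𝓕 : MeasurableSpace Ω) [MeasurableSpace Ω] (P : Measure Ω) {k : ℕ}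
    (Y : Fin k → Ω → ℝ) : ℝ≥0∞ :=
  ⨆ x : Fin k → ℝ,
    eLpNorm (center P
      (P[fun ω => ∏ j, center P (Set.indicator {ω' | Y j ω' ≤ x j} fun _ => (1 : ℝ)) ω | 𝓕])) 1 P

/-- `α_{k,Y}(n) = max_{1 ≤ l ≤ k} sup_{n ≤ i_1 ≤ … ≤ i_l} α(𝓜₀, (Y_{i_1}, …, Y_{i_l}))`. Only
nonnegative indices enter, so `Y` is a sequence indexed by `ℕ`. -/
def alphaCoeff {Ω : Type*} (M₀ : MeasurableSpace Ω) [MeasurableSpace Ω] (P : Measure Ω)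
    (Y : ℕ → Ω → ℝ) (k n : ℕ) : ℝ≥0∞ :=
  ⨆ l ∈ Finset.Icc 1 k, ⨆ i ∈ {i : Fin l → ℕ | Monotone i ∧ ∀ j, n ≤ i j},
    alpha M₀ P (fun j => Y (i j))

/-- `R(u) = (min {q ∈ ℕ : α₂(q) ≤ u} ∧ n) Q(u)`; the minimum of the empty set is `∞`. -/
def R (α₂ : ℕ → ℝ≥0∞) (n : ℕ) (Q : ℝ → ℝ≥0∞) (u : ℝ) : ℝ≥0∞ :=
  (((⨅ q ∈ {q : ℕ | α₂ q ≤ ENNReal.ofReal u}, (q : ℕ∞)) ⊓ (n : ℕ∞) : ℕ∞) : ℝ≥0∞) * Q u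

/-- `S(v) = inf {u ∈ [0,1] : R(u) ≤ v}`. -/
def S (α₂ : ℕ → ℝ≥0∞) (n : ℕ) (Q : ℝ → ℝ≥0∞) (v : ℝ) : ℝ :=
  sInf {u : ℝ | u ∈ Set.Icc (0 : ℝ) 1 ∧ R α₂ n Q u ≤ ENNReal.ofReal v}

/-- `h(u) = (1 + u) ln (1 + u) - u`. -/
def h (u : ℝ) : ℝ := (1 + u) * Real.log (1 + u) - u

/-- `Y_i = Y_0 ∘ θ^i`. -/
def orbit {Ω : Type*} (θ : Ω → Ω) (Y₀ : Ω → ℝ) (i : ℕ) : Ω → ℝ := fun ω => Y₀ (θ^[i] ω)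

/-- `S_k = ∑_{i=1}^k X_i` with `X_i = f(Y_i) - E f(Y_i)`. -/
def partialSum {Ω : Type*} [MeasurableSpace Ω] (P : Measure Ω) (Y : ℕ → Ω → ℝ) (f : ℝ → ℝ)
    (k : ℕ) (ω : Ω) : ℝ :=
  ∑ i ∈ Finset.Icc 1 k, center P (fun ω' => f (Y i ω')) ω

end

end FukNagaev

/-!
A Fuk–Nagaev inequality for the partial sums of `f (Y_i)` under the coefficients `α₁`, `α₂`, which
test the dependence only on indicators of half-lines. The proof truncates, groups the variables into
blocks, and applies Freedman's martingale inequality to the blocks.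

*From half-lines to functions.* A function that is monotonic on an interval and null elsewhere has
order-connected superlevel sets (`MonClass.ordLevels`), and so have its truncations. A bound for
integrals over half-lines gives one for integrals over order-connected sets, up to a factor `2`, and
then, by the layer-cake formula, one for integrals against such a function
(`OrdLevels.abs_integral_mul_le`). Hence the coefficients control the conditional expectations of
truncated combinations and of their products: `integral_abs_condExp_clipSum_le`,
`integral_abs_condExp_clipSum_mul_le`. The covariance of two truncated combinations at distance `d`
is at most `4 ∫_0^{α₁(d)} Q²`, whatever the level of truncation (`integral_clipSum_mul_le`).

*Choice of the parameters.* Let `v = S(x / r)`. The infimum defining `S` is attained (`S_mem`), so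
that `q Q(v) ≤ x / r` for the block length `q = min {k : α₂(k) ≤ v} ∧ n`. The functions are
truncated at `M = Q(v)`; then `q M ≤ x / r`, and the tails cost at most
`2 ∫ (Q - M)₊ = 2 (∫_0^v Q - M v)` per centred variable.

*Blocks.* Each block of length `q` is compensated by its conditional expectation given the past one
whole block before its beginning. The even and the odd compensated blocks are martingale
differences bounded by `2x / r`. The expected conditional variances add up to at most `2s²`;
their fluctuation is at most `s²` off an event which `α₂(q) ≤ v` and Markov's inequality make
small, and this gives the term `16x / (r s²)`. The threshold `5x` is spent as follows
(`measure_max_le`): `3x/2` for each of the two martingales, `x` for the distance to the end of a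
block, which is at most `q M`, and `x` for the predictions of the blocks together with the
tails, again by Markov's inequality, which gives the term `6 / x`. Freedman's inequality at level
`3x/2` with variance `3s²` yields the exponent, since `h (2t) ≤ 6 h t` (`exponent_le`).

Two points remain. An element of the closed class is only approximated in `L¹` by a
combination; the error enters the Markov term and tends to zero. If `q = 0 < n`, there are no
blocks and `Q(v)` may be infinite, but then `α₂(0) ≤ v`, the truncated variables themselves are
small in `L¹`, and Markov's inequality is enough (`measure_partialSum_le_of_degenerate`).
-/

namespace FukNagaev

/-! ### Quantile functions -/

/-- The infimum defining the quantile function is attained: the quantile function is the generalized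
inverse of the tail. -/
lemma quantile_le_ofReal_iff {Ω : Type*} [MeasurableSpace Ω] {P : Measure Ω} {X : Ω → ℝ} {u t : ℝ}
    (ht : 0 ≤ t) :
    quantile P X u ≤ ENNReal.ofReal t ↔ P {ω | t < X ω} ≤ ENNReal.ofReal u := by
  constructor
  · intro hle
    have hU : {ω | t < X ω} = ⋃ k : ℕ, {ω | t + 1 / ((k : ℝ) + 1) < X ω} := by
      ext ω
      simp only [Set.mem_ofPred_eq, Set.mem_iUnion]
      constructor
      · intro hω
        obtain ⟨k, hk⟩ := exists_nat_one_div_lt (sub_pos.2 hω)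
        exact ⟨k, by linarith⟩
      · rintro ⟨k, hk⟩
        have : 0 < 1 / ((k : ℝ) + 1) := by positivity
        linarith
    have hmono : Monotone fun k : ℕ => {ω | t + 1 / ((k : ℝ) + 1) < X ω} := by
      intro a b hab ω hω
      have : 1 / ((b : ℝ) + 1) ≤ 1 / ((a : ℝ) + 1) := Nat.one_div_le_one_div hab
      simp only [Set.mem_ofPred_eq] at hω ⊢
      linarith
    rw [hU, hmono.measure_iUnion]
    refine iSup_le fun k => ?_
    have hlt : quantile P X u < ENNReal.ofReal (t + 1 / ((k : ℝ) + 1)) :=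
      lt_of_le_of_lt hle ((ENNReal.ofReal_lt_ofReal_iff (by positivity)).2
        (by have : 0 < 1 / ((k : ℝ) + 1) := by positivity
            linarith))
    simp only [quantile, iInf_lt_iff] at hlt
    obtain ⟨t', ⟨ht', hP⟩, hlt⟩ := hlt
    refine le_trans (measure_mono fun ω hω => ?_) hP
    have := (ENNReal.ofReal_lt_ofReal_iff (by positivity)).1 hlt
    simp only [Set.mem_ofPred_eq] at hω ⊢
    linarith
  · intro hP
    exact iInf₂_le t ⟨ht, hP⟩

lemma quantile_anti {Ω : Type*} [MeasurableSpace Ω] {P : Measure Ω} {X : Ω → ℝ} :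
    Antitone (quantile P X) := by
  intro u u' huu
  refine le_iInf₂ fun t ht => iInf₂_le t ⟨ht.1, ht.2.trans (ENNReal.ofReal_le_ofReal huu)⟩

lemma quantile_id_ne_top {ρ : Measure ℝ} [IsProbabilityMeasure ρ] {u : ℝ} (hu : 0 < u) :
    quantile ρ id u ≠ ∞ := by
  have hlim := tendsto_measure_iInter_atTop (μ := ρ) (s := fun k : ℕ => Set.Ioi (k : ℝ))
    (fun k => measurableSet_Ioi.nullMeasurableSet)
    (fun a b hab => Set.Ioi_subset_Ioi (by exact_mod_cast hab)) ⟨0, measure_ne_top _ _⟩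
  have hempty : (⋂ k : ℕ, Set.Ioi (k : ℝ)) = ∅ := by
    ext y
    simp only [Set.mem_iInter, Set.mem_Ioi, Set.mem_empty_iff_false, iff_false, not_forall, not_lt]
    exact exists_nat_ge y
  rw [hempty, measure_empty] at hlim
  obtain ⟨k, hk⟩ := (hlim.eventually (gt_mem_nhds (ENNReal.ofReal_pos.2 hu))).exists
  refine ne_top_of_le_ne_top (ENNReal.ofReal_ne_top (r := (k : ℝ))) ?_
  exact (quantile_le_ofReal_iff (Nat.cast_nonneg k)).2 hk.le

lemma IsQuantileFunction.antitoneOn {Q : ℝ → ℝ≥0∞} (hQ : IsQuantileFunction Q) :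
    AntitoneOn Q (Set.Icc 0 1) := by
  obtain ⟨ρ, _, -, hρ⟩ := hQ
  intro u hu u' hu' huu
  rw [hρ u hu, hρ u' hu']
  exact quantile_anti huu

lemma IsQuantileFunction.ne_top {Q : ℝ → ℝ≥0∞} (hQ : IsQuantileFunction Q) {u : ℝ}
    (hu : u ∈ Set.Ioc (0 : ℝ) 1) : Q u ≠ ∞ := by
  obtain ⟨ρ, _, -, hρ⟩ := hQ
  rw [hρ u ⟨hu.1.le, hu.2⟩]
  exact quantile_id_ne_top hu.1

lemma IsQuantileFunction.apply_one {Q : ℝ → ℝ≥0∞} (hQ : IsQuantileFunction Q) : Q 1 = 0 := by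
  obtain ⟨ρ, _, -, hρ⟩ := hQ
  rw [hρ 1 (by simp), ← nonpos_iff_eq_zero, ← ENNReal.ofReal_zero, quantile_le_ofReal_iff le_rfl,
    ENNReal.ofReal_one]
  exact prob_le_one

/-- Quantile functions are right continuous; being antitone, they only have to be lower
semicontinuous from the right. -/
lemma IsQuantileFunction.exists_lt_of_lt {Q : ℝ → ℝ≥0∞} (hQ : IsQuantileFunction Q) {v : ℝ}
    (hv : v ∈ Set.Icc (0 : ℝ) 1) {b : ℝ≥0∞} (hb : b < Q v) :
    ∃ w, v < w ∧ ∀ u ∈ Set.Icc (0 : ℝ) 1, u < w → b < Q u := by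
  obtain ⟨ρ, _, -, hρ⟩ := hQ
  rw [hρ v hv] at hb
  lift b to NNReal using hb.ne_top
  have key : ∀ u, (b : ℝ≥0∞) < quantile ρ id u ↔ ENNReal.ofReal u < ρ {y | (b : ℝ) < id y} := by
    intro u
    rw [← not_le, ← not_le, not_iff_not, ← ENNReal.ofReal_coe_nnreal]
    exact quantile_le_ofReal_iff b.2
  have hne : ρ {y | (b : ℝ) < id y} ≠ ∞ := measure_ne_top _ _
  refine ⟨(ρ {y | (b : ℝ) < id y}).toReal, ?_, fun u hu huw => ?_⟩
  · exact (ENNReal.ofReal_lt_iff_lt_toReal hv.1 hne).1 ((key v).1 hb)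
  · rw [hρ u hu, key, ENNReal.ofReal_lt_iff_lt_toReal hu.1 hne]
    exact huw

/-! ### Comparison of moments with a quantile function -/

/-- Variables with comparable tails have comparable means, even if they live on different spaces. -/
lemma lintegral_le_of_tail_le {α β : Type*} [MeasurableSpace α] [MeasurableSpace β]
    {μ : Measure α} {ν : Measure β} {X : α → ℝ} {Y : β → ℝ} (hX : AEMeasurable X μ)
    (hY : AEMeasurable Y ν) (hX0 : ∀ a, 0 ≤ X a) (hY0 : ∀ b, 0 ≤ Y b)
    (h : ∀ t, 0 < t → μ {a | t < X a} ≤ ν {b | t < Y b}) :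
    ∫⁻ a, ENNReal.ofReal (X a) ∂μ ≤ ∫⁻ b, ENNReal.ofReal (Y b) ∂ν := by
  rw [lintegral_eq_lintegral_meas_lt μ (Filter.Eventually.of_forall hX0) hX,
    lintegral_eq_lintegral_meas_lt ν (Filter.Eventually.of_forall hY0) hY]
  exact setLIntegral_mono' measurableSet_Ioi fun t ht => h t ht

/-- A real-valued version of a quantile function, on which integrals are computed. Its value is
meaningless at `0` if the quantile function is infinite there. -/
noncomputable def realQuantile (Q : ℝ → ℝ≥0∞) (u : ℝ) : ℝ := (Q u).toReal

lemma realQuantile_nonneg (Q : ℝ → ℝ≥0∞) (u : ℝ) : 0 ≤ realQuantile Q u := ENNReal.toReal_nonneg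

section

variable {Q : ℝ → ℝ≥0∞}

lemma realQuantile_le_of_le (hQ : IsQuantileFunction Q) {u v : ℝ} (hv : v ∈ Set.Icc (0 : ℝ) 1)
    (hvt : Q v ≠ ∞) (hu : u ≤ 1) (hvu : v ≤ u) : realQuantile Q u ≤ realQuantile Q v :=
  ENNReal.toReal_mono hvt (hQ.antitoneOn hv ⟨hv.1.trans hvu, hu⟩ hvu)

lemma realQuantile_antitoneOn (hQ : IsQuantileFunction Q) :
    AntitoneOn (realQuantile Q) (Set.Ioc 0 1) := fun _ hu _ hu' huu =>
  realQuantile_le_of_le hQ ⟨hu.1.le, hu.2⟩ (hQ.ne_top hu) hu'.2 huu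

lemma aemeasurable_realQuantile (hQ : IsQuantileFunction Q) :
    AEMeasurable (realQuantile Q) (volume.restrict (Set.Ioc 0 1)) :=
  aemeasurable_restrict_of_antitoneOn measurableSet_Ioc (realQuantile_antitoneOn hQ)

lemma setLIntegral_eq_realQuantile (hQ : IsQuantileFunction Q) {a : ℝ} (ha : a ≤ 1)
    (G : ℝ≥0∞ → ℝ≥0∞) :
    ∫⁻ u in Set.Icc 0 a, G (Q u) = ∫⁻ u in Set.Ioc 0 a, G (ENNReal.ofReal (realQuantile Q u)) := by
  rw [setLIntegral_congr (Ioc_ae_eq_Icc (μ := volume) (a := (0 : ℝ)) (b := a)).symm]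
  refine setLIntegral_congr_fun measurableSet_Ioc fun u hu => ?_
  simp only [realQuantile]
  rw [ENNReal.ofReal_toReal (hQ.ne_top ⟨hu.1, hu.2.trans ha⟩)]

lemma integrable_realQuantile_sq (hQ : IsQuantileFunction Q)
    (hQ2 : ∫⁻ u in Set.Icc (0 : ℝ) 1, Q u ^ 2 < ∞) :
    IntegrableOn (fun u => realQuantile Q u ^ 2) (Set.Ioc 0 1) := by
  refine ⟨((aemeasurable_realQuantile hQ).pow_const 2).aestronglyMeasurable, ?_⟩
  rw [hasFiniteIntegral_iff_ofReal (Filter.Eventually.of_forall fun u => by positivity)]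
  have := setLIntegral_eq_realQuantile hQ le_rfl (fun z => z ^ 2)
  rw [this] at hQ2
  refine lt_of_le_of_lt (le_of_eq ?_) hQ2
  refine lintegral_congr fun u => ?_
  rw [ENNReal.ofReal_pow (realQuantile_nonneg _ _)]

lemma integrable_realQuantile (hQ : IsQuantileFunction Q)
    (hQ2 : ∫⁻ u in Set.Icc (0 : ℝ) 1, Q u ^ 2 < ∞) :
    IntegrableOn (realQuantile Q) (Set.Ioc 0 1) := by
  refine Integrable.mono' (((integrable_realQuantile_sq hQ hQ2)).add (integrable_const (1 : ℝ)))
    (aemeasurable_realQuantile hQ).aestronglyMeasurable (Filter.Eventually.of_forall fun u => ?_)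
  rw [Real.norm_of_nonneg (realQuantile_nonneg _ _)]
  simp only [Pi.add_apply]
  nlinarith [sq_nonneg (realQuantile Q u - 1)]

lemma setLIntegral_eq_ofReal (hQ : IsQuantileFunction Q)
    (hQ2 : ∫⁻ u in Set.Icc (0 : ℝ) 1, Q u ^ 2 < ∞) {a : ℝ} (ha : a ≤ 1) :
    ∫⁻ u in Set.Icc 0 a, Q u = ENNReal.ofReal (∫ u in Set.Ioc 0 a, realQuantile Q u) := by
  rw [setLIntegral_eq_realQuantile hQ ha (fun z => z), ofReal_integral_eq_lintegral_ofReal]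
  · exact (integrable_realQuantile hQ hQ2).mono_set (Set.Ioc_subset_Ioc_right ha)
  · exact Filter.Eventually.of_forall (realQuantile_nonneg _)

lemma setLIntegral_sq_eq_ofReal (hQ : IsQuantileFunction Q)
    (hQ2 : ∫⁻ u in Set.Icc (0 : ℝ) 1, Q u ^ 2 < ∞) {a : ℝ} (ha : a ≤ 1) :
    ∫⁻ u in Set.Icc 0 a, Q u ^ 2
      = ENNReal.ofReal (∫ u in Set.Ioc 0 a, realQuantile Q u ^ 2) := by
  rw [setLIntegral_eq_realQuantile hQ ha (fun z => z ^ 2), ofReal_integral_eq_lintegral_ofReal]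
  · refine lintegral_congr fun u => ?_
    rw [ENNReal.ofReal_pow (realQuantile_nonneg _ _)]
  · exact (integrable_realQuantile_sq hQ hQ2).mono_set (Set.Ioc_subset_Ioc_right ha)
  · exact Filter.Eventually.of_forall fun u => by positivity

/-- A variable whose quantile function is dominated by `Q` has tails dominated by those of `Q`,
regarded as a random variable on `(0, 1]` with Lebesgue measure. -/
lemma tail_le_of_quantile_le (hQ : IsQuantileFunction Q) {Ω : Type*} [MeasurableSpace Ω]
    {μ : Measure Ω} [IsProbabilityMeasure μ] {X : Ω → ℝ}
    (h : ∀ u ∈ Set.Icc (0 : ℝ) 1, quantile μ X u ≤ Q u) {t : ℝ} (ht : 0 ≤ t) :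
    μ {ω | t < X ω} ≤ volume.restrict (Set.Ioc (0 : ℝ) 1) {u | t < realQuantile Q u} := by
  set p := (μ {ω | t < X ω}).toReal with hp
  have hp1 : p ≤ 1 := ENNReal.toReal_le_of_le_ofReal zero_le_one (by simpa using prob_le_one)
  have hsub : Set.Ioo 0 p ⊆ {u | t < realQuantile Q u} := by
    intro u hu
    have hu1 : u ∈ Set.Ioc (0 : ℝ) 1 := ⟨hu.1, hu.2.le.trans hp1⟩
    have hlt : ENNReal.ofReal t < Q u := by
      refine lt_of_lt_of_le ?_ (h u ⟨hu1.1.le, hu1.2⟩)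
      rw [← not_le, quantile_le_ofReal_iff ht, not_le,
        ENNReal.ofReal_lt_iff_lt_toReal hu.1.le (measure_ne_top _ _)]
      exact hu.2
    exact (ENNReal.ofReal_lt_iff_lt_toReal ht (hQ.ne_top hu1)).1 hlt
  calc μ {ω | t < X ω} = ENNReal.ofReal p := by rw [hp, ENNReal.ofReal_toReal (measure_ne_top _ _)]
    _ = volume.restrict (Set.Ioc (0 : ℝ) 1) (Set.Ioo 0 p) := by
        rw [Measure.restrict_apply measurableSet_Ioo, Set.inter_eq_left.2, Real.volume_Ioo,
          sub_zero]
        exact fun u hu => ⟨hu.1, hu.2.le.trans hp1⟩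
    _ ≤ _ := measure_mono hsub

lemma integral_excess_le (hQ : IsQuantileFunction Q)
    (hQ2 : ∫⁻ u in Set.Icc (0 : ℝ) 1, Q u ^ 2 < ∞) {Ω : Type*} [MeasurableSpace Ω]
    {μ : Measure Ω} [IsProbabilityMeasure μ] {X : Ω → ℝ} (hX : AEMeasurable X μ)
    (h : ∀ u ∈ Set.Icc (0 : ℝ) 1, quantile μ X u ≤ Q u) {m : ℝ} (hm : 0 ≤ m) :
    Integrable (fun ω => max (X ω - m) 0) μ ∧
      ∫ ω, max (X ω - m) 0 ∂μ ≤ ∫ u in Set.Ioc 0 1, max (realQuantile Q u - m) 0 := by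
  have hle := lintegral_le_of_tail_le (μ := μ) (ν := volume.restrict (Set.Ioc (0 : ℝ) 1))
    (X := fun ω => max (X ω - m) 0) (Y := fun u => max (realQuantile Q u - m) 0)
    ((hX.sub_const m).max aemeasurable_const)
    (((aemeasurable_realQuantile hQ).sub_const m).max aemeasurable_const)
    (fun _ => le_max_right _ _) (fun _ => le_max_right _ _) (fun t ht => by
      have := tail_le_of_quantile_le hQ h (t := m + t) (by positivity)
      have e : ∀ z : ℝ, t < max (z - m) 0 ↔ m + t < z := fun z => by
        rw [lt_max_iff, lt_sub_iff_add_lt', or_iff_left (not_lt.2 ht.le)]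
      simpa only [e] using this)
  have hint : Integrable (fun u => max (realQuantile Q u - m) 0)
      (volume.restrict (Set.Ioc (0 : ℝ) 1)) :=
    ((integrable_realQuantile hQ hQ2).sub (integrable_const m)).pos_part
  have hint' : Integrable (fun ω => max (X ω - m) 0) μ := by
    refine ⟨((hX.sub_const m).max aemeasurable_const).aestronglyMeasurable, ?_⟩
    rw [hasFiniteIntegral_iff_ofReal
      (Filter.Eventually.of_forall fun ω => le_max_right (X ω - m) 0)]
    exact hle.trans_lt ((hasFiniteIntegral_iff_ofReal
      (Filter.Eventually.of_forall fun u => le_max_right _ _)).1 hint.2)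
  refine ⟨hint', ?_⟩
  rw [← ofReal_integral_eq_lintegral_ofReal hint'
    (Filter.Eventually.of_forall fun u => le_max_right _ _),
    ← ofReal_integral_eq_lintegral_ofReal hint
    (Filter.Eventually.of_forall fun u => le_max_right _ _)] at hle
  exact (ENNReal.ofReal_le_ofReal_iff (integral_nonneg fun u => le_max_right _ _)).1 hle

lemma integrable_excess_sq (hQ : IsQuantileFunction Q)
    (hQ2 : ∫⁻ u in Set.Icc (0 : ℝ) 1, Q u ^ 2 < ∞) {m : ℝ} (hm : 0 ≤ m) :
    Integrable (fun u => max (realQuantile Q u - m) 0 ^ 2)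
      (volume.restrict (Set.Ioc (0 : ℝ) 1)) := by
  refine Integrable.mono' (integrable_realQuantile_sq hQ hQ2)
    ((((aemeasurable_realQuantile hQ).sub_const m).max aemeasurable_const).pow_const
      2).aestronglyMeasurable (Filter.Eventually.of_forall fun u => ?_)
  rw [Real.norm_of_nonneg (by positivity)]
  exact pow_le_pow_left₀ (le_max_right _ _)
    (max_le (by linarith) (realQuantile_nonneg _ _)) 2

lemma integral_excess_sq_le (hQ : IsQuantileFunction Q)
    (hQ2 : ∫⁻ u in Set.Icc (0 : ℝ) 1, Q u ^ 2 < ∞) {Ω : Type*} [MeasurableSpace Ω]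
    {μ : Measure Ω} [IsProbabilityMeasure μ] {X : Ω → ℝ} (hX : AEMeasurable X μ)
    (h : ∀ u ∈ Set.Icc (0 : ℝ) 1, quantile μ X u ≤ Q u) {m : ℝ} (hm : 0 ≤ m) :
    Integrable (fun ω => max (X ω - m) 0 ^ 2) μ ∧
      ∫ ω, max (X ω - m) 0 ^ 2 ∂μ ≤ ∫ u in Set.Ioc 0 1, max (realQuantile Q u - m) 0 ^ 2 := by
  have hle := lintegral_le_of_tail_le (μ := μ) (ν := volume.restrict (Set.Ioc (0 : ℝ) 1))
    (X := fun ω => max (X ω - m) 0 ^ 2) (Y := fun u => max (realQuantile Q u - m) 0 ^ 2)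
    (((hX.sub_const m).max aemeasurable_const).pow_const 2)
    ((((aemeasurable_realQuantile hQ).sub_const m).max aemeasurable_const).pow_const 2)
    (fun _ => by positivity) (fun _ => by positivity) (fun t ht => by
      have := tail_le_of_quantile_le hQ h (t := m + √t) (by positivity)
      have e : ∀ z : ℝ, t < max (z - m) 0 ^ 2 ↔ m + √t < z := fun z => by
        rw [← Real.sqrt_lt_sqrt_iff ht.le, Real.sqrt_sq (le_max_right _ _),
          lt_max_iff, lt_sub_iff_add_lt', or_iff_left (not_lt.2 (Real.sqrt_nonneg t))]
      simpa only [e] using this)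
  have hint := integrable_excess_sq hQ hQ2 hm
  have hint' : Integrable (fun ω => max (X ω - m) 0 ^ 2) μ := by
    refine ⟨(((hX.sub_const m).max aemeasurable_const).pow_const 2).aestronglyMeasurable, ?_⟩
    rw [hasFiniteIntegral_iff_ofReal (Filter.Eventually.of_forall fun u => by positivity)]
    exact hle.trans_lt ((hasFiniteIntegral_iff_ofReal
      (Filter.Eventually.of_forall fun u => by positivity)).1 hint.2)
  refine ⟨hint', ?_⟩
  rw [← ofReal_integral_eq_lintegral_ofReal hint'
    (Filter.Eventually.of_forall fun u => by positivity),
    ← ofReal_integral_eq_lintegral_ofReal hint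
    (Filter.Eventually.of_forall fun u => by positivity)] at hle
  exact (ENNReal.ofReal_le_ofReal_iff (integral_nonneg fun u => by positivity)).1 hle

/-- Above the level `m = Q(v)`, a quantile function is only seen on `(0, v]`. -/
lemma integral_comp_excess (hQ : IsQuantileFunction Q) {v : ℝ} (hv : v ∈ Set.Icc (0 : ℝ) 1)
    (hvt : Q v ≠ ∞) {G : ℝ → ℝ} (hG : G 0 = 0) :
    ∫ u in Set.Ioc 0 1, G (max (realQuantile Q u - realQuantile Q v) 0)
      = ∫ u in Set.Ioc 0 v, G (realQuantile Q u - realQuantile Q v) := by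
  rw [setIntegral_eq_of_subset_of_forall_sdiff_eq_zero measurableSet_Ioc
    (Set.Ioc_subset_Ioc_right hv.2)]
  · refine setIntegral_congr_fun measurableSet_Ioc fun u hu => ?_
    have : realQuantile Q v ≤ realQuantile Q u :=
      realQuantile_le_of_le hQ ⟨hu.1.le, hu.2.trans hv.2⟩ (hQ.ne_top ⟨hu.1, hu.2.trans hv.2⟩)
        hv.2 hu.2
    rw [max_eq_left (by linarith)]
  · intro u hu
    have hvu : v ≤ u := by
      by_contra hlt
      exact hu.2 ⟨hu.1.1, (not_le.1 hlt).le⟩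
    rw [max_eq_right, hG]
    linarith [realQuantile_le_of_le hQ hv hvt hu.1.2 hvu]

lemma integral_excess_eq (hQ : IsQuantileFunction Q)
    (hQ2 : ∫⁻ u in Set.Icc (0 : ℝ) 1, Q u ^ 2 < ∞) {v : ℝ} (hv : v ∈ Set.Icc (0 : ℝ) 1)
    (hvt : Q v ≠ ∞) :
    ∫ u in Set.Ioc 0 1, max (realQuantile Q u - realQuantile Q v) 0
      = (∫ u in Set.Ioc 0 v, realQuantile Q u) - realQuantile Q v * v := by
  have h1 := (integrable_realQuantile hQ hQ2).mono_set (Set.Ioc_subset_Ioc_right hv.2)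
  rw [integral_comp_excess hQ hv hvt (G := fun z => z) rfl,
    integral_sub h1 (integrable_const _)]
  simp [hv.1, mul_comm]

lemma integral_excess_sq_eq (hQ : IsQuantileFunction Q)
    (hQ2 : ∫⁻ u in Set.Icc (0 : ℝ) 1, Q u ^ 2 < ∞) {v : ℝ} (hv : v ∈ Set.Icc (0 : ℝ) 1)
    (hvt : Q v ≠ ∞) :
    ∫ u in Set.Ioc 0 1, max (realQuantile Q u - realQuantile Q v) 0 ^ 2
      = (∫ u in Set.Ioc 0 v, realQuantile Q u ^ 2)
        - 2 * realQuantile Q v * (∫ u in Set.Ioc 0 v, realQuantile Q u)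
        + realQuantile Q v ^ 2 * v := by
  have h1 := (integrable_realQuantile hQ hQ2).mono_set (Set.Ioc_subset_Ioc_right hv.2)
  have h2 := (integrable_realQuantile_sq hQ hQ2).mono_set (Set.Ioc_subset_Ioc_right hv.2)
  rw [integral_comp_excess hQ hv hvt (G := fun z => z ^ 2) (by simp)]
  have e : ∀ u, (realQuantile Q u - realQuantile Q v) ^ 2
      = (realQuantile Q u ^ 2 - 2 * realQuantile Q v * realQuantile Q u)
        + realQuantile Q v ^ 2 := fun u => by ring
  simp only [e]
  have h3 : IntegrableOn (fun u => realQuantile Q u ^ 2 - 2 * realQuantile Q v * realQuantile Q u)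
      (Set.Ioc 0 v) := h2.sub (h1.const_mul _)
  rw [integral_add h3 (integrable_const _), integral_sub h2 (h1.const_mul _), integral_const_mul]
  simp [hv.1, mul_comm]

lemma mul_le_integral_realQuantile (hQ : IsQuantileFunction Q)
    (hQ2 : ∫⁻ u in Set.Icc (0 : ℝ) 1, Q u ^ 2 < ∞) {v : ℝ} (hv : v ∈ Set.Icc (0 : ℝ) 1)
    (hvt : Q v ≠ ∞) :
    realQuantile Q v * v ≤ ∫ u in Set.Ioc 0 v, realQuantile Q u := by
  have := integral_excess_eq hQ hQ2 hv hvt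
  have h0 : 0 ≤ ∫ u in Set.Ioc 0 1, max (realQuantile Q u - realQuantile Q v) 0 :=
    integral_nonneg fun u => le_max_right _ _
  linarith

/-- `Q ≥ Q(v)` on `(0, v]`. -/
lemma mul_integral_le_integral_sq (hQ : IsQuantileFunction Q)
    (hQ2 : ∫⁻ u in Set.Icc (0 : ℝ) 1, Q u ^ 2 < ∞) {v : ℝ} (hv : v ∈ Set.Icc (0 : ℝ) 1) :
    realQuantile Q v * (∫ u in Set.Ioc 0 v, realQuantile Q u)
      ≤ ∫ u in Set.Ioc 0 v, realQuantile Q u ^ 2 := by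
  have h1 := (integrable_realQuantile hQ hQ2).mono_set (Set.Ioc_subset_Ioc_right hv.2)
  have h2 := (integrable_realQuantile_sq hQ hQ2).mono_set (Set.Ioc_subset_Ioc_right hv.2)
  rw [← integral_const_mul]
  refine setIntegral_mono_on (h1.const_mul _) h2 measurableSet_Ioc fun u hu => ?_
  have : realQuantile Q v ≤ realQuantile Q u :=
    realQuantile_le_of_le hQ ⟨hu.1.le, hu.2.trans hv.2⟩ (hQ.ne_top ⟨hu.1, hu.2.trans hv.2⟩)
      hv.2 hu.2
  rw [sq]
  exact mul_le_mul_of_nonneg_right this (realQuantile_nonneg _ _)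

end

/-! ### The block length attached to a quantile function -/

/-- The truncated mixing time `min {q : α₂(q) ≤ u} ∧ n`. -/
noncomputable def blockLength (α₂ : ℕ → ℝ≥0∞) (n : ℕ) (u : ℝ) : ℕ :=
  ((⨅ q ∈ {q : ℕ | α₂ q ≤ ENNReal.ofReal u}, (q : ℕ∞)) ⊓ (n : ℕ∞)).toNat

lemma coe_blockLength (α₂ : ℕ → ℝ≥0∞) (n : ℕ) (u : ℝ) :
    (blockLength α₂ n u : ℕ∞) = (⨅ q ∈ {q : ℕ | α₂ q ≤ ENNReal.ofReal u}, (q : ℕ∞)) ⊓ (n : ℕ∞) :=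
  ENat.natCast_toNat (ne_top_of_le_ne_top (ENat.natCast_ne_top n) inf_le_right)

lemma R_eq (α₂ : ℕ → ℝ≥0∞) (n : ℕ) (Q : ℝ → ℝ≥0∞) (u : ℝ) :
    R α₂ n Q u = blockLength α₂ n u * Q u := by
  rw [R, ← coe_blockLength]
  simp

lemma blockLength_le (α₂ : ℕ → ℝ≥0∞) (n : ℕ) (u : ℝ) : blockLength α₂ n u ≤ n := by
  have : (blockLength α₂ n u : ℕ∞) ≤ n := by rw [coe_blockLength]; exact inf_le_right
  exact_mod_cast this

lemma le_blockLength_iff {α₂ : ℕ → ℝ≥0∞} {n : ℕ} {u : ℝ} {k : ℕ} :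
    k ≤ blockLength α₂ n u ↔ k ≤ n ∧ ∀ q, α₂ q ≤ ENNReal.ofReal u → k ≤ q := by
  have : k ≤ blockLength α₂ n u ↔ (k : ℕ∞) ≤ blockLength α₂ n u := by norm_cast
  rw [this, coe_blockLength, le_inf_iff, le_iInf₂_iff, and_comm]
  simp

/-- Before the cut-off `n`, the mixing coefficient at the block length is at most `u`. -/
lemma coeff_blockLength_le {α₂ : ℕ → ℝ≥0∞} {n : ℕ} {u : ℝ} (hα : Antitone α₂)
    (h : blockLength α₂ n u < n) : α₂ (blockLength α₂ n u) ≤ ENNReal.ofReal u := by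
  by_contra hcon
  have : blockLength α₂ n u + 1 ≤ blockLength α₂ n u := by
    refine le_blockLength_iff.2 ⟨h, fun q hq => ?_⟩
    by_contra hlt
    exact hcon ((hα (by omega)).trans hq)
  omega

/-- The infimum defining `S` is attained. The set is nonempty because `Q 1 = 0`. -/
lemma S_mem {α₂ : ℕ → ℝ≥0∞} {n : ℕ} {Q : ℝ → ℝ≥0∞} (hQ : IsQuantileFunction Q)
    (hα : Antitone α₂) (c : ℝ) :
    S α₂ n Q c ∈ Set.Icc (0 : ℝ) 1 ∧ R α₂ n Q (S α₂ n Q c) ≤ ENNReal.ofReal c := by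
  set A := {u : ℝ | u ∈ Set.Icc (0 : ℝ) 1 ∧ R α₂ n Q u ≤ ENNReal.ofReal c} with hA
  have hne : A.Nonempty := ⟨1, by simp [hA, R_eq, hQ.apply_one]⟩
  have hbdd : BddBelow A := ⟨0, fun u hu => hu.1.1⟩
  set v := S α₂ n Q c with hv
  have hvA : v = sInf A := rfl
  have hv01 : v ∈ Set.Icc (0 : ℝ) 1 :=
    ⟨le_csInf hne fun u hu => hu.1.1, (csInf_le_of_le hbdd hne.some_mem hne.some_mem.1.2)⟩
  refine ⟨hv01, ?_⟩
  rw [R_eq]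
  -- Both factors are lower semicontinuous from the right at `v`, the first one because the mixing
  -- time at `u` exceeds `k` exactly when `u < α₂ k`.
  refine ENNReal.mul_le_of_forall_lt fun a ha b hb => ?_
  obtain ⟨w, hvw, hw⟩ := hQ.exists_lt_of_lt hv01 hb
  obtain ⟨w', hvw', hw'⟩ : ∃ w', v < w' ∧ ∀ u, u < w' →
      blockLength α₂ n v ≤ blockLength α₂ n u := by
    rcases Nat.eq_zero_or_pos (blockLength α₂ n v) with h0 | hpos
    · exact ⟨v + 1, by linarith, fun u _ => by omega⟩
    obtain ⟨k, hk⟩ : ∃ k, blockLength α₂ n v = k + 1 := ⟨_, (Nat.succ_pred_eq_of_pos hpos).symm⟩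
    have hlt : ENNReal.ofReal v < α₂ k := by
      by_contra hle
      have := (le_blockLength_iff.1 hk.ge).2 k (not_lt.1 hle)
      omega
    obtain ⟨z, hz1, hz2⟩ := ENNReal.lt_iff_exists_nnreal_btwn.1 hlt
    refine ⟨z, ?_, fun u hu => ?_⟩
    · rw [← ENNReal.ofReal_coe_nnreal] at hz1
      exact (ENNReal.ofReal_lt_ofReal_iff_of_nonneg hv01.1).1 hz1
    · rw [hk]
      refine le_blockLength_iff.2 ⟨hk ▸ blockLength_le _ _ _, fun q hq => ?_⟩
      by_contra hlt'
      have h1 : α₂ k ≤ ENNReal.ofReal u := (hα (by omega)).trans hq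
      have h2 : ENNReal.ofReal u ≤ z := by
        rw [← ENNReal.ofReal_coe_nnreal]; exact ENNReal.ofReal_le_ofReal hu.le
      exact absurd (h1.trans h2) (not_le.2 hz2)
  obtain ⟨u, huA, hu⟩ := exists_lt_of_csInf_lt hne (lt_min hvw hvw' : sInf A < min w w')
  calc a * b ≤ blockLength α₂ n u * Q u := by
        refine mul_le_mul' (ha.le.trans ?_) (hw u huA.1 (hu.trans_le (min_le_left _ _))).le
        exact_mod_cast hw' u (hu.trans_le (min_le_right _ _))
    _ = R α₂ n Q u := (R_eq _ _ _ _).symm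
    _ ≤ _ := huA.2

/-! ### The Bennett rate function -/

/-- Doubling the argument of `h` costs a constant factor, which makes room for the variance `3s²`
in place of `s²` in Freedman's inequality. -/
lemma h_two_mul_le {t : ℝ} (ht : 0 ≤ t) : h (2 * t) ≤ 6 * h t := by
  unfold h
  have h1 : Real.log (1 + 2 * t) ≤ 2 * Real.log (1 + t) := by
    have : 2 * Real.log (1 + t) = Real.log ((1 + t) ^ 2) := by
      rw [Real.log_pow]; norm_num
    rw [this]
    exact Real.log_le_log (by positivity) (by nlinarith)
  have h2 : 2 * t ≤ (t + 2) * Real.log (1 + t) := by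
    have := Real.le_log_one_add_of_nonneg ht
    rw [div_le_iff₀ (by positivity)] at this
    linarith
  nlinarith [mul_le_mul_of_nonneg_left h1 (by positivity : 0 ≤ 1 + 2 * t)]

/-! ### Functions with order-connected level sets -/

/-- The superlevel sets of the positive and negative parts of `g` are order connected. This holds
for every function that is monotonic on an interval and null elsewhere, is stable under truncation,
and is all that is used about such functions. -/
def OrdLevels (g : ℝ → ℝ) : Prop :=
  ∀ t, 0 ≤ t → {y | t < g y}.OrdConnected ∧ {y | t < -g y}.OrdConnected

lemma OrdLevels.neg {g : ℝ → ℝ} (hg : OrdLevels g) : OrdLevels (fun y => -g y) := fun t ht =>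
  ⟨(hg t ht).2, by simpa only [neg_neg] using (hg t ht).1⟩

lemma ordConnected_of_monotoneOn {g : ℝ → ℝ} {I : Set ℝ} (hI : I.OrdConnected)
    (hg : MonotoneOn g I) (h0 : ∀ y ∉ I, g y = 0) {t : ℝ} (ht : 0 ≤ t) :
    {y | t < g y}.OrdConnected := by
  have hmem : ∀ y, t < g y → y ∈ I := fun y hy => by
    by_contra hyI
    rw [h0 y hyI] at hy
    exact absurd hy (not_lt.2 ht)
  refine ⟨fun y hy z hz w hw => ?_⟩
  exact lt_of_lt_of_le hy (hg (hmem y hy) (hI.out (hmem y hy) (hmem z hz) hw) hw.1)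

lemma ordConnected_of_antitoneOn {g : ℝ → ℝ} {I : Set ℝ} (hI : I.OrdConnected)
    (hg : AntitoneOn g I) (h0 : ∀ y ∉ I, g y = 0) {t : ℝ} (ht : 0 ≤ t) :
    {y | t < g y}.OrdConnected := by
  have hmem : ∀ y, t < g y → y ∈ I := fun y hy => by
    by_contra hyI
    rw [h0 y hyI] at hy
    exact absurd hy (not_lt.2 ht)
  refine ⟨fun y hy z hz w hw => ?_⟩
  exact lt_of_lt_of_le hz (hg (hI.out (hmem y hy) (hmem z hz) hw) (hmem z hz) hw.2)

lemma MonClass.ordLevels {Q : ℝ → ℝ≥0∞} {μ : Measure ℝ} {g : ℝ → ℝ} (hg : g ∈ MonClass Q μ) :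
    OrdLevels g := by
  obtain ⟨⟨I, -, hI, hmono, h0⟩, -⟩ := hg
  have h0' : ∀ y ∉ I, -g y = 0 := fun y hy => by simp [h0 y hy]
  intro t ht
  rcases hmono with hm | hm
  · exact ⟨ordConnected_of_monotoneOn hI hm h0 ht, ordConnected_of_antitoneOn hI hm.neg h0' ht⟩
  · exact ⟨ordConnected_of_antitoneOn hI hm h0 ht, ordConnected_of_monotoneOn hI hm.neg h0' ht⟩

lemma OrdLevels.measurable {g : ℝ → ℝ} (hg : OrdLevels g) : Measurable g := by
  have key : ∀ f : ℝ → ℝ, OrdLevels f → Measurable fun y => max (f y) 0 := by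
    intro f hf
    refine measurable_of_Ioi fun t => ?_
    rcases le_or_gt 0 t with ht | ht
    · convert (hf t ht).1.measurableSet using 1
      ext y
      simp [not_lt.2 ht]
    · convert MeasurableSet.univ using 1
      ext y
      simp [ht]
  have : g = fun y => max (g y) 0 - max (-g y) 0 := by
    ext y
    rcases le_total 0 (g y) with h | h
    · rw [max_eq_left h, max_eq_right (by linarith), sub_zero]
    · rw [max_eq_right h, max_eq_left (by linarith)]; ring
  rw [this]
  exact (key g hg).sub (key _ hg.neg)

/-- Truncation of a real number at the levels `m` and `-m`. -/
noncomputable def clip (m y : ℝ) : ℝ := max (-m) (min y m)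

lemma abs_clip_le {m : ℝ} (hm : 0 ≤ m) (y : ℝ) : |clip m y| ≤ m :=
  abs_le.2 ⟨le_max_left _ _, max_le (by linarith) (min_le_right _ _)⟩

lemma abs_sub_clip {m : ℝ} (hm : 0 ≤ m) (y : ℝ) : |y - clip m y| = max (|y| - m) 0 := by
  unfold clip
  grind

lemma abs_clip_sub_clip_le {m M : ℝ} (hm : 0 ≤ m) (hM : m ≤ M) (y : ℝ) :
    |clip M y - clip m y| ≤ max (|y| - m) 0 := by
  unfold clip
  grind

lemma measurable_clip (m : ℝ) : Measurable (clip m) :=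
  measurable_const.max (measurable_id.min measurable_const)

lemma OrdLevels.clip {g : ℝ → ℝ} (hg : OrdLevels g) {m : ℝ} (hm : 0 ≤ m) :
    OrdLevels fun y => clip m (g y) := by
  intro t ht
  have h1 : ∀ y, t < FukNagaev.clip m (g y) ↔ t < g y ∧ t < m := fun y => by
    unfold FukNagaev.clip; grind
  have h2 : ∀ y, t < -FukNagaev.clip m (g y) ↔ t < -g y ∧ t < m := fun y => by
    unfold FukNagaev.clip; grind
  simp only [h1, h2]
  by_cases htm : t < m
  · simpa only [htm, and_true] using hg t ht
  · simpa only [htm, and_false] using ⟨Set.ordConnected_empty, Set.ordConnected_empty⟩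

/-! ### From half-lines to functions with order-connected levels -/

section Levels

variable {Ω : Type*} [MeasurableSpace Ω] {P : Measure Ω} {Z : Ω → ℝ} {K : ℝ}

lemma abs_setIntegral_lowerSet_le {Y : Ω → ℝ} (hY : Measurable Y) (hZ : Integrable Z P)
    (hK : ∀ t, |∫ ω in {ω | Y ω ≤ t}, Z ω ∂P| ≤ K) {L : Set ℝ} (hL : IsLowerSet L) :
    |∫ ω in Y ⁻¹' L, Z ω ∂P| ≤ K := by
  have hK0 : 0 ≤ K := (abs_nonneg _).trans (hK 0)
  -- A lower set that is not a closed half-line is a countable increasing union of such.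
  have key : ∀ s : ℕ → ℝ, Monotone s → L = ⋃ k, Set.Iic (s k) → |∫ ω in Y ⁻¹' L, Z ω ∂P| ≤ K := by
    intro s hs hLs
    have hlim := tendsto_setIntegral_of_monotone (μ := P) (f := Z)
      (s := fun k => Y ⁻¹' Set.Iic (s k)) (fun k => hY measurableSet_Iic)
      (fun a b hab => Set.preimage_mono (Set.Iic_subset_Iic.2 (hs hab))) hZ.integrableOn
    rw [← Set.preimage_iUnion, ← hLs] at hlim
    exact le_of_tendsto hlim.abs (Filter.Eventually.of_forall fun k => hK (s k))
  rcases L.eq_empty_or_nonempty with hemp | hne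
  · simpa [hemp] using hK0
  by_cases hb : BddAbove L
  · by_cases hmem : sSup L ∈ L
    · have : L = Set.Iic (sSup L) :=
        Set.Subset.antisymm (fun y hy => le_csSup hb hy) fun y hy => hL hy hmem
      rw [this]
      exact hK _
    · refine key (fun k => sSup L - 1 / ((k : ℝ) + 1)) (fun a b hab => ?_) ?_
      · have : 1 / ((b : ℝ) + 1) ≤ 1 / ((a : ℝ) + 1) := Nat.one_div_le_one_div hab
        simp only
        linarith
      · ext y
        simp only [Set.mem_iUnion, Set.mem_Iic]
        constructor
        · intro hy
          have hlt : y < sSup L := lt_of_le_of_ne (le_csSup hb hy) fun h => hmem (h ▸ hy)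
          obtain ⟨k, hk⟩ := exists_nat_one_div_lt (sub_pos.2 hlt)
          exact ⟨k, by linarith⟩
        · rintro ⟨k, hk⟩
          have hpos : 0 < 1 / ((k : ℝ) + 1) := by positivity
          obtain ⟨z, hz, hyz⟩ := exists_lt_of_lt_csSup hne (by linarith : y < sSup L)
          exact hL hyz.le hz
  · refine key (fun k => k) Nat.mono_cast ?_
    ext y
    simp only [Set.mem_iUnion, Set.mem_Iic]
    refine ⟨fun _ => exists_nat_ge y, fun _ => ?_⟩
    obtain ⟨z, hz, hyz⟩ := not_bddAbove_iff.1 hb y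
    exact hL hyz.le hz

/-- An order-connected set is the difference of two lower sets, whence the factor `2`. -/
lemma abs_setIntegral_ordConnected_le {Y : Ω → ℝ} (hY : Measurable Y) (hZ : Integrable Z P)
    (hK : ∀ t, |∫ ω in {ω | Y ω ≤ t}, Z ω ∂P| ≤ K) {J : Set ℝ} (hJ : J.OrdConnected) :
    |∫ ω in Y ⁻¹' J, Z ω ∂P| ≤ 2 * K := by
  set L₁ : Set ℝ := {x | ∃ y ∈ J, x ≤ y} with hL₁
  set L₂ : Set ℝ := L₁ \ J with hL₂
  have h1 : IsLowerSet L₁ := by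
    rintro a b hba ⟨y, hy, hay⟩
    exact ⟨y, hy, hba.trans hay⟩
  have h2 : IsLowerSet L₂ := by
    rintro a b hba ⟨ha, haJ⟩
    refine ⟨h1 hba ha, fun hbJ => haJ ?_⟩
    obtain ⟨y, hy, hay⟩ := ha
    exact hJ.out hbJ hy ⟨hba, hay⟩
  have hJ' : J = L₁ \ L₂ := by
    rw [hL₂, sdiff_sdiff_right_self]
    ext y
    exact ⟨fun hy => ⟨⟨y, hy, le_rfl⟩, hy⟩, fun hy => hy.2⟩
  have hdiff : ∫ ω in Y ⁻¹' J, Z ω ∂P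
      = (∫ ω in Y ⁻¹' L₁, Z ω ∂P) - ∫ ω in Y ⁻¹' L₂, Z ω ∂P := by
    rw [hJ', Set.preimage_sdiff]
    exact setIntegral_sdiff (hY h2.ordConnected.measurableSet) hZ.integrableOn
      (Set.preimage_mono Set.sdiff_subset)
  rw [hdiff]
  refine (abs_sub _ _).trans ?_
  have := abs_setIntegral_lowerSet_le hY hZ hK h1
  have := abs_setIntegral_lowerSet_le hY hZ hK h2
  linarith

/-- Layer-cake: a bound for the integrals of `Z` over the superlevel sets of `W ≥ 0` gives a bound
for the integral of `Z W`. -/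
lemma abs_integral_mul_le_of_superlevel [SFinite P] (hZ : Integrable Z P) {W : Ω → ℝ}
    (hW : Measurable W) {M : ℝ} (hW0 : ∀ ω, 0 ≤ W ω) (hWM : ∀ ω, W ω ≤ M) (hM : 0 ≤ M)
    (hK : ∀ t, 0 ≤ t → |∫ ω in {ω | t < W ω}, Z ω ∂P| ≤ K) :
    |∫ ω, Z ω * W ω ∂P| ≤ M * K := by
  have hset : MeasurableSet {p : Ω × ℝ | p.2 < W p.1} :=
    measurableSet_lt measurable_snd (hW.comp measurable_fst)
  have hpt : ∀ ω, Z ω * W ω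
      = ∫ t in Set.Ioc 0 M, {p : Ω × ℝ | p.2 < W p.1}.indicator (fun p => Z p.1) (ω, t) := by
    intro ω
    have : ∀ t, {p : Ω × ℝ | p.2 < W p.1}.indicator (fun p => Z p.1) (ω, t)
        = (Set.Iio (W ω)).indicator (fun _ => Z ω) t := fun t => by
      simp [Set.indicator_apply]
    simp only [this]
    rw [integral_indicator measurableSet_Iio, Measure.restrict_restrict measurableSet_Iio,
      setIntegral_const, smul_eq_mul, mul_comm]
    congr 1
    have : Set.Iio (W ω) ∩ Set.Ioc 0 M = Set.Ioo 0 (W ω) := by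
      ext t
      simp only [Set.mem_inter_iff, Set.mem_Iio, Set.mem_Ioc, Set.mem_Ioo]
      exact ⟨fun h => ⟨h.2.1, h.1⟩, fun h => ⟨h.2, h.1, h.2.le.trans (hWM ω)⟩⟩
    rw [this]
    simp [Measure.real, hW0 ω]
  have hint : Integrable (Function.uncurry fun ω t =>
      {p : Ω × ℝ | p.2 < W p.1}.indicator (fun p => Z p.1) (ω, t))
      (P.prod (volume.restrict (Set.Ioc 0 M))) := by
    have : Integrable (fun p : Ω × ℝ => Z p.1) (P.prod (volume.restrict (Set.Ioc 0 M))) :=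
      hZ.comp_fst _
    exact this.indicator hset
  simp only [hpt]
  rw [integral_integral_swap hint]
  have hb := norm_setIntegral_le_of_norm_le_const (μ := volume) (s := Set.Ioc 0 M) (C := K)
    (f := fun t => ∫ ω, {p : Ω × ℝ | p.2 < W p.1}.indicator (fun p => Z p.1) (ω, t) ∂P)
    (by simp) (fun t ht => by
      have e : ∀ ω, {p : Ω × ℝ | p.2 < W p.1}.indicator (fun p => Z p.1) (ω, t)
          = {ω | t < W ω}.indicator Z ω := fun ω => by simp [Set.indicator_apply]
      simp only [e]
      rw [integral_indicator (measurableSet_lt measurable_const hW)]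
      exact hK t ht.1.le)
  rw [Real.norm_eq_abs] at hb
  refine hb.trans (le_of_eq ?_)
  simp [Measure.real, hM, mul_comm]

/-- The factor `2` comes from treating the positive and the negative part of `g` separately. -/
lemma OrdLevels.abs_integral_mul_le [SFinite P] {Y : Ω → ℝ} (hY : Measurable Y)
    (hZ : Integrable Z P) {g : ℝ → ℝ} (hg : OrdLevels g) {M : ℝ} (hM : 0 ≤ M)
    (hgM : ∀ y, |g y| ≤ M)
    (hK : ∀ J : Set ℝ, J.OrdConnected → |∫ ω in Y ⁻¹' J, Z ω ∂P| ≤ K) :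
    |∫ ω, Z ω * g (Y ω) ∂P| ≤ 2 * M * K := by
  have key : ∀ f : ℝ → ℝ, OrdLevels f → (∀ y, |f y| ≤ M) →
      |∫ ω, Z ω * max (f (Y ω)) 0 ∂P| ≤ M * K := by
    intro f hf hfM
    refine abs_integral_mul_le_of_superlevel (W := fun ω => max (f (Y ω)) 0) hZ
      ((hf.measurable.comp hY).max measurable_const)
      (fun _ => le_max_right _ _) (fun ω => max_le (abs_le.1 (hfM _)).2 hM) hM fun t ht => ?_
    have : {ω | t < max (f (Y ω)) 0} = Y ⁻¹' {y | t < f y} := by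
      ext ω
      simp [not_lt.2 ht]
    rw [this]
    exact hK _ (hf t ht).1
  have hint : ∀ f : ℝ → ℝ, OrdLevels f → (∀ y, |f y| ≤ M) →
      Integrable (fun ω => Z ω * max (f (Y ω)) 0) P := by
    intro f hf hfM
    refine hZ.mul_bdd (c := M) ((hf.measurable.comp hY).max measurable_const).aestronglyMeasurable
      (Filter.Eventually.of_forall fun ω => ?_)
    rw [Real.norm_of_nonneg (le_max_right _ _)]
    exact max_le (abs_le.1 (hfM _)).2 hM
  have hneg : ∀ y, |(-g y)| ≤ M := fun y => by rw [abs_neg]; exact hgM y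
  have hsplit : ∀ ω, Z ω * g (Y ω)
      = Z ω * max (g (Y ω)) 0 - Z ω * max (-g (Y ω)) 0 := fun ω => by
    rw [← mul_sub]
    congr 1
    grind
  simp only [hsplit]
  rw [integral_sub (hint g hg hgM) (hint _ hg.neg hneg)]
  refine (abs_sub _ _).trans ?_
  have := key g hg hgM
  have := key _ hg.neg hneg
  linarith

end Levels

/-! ### Truncated combinations -/

/-- The combination `∑ a_ℓ clip_m(f_ℓ)` of functions truncated at level `m`. -/
noncomputable def clipSum {L : ℕ} (a : Fin L → ℝ) (f : Fin L → ℝ → ℝ) (m y : ℝ) : ℝ :=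
  ∑ l, a l * clip m (f l y)

lemma abs_sum_mul_le {L : ℕ} {a : Fin L → ℝ} (ha : ∑ l, |a l| ≤ 1) {b : Fin L → ℝ} {K : ℝ}
    (hK : 0 ≤ K) (hb : ∀ l, |b l| ≤ K) : |∑ l, a l * b l| ≤ K :=
  calc |∑ l, a l * b l| ≤ ∑ l, |a l * b l| := Finset.abs_sum_le_sum_abs _ _
    _ ≤ ∑ l, |a l| * K := Finset.sum_le_sum fun _ _ => by
        rw [abs_mul]; exact mul_le_mul_of_nonneg_left (hb _) (abs_nonneg _)
    _ ≤ K := by rw [← Finset.sum_mul]; nlinarith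

lemma abs_clipSum_le {L : ℕ} {a : Fin L → ℝ} (ha : ∑ l, |a l| ≤ 1) (f : Fin L → ℝ → ℝ) {m : ℝ}
    (hm : 0 ≤ m) (y : ℝ) : |clipSum a f m y| ≤ m :=
  abs_sum_mul_le ha hm fun _ => abs_clip_le hm _

lemma measurable_clipSum {L : ℕ} (a : Fin L → ℝ) {f : Fin L → ℝ → ℝ} (hf : ∀ l, OrdLevels (f l))
    (m : ℝ) : Measurable (clipSum a f m) := by
  unfold clipSum
  exact Finset.measurable_fun_sum _ fun l _ =>
    ((measurable_clip m).comp (hf l).measurable).const_mul _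

lemma clipSum_abs_integral_mul_le {Ω : Type*} [MeasurableSpace Ω] {P : Measure Ω} [SFinite P]
    {Z : Ω → ℝ} {K : ℝ} {L : ℕ} {a : Fin L → ℝ} (ha : ∑ l, |a l| ≤ 1) {f : Fin L → ℝ → ℝ}
    (hf : ∀ l, OrdLevels (f l)) {m : ℝ} (hm : 0 ≤ m) {Y : Ω → ℝ} (hY : Measurable Y)
    (hZ : Integrable Z P)
    (hK : ∀ J : Set ℝ, J.OrdConnected → |∫ ω in Y ⁻¹' J, Z ω ∂P| ≤ K) :
    |∫ ω, Z ω * clipSum a f m (Y ω) ∂P| ≤ 2 * m * K := by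
  have hK0 : 0 ≤ K := (abs_nonneg _).trans (hK ∅ Set.ordConnected_empty)
  have e : ∀ ω, Z ω * clipSum a f m (Y ω) = ∑ l, a l * (Z ω * clip m (f l (Y ω))) := fun ω => by
    rw [clipSum, Finset.mul_sum]
    exact Finset.sum_congr rfl fun l _ => by ring
  have hint : ∀ l, Integrable (fun ω => Z ω * clip m (f l (Y ω))) P := fun l =>
    hZ.mul_bdd (c := m) ((measurable_clip m).comp ((hf l).measurable.comp hY)).aestronglyMeasurable
      (Filter.Eventually.of_forall fun ω => abs_clip_le hm _)
  simp only [e]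
  rw [integral_finsetSum _ fun l _ => (hint l).const_mul _]
  simp only [integral_const_mul]
  exact abs_sum_mul_le ha (by positivity) fun l =>
    ((hf l).clip hm).abs_integral_mul_le hY hZ hm (fun y => abs_clip_le hm _) hK

/-! ### An exponential inequality for martingales -/

/-- Bennett's bound: `(exp y - 1 - y) / y²` is increasing, which is read off its power series. -/
lemma exp_le_one_add_add_sq {x c θ : ℝ} (hc : 0 < c) (hθ : 0 ≤ θ) (hx : |x| ≤ c) :
    Real.exp (θ * x) ≤ 1 + θ * x + (Real.exp (θ * c) - 1 - θ * c) / c ^ 2 * x ^ 2 := by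
  have hs : ∀ y : ℝ, HasSum (fun k : ℕ => y ^ (k + 2) / (k + 2).factorial)
      (Real.exp y - 1 - y) := fun y => by
    have h := NormedSpace.expSeries_div_hasSum_exp (𝔸 := ℝ) y
    rw [← Real.exp_eq_exp_ℝ, ← hasSum_nat_add_iff' 2] at h
    simpa [Finset.sum_range_succ, sub_sub] using h
  have h1 := hs (θ * x)
  have h2 := (hs (θ * c)).mul_left (x ^ 2 / c ^ 2)
  have := hasSum_le (fun k => ?_) h1 h2
  · have e : (Real.exp (θ * c) - 1 - θ * c) / c ^ 2 * x ^ 2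
      = x ^ 2 / c ^ 2 * (Real.exp (θ * c) - 1 - θ * c) := by ring
    rw [e]
    linarith
  · rw [← mul_div_assoc]
    refine div_le_div_of_nonneg_right ?_ (by positivity)
    have e : x ^ 2 / c ^ 2 * (θ * c) ^ (k + 2) = θ ^ (k + 2) * (x ^ 2 * c ^ k) := by
      field_simp
      ring
    rw [e, mul_pow]
    refine mul_le_mul_of_nonneg_left ?_ (by positivity)
    rw [pow_add, mul_comm (x ^ k)]
    refine mul_le_mul_of_nonneg_left ?_ (sq_nonneg x)
    exact (le_abs_self _).trans (by rw [abs_pow]; exact pow_le_pow_left₀ (abs_nonneg _) hx k)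

section Freedman

variable {Ω : Type*} [mΩ : MeasurableSpace Ω] {P : Measure Ω}

/-- Bounded martingale differences `D` for the filtration `G`, with conditional variances at most
`v`. -/
structure IsBoundedMartingaleDiff (P : Measure Ω) (G : ℕ → MeasurableSpace Ω) (D v : ℕ → Ω → ℝ)
    (c : ℝ) : Prop where
  mono : Monotone G
  le : ∀ l, G l ≤ mΩ
  meas : ∀ l, StronglyMeasurable[G (l + 1)] (D l)
  bdd : ∀ l, ∀ᵐ ω ∂P, |D l ω| ≤ c
  meas_var : ∀ l, StronglyMeasurable[G l] (v l)
  var_nonneg : ∀ l, ∀ᵐ ω ∂P, 0 ≤ v l ω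
  integrable_var : ∀ l, Integrable (v l) P
  condExp_eq : ∀ l, P[D l | G l] =ᵐ[P] 0
  condExp_sq_le : ∀ l, P[fun ω => D l ω ^ 2 | G l] ≤ᵐ[P] v l

variable {G : ℕ → MeasurableSpace Ω} {D v : ℕ → Ω → ℝ} {c : ℝ}

namespace IsBoundedMartingaleDiff

lemma neg (hD : IsBoundedMartingaleDiff P G D v c) :
    IsBoundedMartingaleDiff P G (fun l ω => -D l ω) v c where
  mono := hD.mono
  le := hD.le
  meas l := (hD.meas l).neg
  bdd l := by simpa only [abs_neg] using hD.bdd l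
  meas_var := hD.meas_var
  var_nonneg := hD.var_nonneg
  integrable_var := hD.integrable_var
  condExp_eq l := by
    filter_upwards [condExp_neg (D l) (G l) (μ := P), hD.condExp_eq l] with ω h1 h2
    have e : (fun ω => -D l ω) = -D l := rfl
    rw [e, h1]
    simp [h2]
  condExp_sq_le l := by simpa only [neg_sq] using hD.condExp_sq_le l

variable [IsProbabilityMeasure P]

lemma integrable (hD : IsBoundedMartingaleDiff P G D v c) (l : ℕ) : Integrable (D l) P :=
  Integrable.of_bound ((hD.meas l).mono (hD.le _)).aestronglyMeasurable c (hD.bdd l)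

lemma integrable_sq (hD : IsBoundedMartingaleDiff P G D v c) (l : ℕ) :
    Integrable (fun ω => D l ω ^ 2) P := by
  refine Integrable.of_bound (((hD.meas l).mono (hD.le _)).pow 2).aestronglyMeasurable (c ^ 2) ?_
  filter_upwards [hD.bdd l] with ω hω
  rw [Real.norm_of_nonneg (sq_nonneg _), ← sq_abs]
  exact pow_le_pow_left₀ (abs_nonneg _) hω 2

/-- Multiplication by previsible indicators, which implements stopping. -/
lemma indicator (hD : IsBoundedMartingaleDiff P G D v c) {E : ℕ → Set Ω}
    (hE : ∀ l, MeasurableSet[G l] (E l)) :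
    IsBoundedMartingaleDiff P G (fun l => (E l).indicator (D l)) (fun l => (E l).indicator (v l))
      c where
  mono := hD.mono
  le := hD.le
  meas l := (hD.meas l).indicator (hD.mono l.le_succ _ (hE l))
  bdd l := by
    filter_upwards [hD.bdd l] with ω hω
    by_cases h : ω ∈ E l
    · simpa [h] using hω
    · simpa [h] using (abs_nonneg _).trans hω
  meas_var l := (hD.meas_var l).indicator (hE l)
  var_nonneg l := by
    filter_upwards [hD.var_nonneg l] with ω hω
    exact Set.indicator_apply_nonneg fun _ => hω
  integrable_var l := (hD.integrable_var l).indicator (hD.le l _ (hE l))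
  condExp_eq l := by
    refine (condExp_indicator (hD.integrable l) (hE l)).trans ?_
    filter_upwards [hD.condExp_eq l] with ω hω
    by_cases h : ω ∈ E l <;> simp [h, hω]
  condExp_sq_le l := by
    have e : (fun ω => (E l).indicator (D l) ω ^ 2) = (E l).indicator fun ω => D l ω ^ 2 := by
      ext ω
      by_cases h : ω ∈ E l <;> simp [h]
    rw [e]
    filter_upwards [condExp_indicator (hD.integrable_sq l) (hE l), hD.condExp_sq_le l] with ω h1 h2
    rw [h1]
    exact Set.indicator_le_indicator h2

/-- The exponential supermartingale behind Freedman's inequality has mean at most one. -/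
lemma exp_supermartingale (hD : IsBoundedMartingaleDiff P G D v c) (hc : 0 < c) {θ : ℝ}
    (hθ : 0 ≤ θ) (N : ℕ) :
    Integrable (fun ω => Real.exp (θ * ∑ l ∈ Finset.range N, D l ω
      - (Real.exp (θ * c) - 1 - θ * c) / c ^ 2 * ∑ l ∈ Finset.range N, v l ω)) P ∧
    ∫ ω, Real.exp (θ * ∑ l ∈ Finset.range N, D l ω
      - (Real.exp (θ * c) - 1 - θ * c) / c ^ 2 * ∑ l ∈ Finset.range N, v l ω) ∂P ≤ 1 := by
  set ψ := (Real.exp (θ * c) - 1 - θ * c) / c ^ 2 with hψ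
  have hψ0 : 0 ≤ ψ := by
    have := Real.add_one_le_exp (θ * c)
    exact div_nonneg (by linarith) (by positivity)
  set T : ℕ → Ω → ℝ := fun N ω => Real.exp (θ * ∑ l ∈ Finset.range N, D l ω
      - ψ * ∑ l ∈ Finset.range N, v l ω) with hT
  have hTm : ∀ N, StronglyMeasurable[G N] (T N) := fun N => by
    refine Real.continuous_exp.comp_stronglyMeasurable ?_
    refine (StronglyMeasurable.const_mul ?_ θ).sub (StronglyMeasurable.const_mul ?_ ψ)
    · exact Finset.stronglyMeasurable_fun_sum _ fun l hl =>
        (hD.meas l).mono (hD.mono (Finset.mem_range.1 hl))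
    · exact Finset.stronglyMeasurable_fun_sum _ fun l hl =>
        (hD.meas_var l).mono (hD.mono (Finset.mem_range.1 hl).le)
  have hall : ∀ᵐ ω ∂P, ∀ l, |D l ω| ≤ c ∧ 0 ≤ v l ω :=
    ae_all_iff.2 fun l => (hD.bdd l).and (hD.var_nonneg l)
  have hTb : ∀ N, ∀ᵐ ω ∂P, ‖T N ω‖ ≤ Real.exp (θ * (N * c)) := fun N => by
    filter_upwards [hall] with ω hω
    rw [Real.norm_of_nonneg (Real.exp_pos _).le]
    refine Real.exp_le_exp.2 ?_
    have h1 : ∑ l ∈ Finset.range N, D l ω ≤ N * c := by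
      refine (Finset.sum_le_card_nsmul _ _ c fun l _ => (abs_le.1 (hω l).1).2).trans ?_
      simp
    have h2 : 0 ≤ ψ * ∑ l ∈ Finset.range N, v l ω :=
      mul_nonneg hψ0 (Finset.sum_nonneg fun l _ => (hω l).2)
    have := mul_le_mul_of_nonneg_left h1 hθ
    linarith
  have hTi : ∀ N, Integrable (T N) P := fun N =>
    Integrable.of_bound ((hTm N).mono (hD.le N)).aestronglyMeasurable _ (hTb N)
  refine ⟨hTi N, ?_⟩
  change ∫ ω, T N ω ∂P ≤ 1
  induction N with
  | zero => simp [hT]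
  | succ N ih =>
    refine le_trans ?_ ih
    set W : Ω → ℝ := fun ω => T N ω * Real.exp (-(ψ * v N ω)) with hW
    have hWm : StronglyMeasurable[G N] W :=
      (hTm N).mul (Real.continuous_exp.comp_stronglyMeasurable
        ((hD.meas_var N).const_mul ψ).neg)
    have hWb : ∀ᵐ ω ∂P, ‖W ω‖ ≤ Real.exp (θ * (N * c)) := by
      filter_upwards [hTb N, hD.var_nonneg N] with ω h1 h2
      rw [hW, norm_mul]
      refine (mul_le_of_le_one_right (norm_nonneg _) ?_).trans h1
      rw [Real.norm_of_nonneg (Real.exp_pos _).le]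
      exact Real.exp_le_one_iff.2 (by have := mul_nonneg hψ0 h2; linarith)
    have hW0 : ∀ ω, 0 ≤ W ω := fun ω => mul_nonneg (Real.exp_pos _).le (Real.exp_pos _).le
    have hWa : AEStronglyMeasurable W P := (hWm.mono (hD.le N)).aestronglyMeasurable
    have hWi : Integrable W P := Integrable.of_bound hWa _ hWb
    have hWf : ∀ f : Ω → ℝ, Integrable f P → Integrable (W * f) P :=
      fun f hf => hf.bdd_mul hWa hWb
    have hpull : ∀ f : Ω → ℝ, Integrable f P → ∫ ω, W ω * f ω ∂P = ∫ ω, W ω * P[f | G N] ω ∂P := by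
      intro f hf
      rw [← integral_condExp (hD.le N) (f := fun ω => W ω * f ω)]
      exact integral_congr_ae (condExp_mul_of_stronglyMeasurable_left hWm (hWf f hf) hf)
    have hWD : ∫ ω, W ω * D N ω ∂P = 0 := by
      rw [hpull _ (hD.integrable N)]
      refine integral_eq_zero_of_ae ?_
      filter_upwards [hD.condExp_eq N] with ω hω
      simp [hω]
    have hWD2 : ∫ ω, W ω * D N ω ^ 2 ∂P ≤ ∫ ω, W ω * v N ω ∂P := by
      rw [hpull _ (hD.integrable_sq N)]
      refine integral_mono_ae (hWf _ integrable_condExp) (hWf _ (hD.integrable_var N)) ?_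
      filter_upwards [hD.condExp_sq_le N] with ω hω
      exact mul_le_mul_of_nonneg_left hω (hW0 ω)
    have hi1 : Integrable (fun ω => W ω * D N ω) P := hWf _ (hD.integrable N)
    have hi2 : Integrable (fun ω => W ω * D N ω ^ 2) P := hWf _ (hD.integrable_sq N)
    have hi3 : Integrable (fun ω => W ω * v N ω) P := hWf _ (hD.integrable_var N)
    calc ∫ ω, T (N + 1) ω ∂P
        ≤ ∫ ω, (W ω + θ * (W ω * D N ω)) + ψ * (W ω * D N ω ^ 2) ∂P := by
          refine integral_mono_ae (hTi _) ((hWi.add (hi1.const_mul θ)).add (hi2.const_mul ψ)) ?_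
          filter_upwards [hD.bdd N] with ω hω
          have e : T (N + 1) ω = W ω * Real.exp (θ * D N ω) := by
            simp only [hT, hW, ← Real.exp_add, Finset.sum_range_succ]
            congr 1
            ring
          have := mul_le_mul_of_nonneg_left (exp_le_one_add_add_sq hc hθ hω) (hW0 ω)
          simp only [e]
          refine this.trans (le_of_eq ?_)
          ring
      _ = ∫ ω, W ω ∂P + ψ * ∫ ω, W ω * D N ω ^ 2 ∂P := by
          have hi4 : Integrable (fun ω => W ω + θ * (W ω * D N ω)) P := hWi.add (hi1.const_mul θ)
          rw [integral_add hi4 (hi2.const_mul ψ), integral_add hWi (hi1.const_mul θ),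
            integral_const_mul, integral_const_mul, hWD]
          ring
      _ ≤ ∫ ω, W ω ∂P + ψ * ∫ ω, W ω * v N ω ∂P := by gcongr
      _ = ∫ ω, W ω + ψ * (W ω * v N ω) ∂P := by
          rw [integral_add hWi (hi3.const_mul ψ), integral_const_mul]
      _ ≤ ∫ ω, T N ω ∂P := by
          refine integral_mono (hWi.add (hi3.const_mul ψ)) (hTi N) fun ω => ?_
          have e : T N ω = W ω * Real.exp (ψ * v N ω) := by
            simp only [hW, mul_assoc, ← Real.exp_add]
            simp
          have h1 := mul_le_mul_of_nonneg_left (Real.add_one_le_exp (ψ * v N ω)) (hW0 ω)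
          simp only [e]
          refine le_trans (le_of_eq ?_) h1
          ring

/-- Freedman's inequality, in Bennett's form, for the maximum of the partial sums. -/
theorem measure_exists_le (hD : IsBoundedMartingaleDiff P G D v c) (hc : 0 < c) {lam y : ℝ}
    (hlam : 0 < lam) (hy : 0 < y) (N : ℕ) :
    P.real {ω | (∃ k ≤ N, lam ≤ ∑ l ∈ Finset.range k, D l ω) ∧ ∑ l ∈ Finset.range N, v l ω ≤ y}
      ≤ Real.exp (-(y / c ^ 2 * h (lam * c / y))) := by
  -- `θ` is the minimizer of the Chernoff bound below.
  set θ : ℝ := Real.log (1 + lam * c / y) / c with hθ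
  have hθ0 : 0 ≤ θ := div_nonneg (Real.log_nonneg (by
    have : 0 ≤ lam * c / y := by positivity
    linarith)) hc.le
  set ψ := (Real.exp (θ * c) - 1 - θ * c) / c ^ 2 with hψ
  have hψ0 : 0 ≤ ψ := by
    have := Real.add_one_le_exp (θ * c)
    exact div_nonneg (by linarith) (by positivity)
  have hopt : y / c ^ 2 * h (lam * c / y) = θ * lam - ψ * y := by
    have h1 : θ * c = Real.log (1 + lam * c / y) := by rw [hθ]; field_simp
    have h2 : Real.exp (θ * c) = 1 + lam * c / y := by
      rw [h1, Real.exp_log (by positivity)]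
    rw [hψ, h2, h1, hθ, h]
    field_simp
    ring
  -- The differences are stopped when the sum first reaches `lam`: `E l` is the event that this has
  -- not happened up to time `l`.
  set E : ℕ → Set Ω := fun l => {ω | ∀ k ∈ Finset.range (l + 1), ∑ i ∈ Finset.range k, D i ω < lam}
    with hE
  have hEm : ∀ l, MeasurableSet[G l] (E l) := fun l => by
    have : E l = ⋂ k ∈ Finset.range (l + 1), {ω | ∑ i ∈ Finset.range k, D i ω < lam} := by
      ext ω; simp [hE]
    rw [this]
    refine Finset.measurableSet_biInter _ fun k hk => ?_
    have hm : StronglyMeasurable[G l] fun ω => ∑ i ∈ Finset.range k, D i ω :=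
      Finset.stronglyMeasurable_fun_sum _ fun i hi =>
        (hD.meas i).mono (hD.mono (by
          have := Finset.mem_range.1 hi
          have := Finset.mem_range.1 hk
          omega))
    exact @measurableSet_lt _ _ _ _ _ (G l) _ _ _ _ _ hm.measurable measurable_const
  obtain ⟨hint, hle⟩ := (hD.indicator hEm).exp_supermartingale hc hθ0 N
  have hall : ∀ᵐ ω ∂P, ∀ l, 0 ≤ v l ω := ae_all_iff.2 hD.var_nonneg
  have hmarkov := mul_meas_ge_le_integral_of_nonneg
    (Filter.Eventually.of_forall fun ω => (Real.exp_pos _).le) hint (Real.exp (θ * lam - ψ * y))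
  have hsub : P.real {ω | (∃ k ≤ N, lam ≤ ∑ l ∈ Finset.range k, D l ω) ∧
        ∑ l ∈ Finset.range N, v l ω ≤ y}
      ≤ P.real {ω | Real.exp (θ * lam - ψ * y) ≤ Real.exp (θ * ∑ l ∈ Finset.range N,
        (E l).indicator (D l) ω - ψ * ∑ l ∈ Finset.range N, (E l).indicator (v l) ω)} := by
    refine ENNReal.toReal_mono (measure_ne_top _ _) (measure_mono_ae ?_)
    filter_upwards [hall] with ω hω
    rintro ⟨hex, hy'⟩
    refine Real.exp_le_exp.2 ?_
    classical
    -- `k` is the first passage time above `lam`.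
    obtain ⟨hk1, hk2⟩ := Nat.find_spec hex
    have hmin := fun j (hj : j < Nat.find hex) => Nat.find_min hex hj
    generalize Nat.find hex = k at hk1 hk2 hmin
    have hin : ∀ l, ω ∈ E l ↔ l < k := fun l => by
      simp only [hE, Set.mem_ofPred_eq, Finset.mem_range]
      constructor
      · intro hl
        by_contra hlk
        exact absurd hk2 (not_le.2 (hl k (by omega)))
      · intro hl j hj
        have := hmin j (by omega)
        by_contra hcon
        exact this ⟨by omega, not_lt.1 hcon⟩
    have hsum : ∑ l ∈ Finset.range N, (E l).indicator (D l) ω = ∑ l ∈ Finset.range k, D l ω := by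
      rw [← Finset.sum_subset (Finset.range_mono hk1)]
      · refine Finset.sum_congr rfl fun l hl => ?_
        rw [Set.indicator_of_mem ((hin l).2 (Finset.mem_range.1 hl))]
      · intro l _ hl
        rw [Set.indicator_of_notMem]
        rw [hin]
        simpa using hl
    have hv : ∑ l ∈ Finset.range N, (E l).indicator (v l) ω ≤ ∑ l ∈ Finset.range N, v l ω :=
      Finset.sum_le_sum fun l _ => Set.indicator_le_self' (fun _ _ => hω l) ω
    rw [hsum]
    have h1 := mul_le_mul_of_nonneg_left hk2 hθ0
    have h2 := mul_le_mul_of_nonneg_left (hv.trans hy') hψ0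
    linarith
  rw [hopt, Real.exp_neg, ← one_div, le_div_iff₀ (Real.exp_pos _), mul_comm]
  refine le_trans ?_ (hmarkov.trans hle)
  exact mul_le_mul_of_nonneg_left hsub (Real.exp_pos _).le

/-- Two-sided form of Freedman's inequality. -/
theorem measure_exists_le_abs (hD : IsBoundedMartingaleDiff P G D v c) (hc : 0 < c) {lam y : ℝ}
    (hlam : 0 < lam) (hy : 0 < y) (N : ℕ) :
    P.real {ω | (∃ k ≤ N, lam ≤ |∑ l ∈ Finset.range k, D l ω|) ∧ ∑ l ∈ Finset.range N, v l ω ≤ y}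
      ≤ 2 * Real.exp (-(y / c ^ 2 * h (lam * c / y))) := by
  have h1 := hD.measure_exists_le hc hlam hy N
  have h2 := hD.neg.measure_exists_le hc hlam hy N
  have hsub : {ω | (∃ k ≤ N, lam ≤ |∑ l ∈ Finset.range k, D l ω|) ∧
      ∑ l ∈ Finset.range N, v l ω ≤ y} ⊆
      {ω | (∃ k ≤ N, lam ≤ ∑ l ∈ Finset.range k, D l ω) ∧ ∑ l ∈ Finset.range N, v l ω ≤ y} ∪
      {ω | (∃ k ≤ N, lam ≤ ∑ l ∈ Finset.range k, -D l ω) ∧ ∑ l ∈ Finset.range N, v l ω ≤ y} := by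
    rintro ω ⟨⟨k, hk, hl⟩, hω⟩
    rcases le_abs.1 hl with h | h
    · exact Or.inl ⟨⟨k, hk, h⟩, hω⟩
    · exact Or.inr ⟨⟨k, hk, by rwa [Finset.sum_neg_distrib]⟩, hω⟩
  have h3 := (measureReal_mono hsub (measure_ne_top P _)).trans (measureReal_union_le _ _)
  linarith

end IsBoundedMartingaleDiff

end Freedman

/-! ### Blocks -/

/-- The `j`-th block `(jq, (j+1)q]` of length `q`, cut at `n`. -/
def block (q n j : ℕ) : Finset ℕ := Finset.Ioc (min (j * q) n) (min ((j + 1) * q) n)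

lemma mem_block {q n j i : ℕ} : i ∈ block q n j ↔ j * q < i ∧ i ≤ (j + 1) * q ∧ i ≤ n := by
  simp only [block, Finset.mem_Ioc]
  omega

lemma card_block_le (q n j : ℕ) : (block q n j).card ≤ q := by
  have : (j + 1) * q = j * q + q := by ring
  simp only [block, Nat.card_Ioc]
  omega

lemma sum_block {E : Type*} [AddCommMonoid E] (a : ℕ → E) (q n m : ℕ) :
    ∑ j ∈ Finset.range m, ∑ i ∈ block q n j, a i = ∑ i ∈ Finset.Ioc 0 (min (m * q) n), a i := by
  induction m with
  | zero => simp
  | succ m ih =>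
    rw [Finset.sum_range_succ, ih, block, Finset.sum_Ioc_consecutive _ (Nat.zero_le _)]
    have : m * q ≤ (m + 1) * q := Nat.mul_le_mul_right _ (Nat.le_succ m)
    omega

lemma sum_card_block_le (q n m : ℕ) : ∑ j ∈ Finset.range m, ((block q n j).card : ℝ) ≤ n := by
  have h := sum_block (fun _ => 1) q n m
  simp only [Finset.sum_const, smul_eq_mul, mul_one, Nat.card_Ioc, tsub_zero] at h
  have : ∑ j ∈ Finset.range m, (block q n j).card ≤ n := by omega
  exact_mod_cast this

lemma sum_range_parity (a : ℕ → ℝ) (m : ℕ) :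
    ∑ j ∈ Finset.range m, a j = ∑ l ∈ Finset.range ((m + 1) / 2), a (2 * l)
      + ∑ l ∈ Finset.range (m / 2), a (2 * l + 1) := by
  induction m with
  | zero => simp
  | succ m ih =>
    rw [Finset.sum_range_succ, ih]
    rcases Nat.even_or_odd' m with ⟨k, rfl | rfl⟩
    · have h1 : (2 * k + 1 + 1) / 2 = k + 1 := by omega
      have h2 : (2 * k + 1) / 2 = k := by omega
      have h3 : 2 * k / 2 = k := by omega
      rw [h1, h2, h3, Finset.sum_range_succ]
      ring
    · have h1 : (2 * k + 1 + 1 + 1) / 2 = k + 1 := by omega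
      have h2 : (2 * k + 1 + 1) / 2 = k + 1 := by omega
      have h3 : (2 * k + 1) / 2 = k := by omega
      rw [h1, h2, h3, Finset.sum_range_succ (fun l => a (2 * l + 1))]
      ring

lemma sum_parity_le {a : ℕ → ℝ} (ha : ∀ j, 0 ≤ a j) (N b : ℕ) (hb : b ≤ 1) :
    ∑ l ∈ Finset.range N, a (2 * l + b) ≤ ∑ j ∈ Finset.range (2 * N), a j := by
  have h := sum_range_parity a (2 * N)
  have h1 : (2 * N + 1) / 2 = N := by omega
  have h2 : 2 * N / 2 = N := by omega
  rw [h1, h2] at h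
  have h3 : 0 ≤ ∑ l ∈ Finset.range N, a (2 * l) := Finset.sum_nonneg fun l _ => ha _
  have h4 : 0 ≤ ∑ l ∈ Finset.range N, a (2 * l + 1) := Finset.sum_nonneg fun l _ => ha _
  interval_cases b
  · simp only [add_zero]; linarith
  · linarith

section Blocks

variable {Ω : Type*} [mΩ : MeasurableSpace Ω] {P : Measure Ω}

/-- A sequence `ξ` adapted to the filtration `ℱ` and bounded by `M`. -/
structure IsBoundedAdapted (ℱ : ℕ → MeasurableSpace Ω) (ξ : ℕ → Ω → ℝ) (M : ℝ) : Prop where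
  mono : Monotone ℱ
  le : ∀ i, ℱ i ≤ mΩ
  meas : ∀ i, StronglyMeasurable[ℱ i] (ξ i)
  bdd : ∀ i ω, |ξ i ω| ≤ M

/-- The sum of the centred variables over the `j`-th block. -/
noncomputable def blockSum (P : Measure Ω) (ξ : ℕ → Ω → ℝ) (q n j : ℕ) (ω : Ω) : ℝ :=
  ∑ i ∈ block q n j, center P (ξ i) ω

/-- The information from which the `j`-th block is predicted: it lies one whole block before
the `j`-th one. Nothing precedes the block `0`. -/
@[reducible]
def past (ℱ : ℕ → MeasurableSpace Ω) (q : ℕ) : ℕ → MeasurableSpace Ω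
  | 0 => ⊥
  | j + 1 => ℱ (j * q)

namespace IsBoundedAdapted

variable {ℱ : ℕ → MeasurableSpace Ω} {ξ : ℕ → Ω → ℝ} {M : ℝ}

lemma nonneg [hΩ : Nonempty Ω] (hξ : IsBoundedAdapted ℱ ξ M) : 0 ≤ M := by
  obtain ⟨ω⟩ := hΩ
  exact (abs_nonneg _).trans (hξ.bdd 0 ω)

lemma past_mono (hξ : IsBoundedAdapted ℱ ξ M) (q : ℕ) : Monotone (past ℱ q) := by
  refine monotone_nat_of_le_succ fun j => ?_
  cases j with
  | zero => exact bot_le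
  | succ j => exact hξ.mono (Nat.mul_le_mul_right _ (Nat.le_succ j))

lemma past_le (hξ : IsBoundedAdapted ℱ ξ M) (q j : ℕ) : past ℱ q j ≤ mΩ := by
  cases j with
  | zero => exact bot_le
  | succ j => exact hξ.le _

lemma measurable_center (hξ : IsBoundedAdapted ℱ ξ M) (i : ℕ) :
    StronglyMeasurable[ℱ i] (center P (ξ i)) :=
  (hξ.meas i).sub stronglyMeasurable_const

lemma blockSum_sq (q n j : ℕ) (ω : Ω) :
    blockSum P ξ q n j ω ^ 2 = ∑ i ∈ block q n j, ∑ i' ∈ block q n j,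
      center P (ξ i) ω * center P (ξ i') ω := by
  rw [sq, blockSum, Finset.sum_mul_sum]

lemma measurable_blockSum (hξ : IsBoundedAdapted ℱ ξ M) (q n j : ℕ) :
    StronglyMeasurable[past ℱ q (j + 2)] (blockSum P ξ q n j) :=
  Finset.stronglyMeasurable_fun_sum _ fun i hi =>
    (hξ.measurable_center i).mono (hξ.mono (mem_block.1 hi).2.1)

variable [IsProbabilityMeasure P]

lemma integrable (hξ : IsBoundedAdapted ℱ ξ M) (i : ℕ) : Integrable (ξ i) P :=
  Integrable.of_bound ((hξ.meas i).mono (hξ.le _)).aestronglyMeasurable M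
    (Filter.Eventually.of_forall (hξ.bdd i))

lemma abs_center_le (hξ : IsBoundedAdapted ℱ ξ M) (i : ℕ) (ω : Ω) :
    |center P (ξ i) ω| ≤ 2 * M := by
  have h1 := hξ.bdd i ω
  have h2 : |∫ ω, ξ i ω ∂P| ≤ M := by
    have := norm_integral_le_of_norm_le_const (μ := P) (f := ξ i) (C := M)
      (Filter.Eventually.of_forall (hξ.bdd i))
    simpa using this
  exact (abs_sub _ _).trans (by linarith)

lemma integrable_center (hξ : IsBoundedAdapted ℱ ξ M) (i : ℕ) : Integrable (center P (ξ i)) P :=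
  (hξ.integrable i).sub (integrable_const _)

lemma integrable_center_mul (hξ : IsBoundedAdapted ℱ ξ M) (i j : ℕ) :
    Integrable (fun ω => center P (ξ i) ω * center P (ξ j) ω) P :=
  (hξ.integrable_center i).mul_bdd
    ((hξ.measurable_center j).mono (hξ.le _)).aestronglyMeasurable
    (Filter.Eventually.of_forall (hξ.abs_center_le j))

lemma integral_center (hξ : IsBoundedAdapted ℱ ξ M) (i : ℕ) : ∫ ω, center P (ξ i) ω ∂P = 0 := by
  unfold center
  rw [integral_sub (hξ.integrable i) (integrable_const _)]
  simp

lemma abs_blockSum_le (hξ : IsBoundedAdapted ℱ ξ M) (q n j : ℕ) (ω : Ω) :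
    |blockSum P ξ q n j ω| ≤ (block q n j).card * (2 * M) := by
  refine (Finset.abs_sum_le_sum_abs _ _).trans ?_
  refine (Finset.sum_le_card_nsmul _ _ (2 * M) fun i _ => hξ.abs_center_le i ω).trans ?_
  simp

lemma integrable_blockSum (hξ : IsBoundedAdapted ℱ ξ M) (q n j : ℕ) :
    Integrable (blockSum P ξ q n j) P :=
  integrable_finsetSum _ fun i _ => hξ.integrable_center i

lemma memLp_blockSum (hξ : IsBoundedAdapted ℱ ξ M) (q n j : ℕ) :
    MemLp (blockSum P ξ q n j) 2 P :=
  MemLp.of_bound ((hξ.measurable_blockSum q n j).mono (hξ.past_le _ _)).aestronglyMeasurable _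
    (Filter.Eventually.of_forall (hξ.abs_blockSum_le q n j))

/-- Centring changes neither the oscillation nor the prediction error of a block, so that the
latter is bounded by `2qM` rather than `4qM`. -/
lemma abs_blockSum_sub_condExp_le (hξ : IsBoundedAdapted ℱ ξ M) (q n j : ℕ) :
    ∀ᵐ ω ∂P, |blockSum P ξ q n j ω - P[blockSum P ξ q n j | past ℱ q j] ω| ≤ 2 * (q * M) := by
  have := nonempty_of_isProbabilityMeasure P
  have hM : 0 ≤ M := hξ.nonneg
  set W : Ω → ℝ := fun ω => ∑ i ∈ block q n j, ξ i ω with hW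
  set e : ℝ := ∑ i ∈ block q n j, ∫ ω, ξ i ω ∂P with he
  have hWb : ∀ ω, |W ω| ≤ q * M := fun ω => by
    refine (Finset.abs_sum_le_sum_abs _ _).trans ?_
    refine (Finset.sum_le_card_nsmul _ _ M fun i _ => hξ.bdd i ω).trans ?_
    rw [nsmul_eq_mul]
    have : ((block q n j).card : ℝ) ≤ q := by exact_mod_cast card_block_le q n j
    exact mul_le_mul_of_nonneg_right this hM
  have hWi : Integrable W P := integrable_finsetSum _ fun i _ => hξ.integrable i
  have hU : blockSum P ξ q n j = W - fun _ => e := by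
    ext ω
    simp [blockSum, center, hW, he, Finset.sum_sub_distrib]
  have hc := condExp_sub hWi (integrable_const e) (past ℱ q j) (μ := P)
  have hb := ae_bdd_abs_condExp_of_ae_bdd_abs (m := past ℱ q j) (μ := P) (f := W)
    (Filter.Eventually.of_forall hWb)
  rw [hU]
  filter_upwards [hc, hb] with ω h1 h2
  rw [h1, condExp_const (hξ.past_le q j)]
  simp only [Pi.sub_apply]
  have := hWb ω
  rw [show W ω - e - (P[W | past ℱ q j] ω - e) = W ω - P[W | past ℱ q j] ω by ring]
  exact (abs_sub _ _).trans (by linarith)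

/-- Blocks of a given parity, corrected by their predictions, form a martingale. -/
lemma isBoundedMartingaleDiff (hξ : IsBoundedAdapted ℱ ξ M) (q n b : ℕ) {c : ℝ}
    (hc : 2 * (q * M) ≤ c) :
    IsBoundedMartingaleDiff P (fun l => past ℱ q (2 * l + b))
      (fun l ω => blockSum P ξ q n (2 * l + b) ω
        - P[blockSum P ξ q n (2 * l + b) | past ℱ q (2 * l + b)] ω)
      (fun l => P[fun ω => blockSum P ξ q n (2 * l + b) ω ^ 2 | past ℱ q (2 * l + b)]) c where
  mono := fun a a' haa => hξ.past_mono q (by omega)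
  le l := hξ.past_le q _
  meas l := by
    exact ((hξ.measurable_blockSum q n _).mono (hξ.past_mono q (by omega))).sub
      (stronglyMeasurable_condExp.mono (hξ.past_mono q (by omega)))
  bdd l := (hξ.abs_blockSum_sub_condExp_le q n _).mono fun ω hω => hω.trans hc
  meas_var l := stronglyMeasurable_condExp
  var_nonneg l := condExp_nonneg (Filter.Eventually.of_forall fun ω => sq_nonneg _)
  integrable_var l := integrable_condExp
  condExp_eq l := by
    have h1 := condExp_sub (hξ.integrable_blockSum (P := P) q n (2 * l + b))
      (integrable_condExp (m := past ℱ q (2 * l + b)) (f := blockSum P ξ q n (2 * l + b)) (μ := P))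
      (past ℱ q (2 * l + b))
    have h2 := condExp_condExp_of_le (μ := P) (f := blockSum P ξ q n (2 * l + b)) le_rfl
      (hξ.past_le q (2 * l + b))
    refine Filter.EventuallyEq.trans h1 ?_
    filter_upwards [h2] with ω h
    simp [h]
  condExp_sq_le l := ProbabilityTheory.condVar_ae_le_condExp_sq (hξ.past_le q _)
    (hξ.memLp_blockSum q n _)

/-! ### Moments of the block predictions -/

/-- The predictions of the blocks are small in `L¹` if those of the single variables are: each index
of a block `j + 1` lies more than `q` after the time `jq` of the past. The block `0` is predicted by
its mean, which is zero. -/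
lemma integral_abs_condExp_blockSum_le (hξ : IsBoundedAdapted ℱ ξ M) {q n : ℕ} {K : ℝ}
    (hK : ∀ p i, p + q < i → i ≤ n → ∫ ω, |P[center P (ξ i) | ℱ p] ω| ∂P ≤ K) (hK0 : 0 ≤ K)
    (j : ℕ) :
    ∫ ω, |P[blockSum P ξ q n j | past ℱ q j] ω| ∂P ≤ (block q n j).card * K := by
  cases j with
  | zero =>
    have : ∫ ω, blockSum P ξ q n 0 ω ∂P = 0 := by
      simp only [blockSum]
      rw [integral_finsetSum _ fun i _ => hξ.integrable_center i]
      exact Finset.sum_eq_zero fun i _ => hξ.integral_center i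
    have e : P[blockSum P ξ q n 0 | past ℱ q 0] = fun _ => 0 := by
      rw [← this]
      exact condExp_bot _
    simp only [e, abs_zero, integral_zero]
    positivity
  | succ j =>
    have hsum : P[blockSum P ξ q n (j + 1) | past ℱ q (j + 1)]
        =ᵐ[P] ∑ i ∈ block q n (j + 1), P[center P (ξ i) | past ℱ q (j + 1)] := by
      have := condExp_finsetSum (μ := P) (s := block q n (j + 1)) (f := fun i => center P (ξ i))
        (fun i _ => hξ.integrable_center i) (past ℱ q (j + 1))
      refine Filter.EventuallyEq.trans (Filter.EventuallyEq.of_eq ?_) this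
      congr 1
      ext ω
      simp [blockSum]
    calc ∫ ω, |P[blockSum P ξ q n (j + 1) | past ℱ q (j + 1)] ω| ∂P
        ≤ ∫ ω, ∑ i ∈ block q n (j + 1), |P[center P (ξ i) | past ℱ q (j + 1)] ω| ∂P := by
          refine integral_mono_ae integrable_condExp.abs
            (integrable_finsetSum _ fun i _ => integrable_condExp.abs) ?_
          filter_upwards [hsum] with ω hω
          simp only [hω, Finset.sum_apply]
          exact Finset.abs_sum_le_sum_abs _ _
      _ = ∑ i ∈ block q n (j + 1), ∫ ω, |P[center P (ξ i) | past ℱ q (j + 1)] ω| ∂P :=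
          integral_finsetSum _ fun i _ => integrable_condExp.abs
      _ ≤ ∑ i ∈ block q n (j + 1), K := Finset.sum_le_sum fun i hi => by
          obtain ⟨h1, -, h3⟩ := mem_block.1 hi
          exact hK (j * q) i (by linarith [add_mul j 1 q]) h3
      _ = _ := by simp

lemma integral_blockSum_sq (hξ : IsBoundedAdapted ℱ ξ M) (q n j : ℕ) :
    ∫ ω, blockSum P ξ q n j ω ^ 2 ∂P = ∑ i ∈ block q n j, ∑ i' ∈ block q n j,
      ∫ ω, center P (ξ i) ω * center P (ξ i') ω ∂P := by
  simp only [blockSum_sq]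
  rw [integral_finsetSum _ fun i _ => integrable_finsetSum _ fun i' _ =>
    hξ.integrable_center_mul i i']
  exact Finset.sum_congr rfl fun i _ => integral_finsetSum _ fun i' _ =>
    hξ.integrable_center_mul i i'

/-- The conditional second moment of a block is close in `L¹` to its mean if this holds for the
products of two variables. -/
lemma integral_abs_condVar_blockSum_le (hξ : IsBoundedAdapted ℱ ξ M) {q n : ℕ} {K : ℝ}
    (hK : ∀ p i i', p + q < i → p + q < i' → i ≤ n → i' ≤ n →
      ∫ ω, |P[fun ω => center P (ξ i) ω * center P (ξ i') ω | ℱ p] ω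
        - ∫ ω', center P (ξ i) ω' * center P (ξ i') ω' ∂P| ∂P ≤ K) (hK0 : 0 ≤ K) (j : ℕ) :
    ∫ ω, |P[fun ω => blockSum P ξ q n j ω ^ 2 | past ℱ q j] ω
      - ∫ ω', blockSum P ξ q n j ω' ^ 2 ∂P| ∂P ≤ (block q n j).card * (q * K) := by
  cases j with
  | zero =>
    have e : P[fun ω => blockSum P ξ q n 0 ω ^ 2 | past ℱ q 0]
        = fun _ => ∫ ω, blockSum P ξ q n 0 ω ^ 2 ∂P := condExp_bot _
    simp only [e, sub_self, abs_zero, integral_zero]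
    positivity
  | succ j =>
    set B := block q n (j + 1) with hB
    set F : ℕ → ℕ → Ω → ℝ := fun i i' ω => center P (ξ i) ω * center P (ξ i') ω with hF
    have hFi : ∀ i i', Integrable (F i i') P := fun i i' => hξ.integrable_center_mul i i'
    have hsum : P[fun ω => blockSum P ξ q n (j + 1) ω ^ 2 | past ℱ q (j + 1)]
        =ᵐ[P] ∑ p ∈ B ×ˢ B, P[F p.1 p.2 | past ℱ q (j + 1)] := by
      have := condExp_finsetSum (μ := P) (s := B ×ˢ B) (f := fun p => F p.1 p.2)
        (fun p _ => hFi p.1 p.2) (past ℱ q (j + 1))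
      refine Filter.EventuallyEq.trans (Filter.EventuallyEq.of_eq ?_) this
      congr 1
      ext ω
      rw [blockSum_sq, Finset.sum_apply, Finset.sum_product]
    have hcenter : ∫ ω, blockSum P ξ q n (j + 1) ω ^ 2 ∂P
        = ∑ p ∈ B ×ˢ B, ∫ ω, F p.1 p.2 ω ∂P := by
      rw [hξ.integral_blockSum_sq, Finset.sum_product]
    have hi : ∀ i i',
        Integrable (fun ω => |P[F i i' | past ℱ q (j + 1)] ω - ∫ ω', F i i' ω' ∂P|) P :=
      fun i i' => (integrable_condExp.sub (integrable_const _)).abs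
    calc ∫ ω, |P[fun ω => blockSum P ξ q n (j + 1) ω ^ 2 | past ℱ q (j + 1)] ω
          - ∫ ω', blockSum P ξ q n (j + 1) ω' ^ 2 ∂P| ∂P
        ≤ ∫ ω, ∑ p ∈ B ×ˢ B, |P[F p.1 p.2 | past ℱ q (j + 1)] ω - ∫ ω', F p.1 p.2 ω' ∂P| ∂P := by
          refine integral_mono_ae (integrable_condExp.sub (integrable_const _)).abs
            (integrable_finsetSum _ fun p _ => hi p.1 p.2) ?_
          filter_upwards [hsum] with ω hω
          simp only [hω, Finset.sum_apply, hcenter]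
          rw [← Finset.sum_sub_distrib]
          exact Finset.abs_sum_le_sum_abs _ _
      _ = ∑ p ∈ B ×ˢ B, ∫ ω, |P[F p.1 p.2 | past ℱ q (j + 1)] ω - ∫ ω', F p.1 p.2 ω' ∂P| ∂P :=
          integral_finsetSum _ fun p _ => hi p.1 p.2
      _ ≤ ∑ p ∈ B ×ˢ B, K := Finset.sum_le_sum fun p hp => by
          obtain ⟨hp1, hp2⟩ := Finset.mem_product.1 hp
          obtain ⟨h1, -, h3⟩ := mem_block.1 hp1
          obtain ⟨h1', -, h3'⟩ := mem_block.1 hp2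
          exact hK (j * q) p.1 p.2 (by linarith [add_mul j 1 q]) (by linarith [add_mul j 1 q])
            h3 h3'
      _ = B.card * (B.card * K) := by
          rw [Finset.sum_const, Finset.card_product, nsmul_eq_mul]
          push_cast
          ring
      _ ≤ B.card * (q * K) := by
          have : (B.card : ℝ) ≤ q := by exact_mod_cast card_block_le q n (j + 1)
          gcongr

/-- The second moment of a block, from covariances bounded by a function `κ` of the distance: each
value of `κ` is met at most twice for a given index. -/
lemma integral_blockSum_sq_le (hξ : IsBoundedAdapted ℱ ξ M) {q n : ℕ} {κ : ℕ → ℝ}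
    (hκ0 : ∀ d, 0 ≤ κ d)
    (hκ : ∀ i d, ∫ ω, center P (ξ i) ω * center P (ξ (i + d)) ω ∂P ≤ κ d) (j : ℕ) :
    ∫ ω, blockSum P ξ q n j ω ^ 2 ∂P
      ≤ (block q n j).card * (2 * ∑ d ∈ Finset.range q, κ d) := by
  rw [hξ.integral_blockSum_sq, ← nsmul_eq_mul]
  refine Finset.sum_le_card_nsmul _ _ _ fun i hi => ?_
  have hterm : ∀ i' ∈ block q n j, ∫ ω, center P (ξ i) ω * center P (ξ i') ω ∂P
      ≤ if i ≤ i' then κ (i' - i) else κ (i - i') := fun i' _ => by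
    split_ifs with h
    · have := hκ i (i' - i)
      rwa [Nat.add_sub_cancel' h] at this
    · have := hκ i' (i - i')
      rw [Nat.add_sub_cancel' (by omega)] at this
      simpa only [mul_comm] using this
  refine (Finset.sum_le_sum hterm).trans ?_
  rw [Finset.sum_ite, two_mul]
  have key : ∀ (s : Finset ℕ) (g : ℕ → ℕ), Set.InjOn g s → (∀ i' ∈ s, g i' < q) →
      ∑ i' ∈ s, κ (g i') ≤ ∑ d ∈ Finset.range q, κ d := by
    intro s g hg hs
    rw [← Finset.sum_image (f := κ) hg]
    refine Finset.sum_le_sum_of_subset_of_nonneg (fun d hd => ?_) fun d _ _ => hκ0 d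
    obtain ⟨i', hi', rfl⟩ := Finset.mem_image.1 hd
    exact Finset.mem_range.2 (hs i' hi')
  have hi' := mem_block.1 hi
  have hjq : (j + 1) * q = j * q + q := by ring
  refine add_le_add (key _ _ ?_ ?_) (key _ _ ?_ ?_)
  · intro a ha b hb hab
    have h1 := (Finset.mem_filter.1 ha).2
    have h2 := (Finset.mem_filter.1 hb).2
    dsimp only at hab
    omega
  · intro a ha
    have h1 := mem_block.1 (Finset.mem_filter.1 ha).1
    omega
  · intro a ha b hb hab
    have h1 := (Finset.mem_filter.1 ha).2
    have h2 := (Finset.mem_filter.1 hb).2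
    omega
  · intro a ha
    have h1 := mem_block.1 (Finset.mem_filter.1 ha).1
    have h2 := (Finset.mem_filter.1 ha).2
    omega

/-- Every partial sum is within `qM` of the partial sum at the nearest end of a block. -/
lemma exists_block_end (hξ : IsBoundedAdapted ℱ ξ M) {q n k : ℕ} (hq : 0 < q) (hk : k ≤ n)
    (ω : Ω) :
    ∃ m ≤ k + 1, |∑ i ∈ Finset.Ioc 0 k, center P (ξ i) ω|
      ≤ |∑ j ∈ Finset.range m, blockSum P ξ q n j ω| + q * M := by
  have := nonempty_of_isProbabilityMeasure P
  have hM : 0 ≤ M := hξ.nonneg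
  have hpart : ∀ a b : ℕ, 2 * (b - a) ≤ q →
      |∑ i ∈ Finset.Ioc a b, center P (ξ i) ω| ≤ q * M := by
    intro a b hab
    refine (Finset.abs_sum_le_sum_abs _ _).trans ?_
    refine (Finset.sum_le_card_nsmul _ _ (2 * M) fun i _ => hξ.abs_center_le i ω).trans ?_
    rw [Nat.card_Ioc, nsmul_eq_mul]
    have : 2 * ((b - a : ℕ) : ℝ) ≤ q := by exact_mod_cast hab
    nlinarith
  have hdiv := Nat.div_add_mod k q
  have hmod := Nat.mod_lt k hq
  have hdivle : k / q ≤ k := Nat.div_le_self k q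
  rw [mul_comm] at hdiv
  simp only [blockSum, sum_block]
  by_cases h2 : 2 * (k % q) ≤ q
  · refine ⟨k / q, by omega, ?_⟩
    have e : min (k / q * q) n = k / q * q := by omega
    rw [e, ← Finset.sum_Ioc_consecutive _ (Nat.zero_le (k / q * q)) (by omega : k / q * q ≤ k)]
    exact (abs_add_le _ _).trans (add_le_add_right (hpart _ _ (by omega)) _)
  · refine ⟨k / q + 1, by omega, ?_⟩
    have e : (k / q + 1) * q = k / q * q + q := by ring
    have h1 := Finset.sum_Ioc_consecutive (fun i => center P (ξ i) ω) (Nat.zero_le k)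
      (by omega : k ≤ min ((k / q + 1) * q) n)
    rw [← eq_sub_iff_add_eq] at h1
    rw [h1]
    exact (abs_sub _ _).trans (add_le_add_right (hpart _ _ (by omega)) _)

/-- The maximal inequality obtained from blocks of length `q`: Freedman's inequality is applied to
the even and to the odd blocks, while the predictions of the blocks, the fluctuations of their
conditional variances and the external error `Err` are controlled by Markov's inequality. -/
theorem measure_max_le (hξ : IsBoundedAdapted ℱ ξ M) {q n : ℕ} (hq : 0 < q) (hqn : q ≤ n)
    {x c s₂ V K₁ K₂ : ℝ} {κ : ℕ → ℝ} (hx : 0 < x) (hc : 0 < c) (hs₂ : 0 < s₂)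
    (hMx : q * M ≤ x) (hMc : 2 * (q * M) ≤ c) (hκ0 : ∀ d, 0 ≤ κ d)
    (hκ : ∀ i d, ∫ ω, center P (ξ i) ω * center P (ξ (i + d)) ω ∂P ≤ κ d)
    (hV : 2 * n * ∑ d ∈ Finset.range n, κ d ≤ V)
    (hK₁ : ∀ p i, p + q < i → i ≤ n → ∫ ω, |P[center P (ξ i) | ℱ p] ω| ∂P ≤ K₁) (hK₁0 : 0 ≤ K₁)
    (hK₂ : ∀ p i i', p + q < i → p + q < i' → i ≤ n → i' ≤ n →
      ∫ ω, |P[fun ω => center P (ξ i) ω * center P (ξ i') ω | ℱ p] ω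
        - ∫ ω', center P (ξ i) ω' * center P (ξ i') ω' ∂P| ∂P ≤ K₂) (hK₂0 : 0 ≤ K₂)
    {Err : Ω → ℝ} (hErr : Integrable Err P) (hErr0 : ∀ ω, 0 ≤ Err ω) :
    P.real {ω | ∃ k ≤ n, 5 * x ≤ |∑ i ∈ Finset.Ioc 0 k, center P (ξ i) ω| + Err ω}
      ≤ 4 * Real.exp (-((V + s₂) / c ^ 2 * h (3 / 2 * x * c / (V + s₂))))
        + ((∫ ω, Err ω ∂P) + n * K₁) / x + n * (q * K₂) / s₂ := by
  set U := blockSum P ξ q n with hU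
  set A : ℕ → Ω → ℝ := fun j => P[U j | past ℱ q j] with hA
  set v : ℕ → Ω → ℝ := fun j => P[fun ω => U j ω ^ 2 | past ℱ q j] with hv
  set E : ℕ → ℝ := fun j => ∫ ω, U j ω ^ 2 ∂P with hE
  set N := n + 1 with hN
  have hE0 : ∀ j, 0 ≤ E j := fun j => integral_nonneg fun ω => sq_nonneg _
  have hS0 : 0 ≤ ∑ d ∈ Finset.range n, κ d := Finset.sum_nonneg fun d _ => hκ0 d
  have hV0 : 0 ≤ V := le_trans (by positivity) hV
  have hEsum : ∑ j ∈ Finset.range (2 * N), E j ≤ V := by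
    refine le_trans (Finset.sum_le_sum fun j _ => hξ.integral_blockSum_sq_le hκ0 hκ j) ?_
    rw [← Finset.sum_mul]
    have h1 : ∑ d ∈ Finset.range q, κ d ≤ ∑ d ∈ Finset.range n, κ d :=
      Finset.sum_le_sum_of_subset_of_nonneg (Finset.range_mono hqn) fun d _ _ => hκ0 d
    have h2 : 0 ≤ ∑ d ∈ Finset.range q, κ d := Finset.sum_nonneg fun d _ => hκ0 d
    calc _ ≤ (n : ℝ) * (2 * ∑ d ∈ Finset.range q, κ d) :=
          mul_le_mul_of_nonneg_right (sum_card_block_le q n _) (by positivity)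
      _ ≤ (n : ℝ) * (2 * ∑ d ∈ Finset.range n, κ d) := by gcongr
      _ ≤ V := by linarith
  have hy : 0 < V + s₂ := by positivity
  -- `N = n + 1` blocks of each parity are more than enough; the blocks beyond `n` are empty.
  have hmart := fun b => hξ.isBoundedMartingaleDiff (P := P) q n b hMc
  have hF := fun b => (hmart b).measure_exists_le_abs hc (by positivity : 0 < 3 / 2 * x) hy N
  -- The two bad events handled by Markov's inequality.
  set B₁ : Set Ω := {ω | x ≤ Err ω + ∑ j ∈ Finset.range (2 * N), |A j ω|} with hB₁
  set B₂ : Set Ω := {ω | s₂ ≤ ∑ j ∈ Finset.range (2 * N), |v j ω - E j|} with hB₂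
  have hAi : ∀ j, Integrable (fun ω => |A j ω|) P := fun j => integrable_condExp.abs
  have hvi : ∀ j, Integrable (fun ω => |v j ω - E j|) P := fun j =>
    (integrable_condExp.sub (integrable_const _)).abs
  have hPB₁ : P.real B₁ ≤ ((∫ ω, Err ω ∂P) + n * K₁) / x := by
    have hi : Integrable (fun ω => ∑ j ∈ Finset.range (2 * N), |A j ω|) P :=
      integrable_finsetSum _ fun j _ => hAi j
    have h1 := mul_meas_ge_le_integral_of_nonneg (μ := P)
      (f := fun ω => Err ω + ∑ j ∈ Finset.range (2 * N), |A j ω|)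
      (Filter.Eventually.of_forall fun ω => add_nonneg (hErr0 ω)
        (Finset.sum_nonneg fun j _ => abs_nonneg _)) (hErr.add hi) x
    rw [integral_add hErr hi, integral_finsetSum _ fun j _ => hAi j] at h1
    have h2 : ∑ j ∈ Finset.range (2 * N), ∫ ω, |A j ω| ∂P ≤ n * K₁ := by
      refine le_trans (Finset.sum_le_sum fun j _ =>
        hξ.integral_abs_condExp_blockSum_le hK₁ hK₁0 j) ?_
      rw [← Finset.sum_mul]
      exact mul_le_mul_of_nonneg_right (sum_card_block_le q n _) hK₁0
    rw [le_div_iff₀ hx, mul_comm]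
    linarith
  have hPB₂ : P.real B₂ ≤ n * (q * K₂) / s₂ := by
    have h1 := mul_meas_ge_le_integral_of_nonneg (μ := P)
      (f := fun ω => ∑ j ∈ Finset.range (2 * N), |v j ω - E j|)
      (Filter.Eventually.of_forall fun ω => Finset.sum_nonneg fun j _ => abs_nonneg _)
      (integrable_finsetSum _ fun j _ => hvi j) s₂
    rw [integral_finsetSum _ fun j _ => hvi j] at h1
    have h2 : ∑ j ∈ Finset.range (2 * N), ∫ ω, |v j ω - E j| ∂P ≤ n * (q * K₂) := by
      refine le_trans (Finset.sum_le_sum fun j _ =>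
        hξ.integral_abs_condVar_blockSum_le hK₂ hK₂0 j) ?_
      rw [← Finset.sum_mul]
      exact mul_le_mul_of_nonneg_right (sum_card_block_le q n _) (by positivity)
    rw [le_div_iff₀ hs₂, mul_comm]
    linarith
  set C : ℕ → Set Ω := fun b => {ω | (∃ k ≤ N, 3 / 2 * x ≤ |∑ l ∈ Finset.range k,
      (U (2 * l + b) ω - A (2 * l + b) ω)|) ∧
      ∑ l ∈ Finset.range N, v (2 * l + b) ω ≤ V + s₂} with hC
  have hsub : {ω | ∃ k ≤ n, 5 * x ≤ |∑ i ∈ Finset.Ioc 0 k, center P (ξ i) ω| + Err ω}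
      ⊆ (C 0 ∪ C 1) ∪ (B₁ ∪ B₂) := by
    rintro ω ⟨k, hk, h5⟩
    by_contra hcon
    simp only [Set.mem_union, not_or] at hcon
    obtain ⟨⟨h0, h1⟩, hb1, hb2⟩ := hcon
    replace hb1 : Err ω + ∑ j ∈ Finset.range (2 * N), |A j ω| < x := not_le.1 hb1
    replace hb2 : ∑ j ∈ Finset.range (2 * N), |v j ω - E j| < s₂ := not_le.1 hb2
    have hvar : ∀ b ≤ 1, ∑ l ∈ Finset.range N, v (2 * l + b) ω ≤ V + s₂ := by
      intro b hb
      have e1 := sum_parity_le (a := fun j => E j + |v j ω - E j|)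
        (fun j => add_nonneg (hE0 j) (abs_nonneg _)) N b hb
      rw [Finset.sum_add_distrib (s := Finset.range (2 * N))] at e1
      have e2 : ∑ l ∈ Finset.range N, v (2 * l + b) ω ≤ ∑ l ∈ Finset.range N,
          (E (2 * l + b) + |v (2 * l + b) ω - E (2 * l + b)|) :=
        Finset.sum_le_sum fun l _ => by linarith [le_abs_self (v (2 * l + b) ω - E (2 * l + b))]
      linarith
    have hmt : ∀ b ≤ 1, ω ∉ C b → ∀ k ≤ N, |∑ l ∈ Finset.range k,
        (U (2 * l + b) ω - A (2 * l + b) ω)| < 3 / 2 * x := by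
      intro b hb hω k hk
      by_contra hge
      exact hω ⟨⟨k, hk, not_lt.1 hge⟩, hvar b hb⟩
    obtain ⟨m, hm, hle⟩ := hξ.exists_block_end (P := P) hq hk ω
    have hsplit : ∑ j ∈ Finset.range m, U j ω = ∑ l ∈ Finset.range ((m + 1) / 2),
          (U (2 * l) ω - A (2 * l) ω)
        + ∑ l ∈ Finset.range (m / 2), (U (2 * l + 1) ω - A (2 * l + 1) ω)
        + ∑ j ∈ Finset.range m, A j ω := by
      rw [← sum_range_parity (fun j => U j ω - A j ω) m, ← Finset.sum_add_distrib]
      exact Finset.sum_congr rfl fun j _ => by ring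
    have ha : |∑ j ∈ Finset.range m, A j ω| ≤ ∑ j ∈ Finset.range (2 * N), |A j ω| :=
      (Finset.abs_sum_le_sum_abs _ _).trans (Finset.sum_le_sum_of_subset_of_nonneg
        (Finset.range_mono (by omega)) fun _ _ _ => abs_nonneg _)
    have hm0 := hmt 0 (by norm_num) h0 ((m + 1) / 2) (by omega)
    have hm1 := hmt 1 le_rfl h1 (m / 2) (by omega)
    simp only [add_zero] at hm0
    rw [hsplit] at hle
    have htri := abs_add_three (∑ l ∈ Finset.range ((m + 1) / 2), (U (2 * l) ω - A (2 * l) ω))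
      (∑ l ∈ Finset.range (m / 2), (U (2 * l + 1) ω - A (2 * l + 1) ω))
      (∑ j ∈ Finset.range m, A j ω)
    linarith
  refine (measureReal_mono hsub (measure_ne_top P _)).trans ?_
  have u1 := measureReal_union_le (μ := P) (C 0 ∪ C 1) (B₁ ∪ B₂)
  have u2 := measureReal_union_le (μ := P) (C 0) (C 1)
  have u3 := measureReal_union_le (μ := P) B₁ B₂
  have f0 := hF 0
  have f1 := hF 1
  change P.real (C 0) ≤ _ at f0
  change P.real (C 1) ≤ _ at f1
  linarith

end IsBoundedAdapted

end Blocks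

/-! ### Covariances with events -/

section Center

variable {Ω : Type*} {H : MeasurableSpace Ω} [mΩ : MeasurableSpace Ω] {P : Measure Ω}

/-- Centring is self-adjoint. -/
lemma integral_mul_center {V W : Ω → ℝ} (hV : Integrable V P) (hW : Integrable W P)
    (hVW : Integrable (fun ω => V ω * W ω) P) :
    ∫ ω, V ω * center P W ω ∂P = ∫ ω, center P V ω * W ω ∂P := by
  simp only [center, mul_sub, sub_mul]
  rw [integral_sub hVW (hV.mul_const _), integral_sub hVW (hW.const_mul _), integral_mul_const,
    integral_const_mul]

lemma setIntegral_center {A : Set Ω} (hA : MeasurableSet A) (W : Ω → ℝ) :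
    ∫ ω in A, center P W ω ∂P
      = ∫ ω, A.indicator (fun _ => (1 : ℝ)) ω * center P W ω ∂P := by
  rw [← integral_indicator hA]
  refine integral_congr_ae (Filter.Eventually.of_forall fun ω => ?_)
  by_cases h : ω ∈ A <;> simp [h]

variable [IsProbabilityMeasure P]

lemma integrable_center_of_integrable {W : Ω → ℝ} (hW : Integrable W P) :
    Integrable (center P W) P := hW.sub (integrable_const _)

lemma integral_center_eq_zero {W : Ω → ℝ} (hW : Integrable W P) :
    ∫ ω, center P W ω ∂P = 0 := by
  unfold center
  rw [integral_sub hW (integrable_const _)]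
  simp

lemma abs_center_le_of_abs_le {W : Ω → ℝ} {M : ℝ} (hW : ∀ ω, |W ω| ≤ M) (ω : Ω) :
    |center P W ω| ≤ 2 * M := by
  have h2 : |∫ ω, W ω ∂P| ≤ M := by
    simpa using norm_integral_le_of_norm_le_const (μ := P) (f := W) (C := M)
      (Filter.Eventually.of_forall hW)
  exact (abs_sub _ _).trans (by linarith [hW ω])

lemma abs_center_indicator_le (B : Set Ω) (hB : MeasurableSet B) (ω : Ω) :
    |center P (B.indicator fun _ => (1 : ℝ)) ω| ≤ 1 := by
  have h1 : (0 : ℝ) ≤ P.real B := measureReal_nonneg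
  have h2 : P.real B ≤ 1 := measureReal_le_one
  have e : ∫ ω, B.indicator (fun _ => (1 : ℝ)) ω ∂P = P.real B := integral_indicator_one hB
  simp only [center, e]
  by_cases h : ω ∈ B
  · rw [Set.indicator_of_mem h, abs_le]; constructor <;> linarith
  · rw [Set.indicator_of_notMem h, abs_le]; constructor <;> linarith

/-- Twice the covariance of `W` with an event of `H` is at most the `L¹` norm of the centred
conditional expectation of `W`. -/
lemma abs_setIntegral_center_le (hH : H ≤ mΩ) {W : Ω → ℝ}
    (hW : Integrable W P) {A : Set Ω} (hA : MeasurableSet[H] A) :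
    |∫ ω in A, center P W ω ∂P| ≤ (eLpNorm (center P (P[W | H])) 1 P).toReal / 2 := by
  set Z := center P (P[W | H]) with hZ
  have hZi : Integrable Z P := integrable_center_of_integrable integrable_condExp
  have hnorm : (eLpNorm Z 1 P).toReal = ∫ ω, |Z ω| ∂P := by
    rw [eLpNorm_one_eq_lintegral_enorm]
    exact (integral_norm_eq_lintegral_enorm hZi.1).symm
  have hA' := hH _ hA
  have h1 : ∫ ω in A, center P W ω ∂P = ∫ ω in A, Z ω ∂P := by
    simp only [hZ, center]
    rw [integral_sub hW.integrableOn (integrable_const _),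
      integral_sub integrable_condExp.integrableOn (integrable_const _),
      setIntegral_condExp hH hW hA, integral_condExp hH]
  have h2 : ∫ ω in A, Z ω ∂P + ∫ ω in Aᶜ, Z ω ∂P = 0 := by
    rw [integral_add_compl hA' hZi]
    exact integral_center_eq_zero integrable_condExp
  have h3 := integral_add_compl hA' hZi.abs
  have h4 : |∫ ω in A, Z ω ∂P| ≤ ∫ ω in A, |Z ω| ∂P := abs_integral_le_integral_abs
  have h5 : |∫ ω in Aᶜ, Z ω ∂P| ≤ ∫ ω in Aᶜ, |Z ω| ∂P := abs_integral_le_integral_abs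
  have h6 : |∫ ω in Aᶜ, Z ω ∂P| = |∫ ω in A, Z ω ∂P| := by
    rw [← abs_neg]; congr 1; linarith
  rw [h1, hnorm]
  linarith

/-- Conversely, covariances with the events of `H` control the conditional expectation in `L¹`. -/
lemma integral_abs_condExp_sub_le (hH : H ≤ mΩ) {W : Ω → ℝ}
    (hW : Integrable W P) {K : ℝ}
    (hK : ∀ A, MeasurableSet[H] A → |∫ ω in A, center P W ω ∂P| ≤ K) :
    ∫ ω, |P[W | H] ω - ∫ ω', W ω' ∂P| ∂P ≤ 2 * K := by
  set Z : Ω → ℝ := fun ω => P[W | H] ω - ∫ ω', W ω' ∂P with hZ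
  have hZi : Integrable Z P := integrable_condExp.sub (integrable_const _)
  have hZm : StronglyMeasurable[H] Z := stronglyMeasurable_condExp.sub stronglyMeasurable_const
  set A : Set Ω := {ω | 0 < Z ω} with hA
  have hAm : MeasurableSet[H] A :=
    @measurableSet_lt _ _ _ _ _ H _ _ _ _ _ measurable_const hZm.measurable
  have h1 : ∫ ω in A, center P W ω ∂P = ∫ ω in A, Z ω ∂P := by
    simp only [hZ, center]
    rw [integral_sub hW.integrableOn (integrable_const _),
      integral_sub integrable_condExp.integrableOn (integrable_const _),
      setIntegral_condExp hH hW hAm]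
  have h0 : ∫ ω, Z ω ∂P = 0 := by
    simp only [hZ]
    rw [integral_sub integrable_condExp (integrable_const _), integral_condExp hH]
    simp
  have h2 : ∀ ω, |Z ω| = 2 * A.indicator Z ω - Z ω := fun ω => by
    by_cases h : 0 < Z ω
    · rw [Set.indicator_of_mem (show ω ∈ A from h), abs_of_pos h]; ring
    · rw [Set.indicator_of_notMem (show ω ∉ A from h), abs_of_nonpos (not_lt.1 h)]; ring
  change ∫ ω, |Z ω| ∂P ≤ 2 * K
  simp only [h2]
  rw [integral_sub ((hZi.indicator (hH _ hAm)).const_mul 2) hZi, integral_const_mul,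
    integral_indicator (hH _ hAm), h0, ← h1]
  linarith [le_abs_self (∫ ω in A, center P W ω ∂P), hK A hAm]

/-- A bound for the covariances of `V` with the indicators of half-lines in `Y` gives one for its
covariances with truncated combinations in `Y`. -/
lemma clipSum_abs_integral_mul_center_le {V : Ω → ℝ} (hV : Integrable V P) {Y : Ω → ℝ}
    (hY : Measurable Y) {κ : ℝ}
    (hκ : ∀ t, |∫ ω, V ω * center P (Set.indicator {ω' | Y ω' ≤ t} fun _ => (1 : ℝ)) ω ∂P| ≤ κ)
    {L : ℕ} {a : Fin L → ℝ} (ha : ∑ l, |a l| ≤ 1) {f : Fin L → ℝ → ℝ}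
    (hf : ∀ l, OrdLevels (f l)) {m : ℝ} (hm : 0 ≤ m) :
    |∫ ω, V ω * center P (fun ω => clipSum a f m (Y ω)) ω ∂P| ≤ 4 * m * κ := by
  have hB : ∀ t, MeasurableSet {ω' | Y ω' ≤ t} := fun t => measurableSet_le hY measurable_const
  have hT : Measurable fun ω => clipSum a f m (Y ω) := (measurable_clipSum a hf m).comp hY
  have hTb : ∀ ω, |clipSum a f m (Y ω)| ≤ m := fun ω => abs_clipSum_le ha f hm _
  have hTi : Integrable (fun ω => clipSum a f m (Y ω)) P :=
    Integrable.of_bound hT.aestronglyMeasurable m (Filter.Eventually.of_forall hTb)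
  have hVc : Integrable (center P V) P := integrable_center_of_integrable hV
  have key : ∀ t, |∫ ω in {ω | Y ω ≤ t}, center P V ω ∂P| ≤ κ := fun t => by
    have h1 : Integrable (Set.indicator {ω' | Y ω' ≤ t} fun _ => (1 : ℝ)) P :=
      (integrable_const _).indicator (hB t)
    have h2 : (fun ω => V ω * Set.indicator {ω' | Y ω' ≤ t} (fun _ => (1 : ℝ)) ω)
        = Set.indicator {ω' | Y ω' ≤ t} V := by
      ext ω
      by_cases h : Y ω ≤ t <;> simp [h]
    have h3 : (fun ω => center P V ω * Set.indicator {ω' | Y ω' ≤ t} (fun _ => (1 : ℝ)) ω)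
        = Set.indicator {ω' | Y ω' ≤ t} (center P V) := by
      ext ω
      by_cases h : Y ω ≤ t <;> simp [h]
    have h4 := hκ t
    rw [integral_mul_center hV h1 (h2 ▸ hV.indicator (hB t)), h3, integral_indicator (hB t)] at h4
    exact h4
  rw [integral_mul_center hV hTi (hV.mul_bdd (c := m) hT.aestronglyMeasurable
    (Filter.Eventually.of_forall hTb))]
  refine (clipSum_abs_integral_mul_le ha hf hm hY hVc fun J hJ =>
    abs_setIntegral_ordConnected_le hY hVc key hJ).trans (le_of_eq (by ring))

end Center

/-! ### Mixing coefficients -/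

section Mixing

variable {Ω : Type*} {M₀ : MeasurableSpace Ω} [mΩ : MeasurableSpace Ω] {P : Measure Ω}

lemma alphaCoeff_antitone (Y : ℕ → Ω → ℝ) (k : ℕ) : Antitone (alphaCoeff M₀ P Y k) := by
  intro m n hmn
  refine iSup₂_le fun l hl => iSup₂_le fun i hi => ?_
  exact le_iSup₂_of_le l hl (le_iSup₂_of_le i ⟨hi.1, fun j => hmn.trans (hi.2 j)⟩ le_rfl)

variable [IsProbabilityMeasure P]

lemma eLpNorm_center_condExp_le {W : Ω → ℝ} (hW : ∀ ω, |W ω| ≤ 1) :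
    eLpNorm (center P (P[W | M₀])) 1 P ≤ 2 := by
  have hb := ae_bdd_abs_condExp_of_ae_bdd_abs (m := M₀) (μ := P) (f := W) (R := 1)
    (Filter.Eventually.of_forall hW)
  have h2 : |∫ ω, P[W | M₀] ω ∂P| ≤ 1 := by
    simpa using norm_integral_le_of_norm_le_const (μ := P) (f := P[W | M₀]) (C := 1) hb
  refine (eLpNorm_le_of_ae_bound (C := 2) ?_).trans (by simp)
  filter_upwards [hb] with ω hω
  exact (abs_sub _ _).trans (by linarith)

lemma alphaCoeff_ne_top {Y : ℕ → Ω → ℝ} (hY : ∀ i, Measurable (Y i)) (k m : ℕ) :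
    alphaCoeff M₀ P Y k m ≠ ∞ := by
  refine ne_top_of_le_ne_top ENNReal.ofNat_ne_top (b := 2) ?_
  refine iSup₂_le fun l _ => iSup₂_le fun i _ => iSup_le fun x => ?_
  refine eLpNorm_center_condExp_le fun ω => ?_
  rw [Finset.abs_prod]
  exact Finset.prod_le_one (fun _ _ => abs_nonneg _) fun j _ =>
    abs_center_indicator_le _ (measurableSet_le (hY _) measurable_const) ω

lemma alphaCoeff_one_le_one (hM₀ : M₀ ≤ mΩ) {Y : ℕ → Ω → ℝ} (hY : ∀ i, Measurable (Y i)) (m : ℕ) :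
    alphaCoeff M₀ P Y 1 m ≤ 1 := by
  refine iSup₂_le fun l hl => iSup₂_le fun i _ => iSup_le fun x => ?_
  obtain rfl : l = 1 := by have := Finset.mem_Icc.1 hl; omega
  simp only [Fin.prod_univ_one]
  set B : Set Ω := {ω' | Y (i 0) ω' ≤ x 0} with hB
  have hBm : MeasurableSet B := measurableSet_le (hY _) measurable_const
  have h1 : Integrable (B.indicator fun _ => (1 : ℝ)) P := (integrable_const _).indicator hBm
  have h0 : ∫ ω, P[fun ω => center P (B.indicator fun _ => (1 : ℝ)) ω | M₀] ω ∂P = 0 := by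
    rw [integral_condExp hM₀]
    exact integral_center_eq_zero h1
  have hb := ae_bdd_abs_condExp_of_ae_bdd_abs (m := M₀) (μ := P)
    (f := fun ω => center P (B.indicator fun _ => (1 : ℝ)) ω) (R := 1)
    (Filter.Eventually.of_forall (abs_center_indicator_le B hBm))
  refine (eLpNorm_le_of_ae_bound (C := 1) ?_).trans (by simp)
  filter_upwards [hb] with ω hω
  rw [center, h0, sub_zero]
  exact hω

lemma abs_setIntegral_le_alphaCoeff (hM₀ : M₀ ≤ mΩ) {Y : ℕ → Ω → ℝ} (hY : ∀ i, Measurable (Y i))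
    {k m i : ℕ} (hk : 1 ≤ k) (hi : m ≤ i) {A : Set Ω} (hA : MeasurableSet[M₀] A) (t : ℝ) :
    |∫ ω, A.indicator (fun _ => (1 : ℝ)) ω
        * center P (Set.indicator {ω' | Y i ω' ≤ t} fun _ => (1 : ℝ)) ω ∂P|
      ≤ (alphaCoeff M₀ P Y k m).toReal / 2 := by
  set B : Set Ω := {ω' | Y i ω' ≤ t} with hB
  have hBm : MeasurableSet B := measurableSet_le (hY _) measurable_const
  have h1 : Integrable (B.indicator fun _ => (1 : ℝ)) P := (integrable_const _).indicator hBm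
  have hle := abs_setIntegral_center_le hM₀ (integrable_center_of_integrable h1) hA
  have hcc : center P (center P (B.indicator fun _ => (1 : ℝ)))
      = center P (B.indicator fun _ => (1 : ℝ)) := by
    ext ω
    rw [center, integral_center_eq_zero h1, sub_zero]
  rw [hcc, setIntegral_center (hM₀ _ hA)] at hle
  refine hle.trans (div_le_div_of_nonneg_right ?_ zero_le_two)
  refine ENNReal.toReal_mono (alphaCoeff_ne_top hY k m) ?_
  refine le_iSup₂_of_le 1 (Finset.mem_Icc.2 ⟨le_rfl, hk⟩) (le_iSup₂_of_le (fun _ => i)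
    ⟨monotone_const, fun _ => hi⟩ (le_iSup_of_le (fun _ => t) ?_))
  simp only [Fin.prod_univ_one]
  exact le_rfl

/-- The coefficient `α₂` in terms of an event of `M₀`. The centring is put on the event, so that
what remains is bilinear in the two indicators of half-lines. -/
lemma abs_integral_pair_le_alphaCoeff (hM₀ : M₀ ≤ mΩ) {Y : ℕ → Ω → ℝ}
    (hY : ∀ i, Measurable (Y i)) {m i j : ℕ} (hi : m ≤ i) (hj : m ≤ j) {A : Set Ω}
    (hA : MeasurableSet[M₀] A) (s t : ℝ) :
    |∫ ω, center P (A.indicator fun _ => (1 : ℝ)) ω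
        * (center P (Set.indicator {ω' | Y i ω' ≤ s} fun _ => (1 : ℝ)) ω
          * center P (Set.indicator {ω' | Y j ω' ≤ t} fun _ => (1 : ℝ)) ω) ∂P|
      ≤ (alphaCoeff M₀ P Y 2 m).toReal / 2 := by
  wlog hij : i ≤ j generalizing i j s t
  · have := this hj hi t s (by omega)
    simpa only [mul_comm (center P (Set.indicator {ω' | Y j ω' ≤ t} fun _ => (1 : ℝ)) _)] using this
  set W : Ω → ℝ := fun ω => center P (Set.indicator {ω' | Y i ω' ≤ s} fun _ => (1 : ℝ)) ω
    * center P (Set.indicator {ω' | Y j ω' ≤ t} fun _ => (1 : ℝ)) ω with hW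
  have hB : ∀ i t, MeasurableSet {ω' | Y i ω' ≤ t} := fun i t =>
    measurableSet_le (hY _) measurable_const
  have h1 : ∀ i t, Integrable (Set.indicator {ω' | Y i ω' ≤ t} fun _ => (1 : ℝ)) P :=
    fun i t => (integrable_const _).indicator (hB i t)
  have hWi : Integrable W P := (integrable_center_of_integrable (h1 i s)).mul_bdd (c := 1)
    (integrable_center_of_integrable (h1 j t)).1
    (Filter.Eventually.of_forall (abs_center_indicator_le _ (hB j t)))
  have hle := abs_setIntegral_center_le hM₀ hWi hA
  have hA' := hM₀ _ hA
  rw [setIntegral_center hA', integral_mul_center ((integrable_const _).indicator hA') hWi] at hle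
  · refine hle.trans (div_le_div_of_nonneg_right ?_ zero_le_two)
    refine ENNReal.toReal_mono (alphaCoeff_ne_top hY 2 m) ?_
    refine le_iSup₂_of_le 2 (by simp) (le_iSup₂_of_le ![i, j] ⟨?_, ?_⟩
      (le_iSup_of_le ![s, t] ?_))
    · intro a b hab
      fin_cases a <;> fin_cases b <;> simp_all
    · intro a
      fin_cases a <;> simpa
    · simp only [Fin.prod_univ_two, Matrix.cons_val_zero, Matrix.cons_val_one]
      exact le_rfl
  · refine hWi.bdd_mul (c := 1) ((integrable_const _).indicator hA').1
      (Filter.Eventually.of_forall fun ω => ?_)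
    by_cases h : ω ∈ A <;> simp [h]

end Mixing

/-! ### Stationarity -/

/-- The dynamical setting: `θ` preserves `P`, the iterates of `θ` pull `M₀` back to a filtration,
and `Y₀` is `M₀`-measurable. -/
structure IsStationarySetup {Ω : Type*} (M₀ : MeasurableSpace Ω) [mΩ : MeasurableSpace Ω]
    (P : Measure Ω) (θ : Ω → Ω) (Y₀ : Ω → ℝ) : Prop where
  measurePreserving : MeasurePreserving θ P P
  le : M₀ ≤ mΩ
  le_comap : M₀ ≤ MeasurableSpace.comap θ M₀
  meas : Measurable[M₀] Y₀

lemma orbit_add {Ω : Type*} (θ : Ω → Ω) (Y₀ : Ω → ℝ) (i p : ℕ) (ω : Ω) :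
    orbit θ Y₀ (i + p) ω = orbit θ Y₀ i (θ^[p] ω) := by
  rw [orbit, orbit, Function.iterate_add_apply]

namespace IsStationarySetup

variable {Ω : Type*} {M₀ : MeasurableSpace Ω} [mΩ : MeasurableSpace Ω] {P : Measure Ω}
  {θ : Ω → Ω} {Y₀ : Ω → ℝ}

lemma measurable_iterate (hθ : IsStationarySetup M₀ P θ Y₀) (i : ℕ) : Measurable (θ^[i]) :=
  hθ.measurePreserving.measurable.iterate i

lemma measurable_orbit (hθ : IsStationarySetup M₀ P θ Y₀) (i : ℕ) : Measurable (orbit θ Y₀ i) :=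
  (hθ.meas.mono hθ.le le_rfl).comp (hθ.measurable_iterate i)

lemma comap_mono (hθ : IsStationarySetup M₀ P θ Y₀) :
    Monotone fun p => MeasurableSpace.comap (θ^[p]) M₀ := by
  refine monotone_nat_of_le_succ fun p => ?_
  rw [Function.iterate_succ', ← MeasurableSpace.comap_comp]
  exact MeasurableSpace.comap_mono hθ.le_comap

lemma comap_le (hθ : IsStationarySetup M₀ P θ Y₀) (p : ℕ) :
    MeasurableSpace.comap (θ^[p]) M₀ ≤ mΩ :=
  (MeasurableSpace.comap_mono hθ.le).trans (hθ.measurable_iterate p).comap_le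

lemma measurable_orbit_comap (hθ : IsStationarySetup M₀ P θ Y₀) (i : ℕ) :
    Measurable[MeasurableSpace.comap (θ^[i]) M₀] (orbit θ Y₀ i) :=
  hθ.meas.comp (comap_measurable _)

lemma map_orbit (hθ : IsStationarySetup M₀ P θ Y₀) (i : ℕ) :
    P.map (orbit θ Y₀ i) = P.map Y₀ := by
  have h := Measure.map_map (μ := P) (hθ.meas.mono hθ.le le_rfl) (hθ.measurable_iterate i)
  rw [(hθ.measurePreserving.iterate i).map_eq] at h
  exact h.symm

lemma integral_orbit (hθ : IsStationarySetup M₀ P θ Y₀) (i : ℕ) {F : ℝ → ℝ}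
    (hF : AEStronglyMeasurable F (P.map Y₀)) :
    ∫ ω, F (orbit θ Y₀ i ω) ∂P = ∫ y, F y ∂(P.map Y₀) := by
  rw [← hθ.map_orbit i] at hF ⊢
  exact (integral_map (hθ.measurable_orbit i).aemeasurable hF).symm

lemma integrable_orbit (hθ : IsStationarySetup M₀ P θ Y₀) (i : ℕ) {F : ℝ → ℝ}
    (hF : Integrable F (P.map Y₀)) : Integrable (fun ω => F (orbit θ Y₀ i ω)) P := by
  rw [← hθ.map_orbit i] at hF
  exact hF.comp_measurable (hθ.measurable_orbit i)

lemma integral_comp_iterate (hθ : IsStationarySetup M₀ P θ Y₀) (p : ℕ) {F : Ω → ℝ}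
    (hF : Measurable F) : ∫ ω, F (θ^[p] ω) ∂P = ∫ ω, F ω ∂P := by
  conv_rhs => rw [← (hθ.measurePreserving.iterate p).map_eq]
  exact (integral_map (hθ.measurable_iterate p).aemeasurable hF.aestronglyMeasurable).symm

lemma center_comp_iterate (hθ : IsStationarySetup M₀ P θ Y₀) (p : ℕ) {F : Ω → ℝ}
    (hF : Measurable F) (ω : Ω) :
    center P (fun ω => F (θ^[p] ω)) ω = center P F (θ^[p] ω) := by
  rw [center, center, hθ.integral_comp_iterate p hF]

/-- Covariances with the events of the past at time `p` reduce to time `0`. -/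
lemma abs_setIntegral_center_comap_le (hθ : IsStationarySetup M₀ P θ Y₀) (p : ℕ) {W : Ω → ℝ}
    (hW : Measurable W) {K : ℝ}
    (hK : ∀ A, MeasurableSet[M₀] A → |∫ ω in A, center P W ω ∂P| ≤ K) {A : Set Ω}
    (hA : MeasurableSet[MeasurableSpace.comap (θ^[p]) M₀] A) :
    |∫ ω in A, center P (fun ω => W (θ^[p] ω)) ω ∂P| ≤ K := by
  obtain ⟨A', hA', rfl⟩ := hA
  have e := setIntegral_map (μ := P) (g := θ^[p]) (f := center P W) (hθ.le _ hA')
    (hW.sub_const _).aestronglyMeasurable (hθ.measurable_iterate p).aemeasurable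
  rw [(hθ.measurePreserving.iterate p).map_eq] at e
  simp only [hθ.center_comp_iterate p hW]
  rw [← e]
  exact hK A' hA'

/-! ### Mixing estimates for truncated combinations -/

variable {L : ℕ} {a : Fin L → ℝ} {f : Fin L → ℝ → ℝ}

lemma measurable_clipSum_orbit (hθ : IsStationarySetup M₀ P θ Y₀) (hf : ∀ l, OrdLevels (f l))
    (m : ℝ) (i : ℕ) : Measurable fun ω => clipSum a f m (orbit θ Y₀ i ω) :=
  (measurable_clipSum a hf m).comp (hθ.measurable_orbit i)

lemma isBoundedAdapted (hθ : IsStationarySetup M₀ P θ Y₀) (ha : ∑ l, |a l| ≤ 1)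
    (hf : ∀ l, OrdLevels (f l)) {m : ℝ} (hm : 0 ≤ m) :
    IsBoundedAdapted (fun p => MeasurableSpace.comap (θ^[p]) M₀)
      (fun i ω => clipSum a f m (orbit θ Y₀ i ω)) m where
  mono := hθ.comap_mono
  le := hθ.comap_le
  meas i := ((measurable_clipSum a hf m).comp (hθ.measurable_orbit_comap i)).stronglyMeasurable
  bdd _ _ := abs_clipSum_le ha f hm _

lemma integral_center_mul_orbit_add (hθ : IsStationarySetup M₀ P θ Y₀) {g g' : ℝ → ℝ}
    (hg : Measurable g) (hg' : Measurable g') (i d : ℕ) :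
    ∫ ω, center P (fun ω => g (orbit θ Y₀ i ω)) ω
        * center P (fun ω => g' (orbit θ Y₀ (i + d) ω)) ω ∂P
      = ∫ ω, center P (fun ω => g (orbit θ Y₀ 0 ω)) ω
        * center P (fun ω => g' (orbit θ Y₀ d ω)) ω ∂P := by
  have h1 := hg.comp (hθ.measurable_orbit 0)
  have h2 := hg'.comp (hθ.measurable_orbit d)
  rw [← hθ.integral_comp_iterate i (F := fun ω => center P (fun ω => g (orbit θ Y₀ 0 ω)) ω
    * center P (fun ω => g' (orbit θ Y₀ d ω)) ω) ((h1.sub_const _).mul (h2.sub_const _))]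
  refine integral_congr_ae (Filter.Eventually.of_forall fun ω => ?_)
  have e1 : ∀ ω, orbit θ Y₀ i ω = orbit θ Y₀ 0 (θ^[i] ω) := fun ω => by
    rw [← orbit_add, zero_add]
  have e2 : ∀ ω, orbit θ Y₀ (i + d) ω = orbit θ Y₀ d (θ^[i] ω) := fun ω => by
    rw [← orbit_add, add_comm]
  simp only [e1, e2]
  have c1 := hθ.center_comp_iterate i h1 ω
  have c2 := hθ.center_comp_iterate i h2 ω
  simp only [Function.comp_apply] at c1 c2
  rw [c1, c2]
  rfl

variable [IsProbabilityMeasure P]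

lemma integrable_clipSum_orbit (hθ : IsStationarySetup M₀ P θ Y₀) (ha : ∑ l, |a l| ≤ 1)
    (hf : ∀ l, OrdLevels (f l)) {m : ℝ} (hm : 0 ≤ m) (i : ℕ) :
    Integrable (fun ω => clipSum a f m (orbit θ Y₀ i ω)) P :=
  Integrable.of_bound (hθ.measurable_clipSum_orbit hf m i).aestronglyMeasurable m
    (Filter.Eventually.of_forall fun _ => abs_clipSum_le ha f hm _)

lemma abs_setIntegral_clipSum_le (hθ : IsStationarySetup M₀ P θ Y₀) (ha : ∑ l, |a l| ≤ 1)
    (hf : ∀ l, OrdLevels (f l)) {m : ℝ} (hm : 0 ≤ m) {k q i : ℕ} (hk : 1 ≤ k) (hi : q ≤ i)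
    {A : Set Ω} (hA : MeasurableSet[M₀] A) :
    |∫ ω in A, center P (fun ω => clipSum a f m (orbit θ Y₀ i ω)) ω ∂P|
      ≤ 2 * m * (alphaCoeff M₀ P (orbit θ Y₀) k q).toReal := by
  rw [setIntegral_center (hθ.le _ hA)]
  refine (clipSum_abs_integral_mul_center_le ((integrable_const _).indicator (hθ.le _ hA))
    (hθ.measurable_orbit i) (fun t => abs_setIntegral_le_alphaCoeff hθ.le hθ.measurable_orbit hk hi
      hA t) ha hf hm).trans (le_of_eq (by ring))

/-- The prediction of a truncated combination from a past at distance `q` is small in `L¹`. -/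
lemma integral_abs_condExp_clipSum_le (hθ : IsStationarySetup M₀ P θ Y₀) (ha : ∑ l, |a l| ≤ 1)
    (hf : ∀ l, OrdLevels (f l)) {m : ℝ} (hm : 0 ≤ m) {k q p i : ℕ} (hk : 1 ≤ k) (hi : p + q ≤ i) :
    ∫ ω, |P[center P (fun ω => clipSum a f m (orbit θ Y₀ i ω)) |
        MeasurableSpace.comap (θ^[p]) M₀] ω| ∂P
      ≤ 4 * m * (alphaCoeff M₀ P (orbit θ Y₀) k q).toReal := by
  obtain ⟨i, rfl⟩ : ∃ i', i = i' + p := ⟨i - p, by omega⟩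
  have hi0 := hθ.integrable_clipSum_orbit ha hf hm (i + p)
  have h0 := integral_center_eq_zero hi0
  have hcc : center P (center P fun ω => clipSum a f m (orbit θ Y₀ (i + p) ω))
      = center P fun ω => clipSum a f m (orbit θ Y₀ (i + p) ω) := by
    ext ω
    rw [center, h0, sub_zero]
  have h := integral_abs_condExp_sub_le (hθ.comap_le p) (integrable_center_of_integrable hi0)
    (K := 2 * m * (alphaCoeff M₀ P (orbit θ Y₀) k q).toReal) fun A hA => by
      rw [hcc]
      simp only [orbit_add]
      exact hθ.abs_setIntegral_center_comap_le p
        (W := fun ω => clipSum a f m (orbit θ Y₀ i ω)) (hθ.measurable_clipSum_orbit hf m i)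
        (fun A' hA' => hθ.abs_setIntegral_clipSum_le ha hf hm hk (by omega) hA') hA
  rw [h0] at h
  simp only [sub_zero] at h
  linarith

/-- The centred product of two truncated combinations: the half-line bound is upgraded in each of
the two variables in turn. -/
lemma abs_setIntegral_clipSum_mul_le (hθ : IsStationarySetup M₀ P θ Y₀) (ha : ∑ l, |a l| ≤ 1)
    (hf : ∀ l, OrdLevels (f l)) {m : ℝ} (hm : 0 ≤ m) {q i j : ℕ} (hi : q ≤ i) (hj : q ≤ j)
    {A : Set Ω} (hA : MeasurableSet[M₀] A) :
    |∫ ω in A, center P (fun ω => center P (fun ω => clipSum a f m (orbit θ Y₀ i ω)) ω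
        * center P (fun ω => clipSum a f m (orbit θ Y₀ j ω)) ω) ω ∂P|
      ≤ 8 * m ^ 2 * (alphaCoeff M₀ P (orbit θ Y₀) 2 q).toReal := by
  have hA' := hθ.le _ hA
  set C : ℕ → Ω → ℝ := fun i => center P (fun ω => clipSum a f m (orbit θ Y₀ i ω)) with hC
  set VA : Ω → ℝ := center P (A.indicator fun _ => (1 : ℝ)) with hVA
  have h1 : Integrable (A.indicator fun _ => (1 : ℝ)) P := (integrable_const _).indicator hA'
  have hVAi : Integrable VA P := integrable_center_of_integrable h1
  have hCi : ∀ i, Integrable (C i) P := fun i =>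
    integrable_center_of_integrable (hθ.integrable_clipSum_orbit ha hf hm i)
  have hCb : ∀ i ω, |C i ω| ≤ 2 * m := fun i =>
    abs_center_le_of_abs_le fun ω => abs_clipSum_le ha f hm _
  have hmul : ∀ V : Ω → ℝ, Integrable V P → ∀ i, Integrable (fun ω => V ω * C i ω) P :=
    fun V hV i => hV.mul_bdd (hCi i).1 (Filter.Eventually.of_forall (hCb i))
  have hB : ∀ t, MeasurableSet {ω' | orbit θ Y₀ i ω' ≤ t} := fun t =>
    measurableSet_le (hθ.measurable_orbit i) measurable_const
  rw [setIntegral_center hA', integral_mul_center h1 (hmul _ (hCi i) j)]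
  · have step : ∀ s, |∫ ω, (VA ω * C j ω)
        * center P (Set.indicator {ω' | orbit θ Y₀ i ω' ≤ s} fun _ => (1 : ℝ)) ω ∂P|
        ≤ 2 * m * (alphaCoeff M₀ P (orbit θ Y₀) 2 q).toReal := fun s => by
      set I := center P (Set.indicator {ω' | orbit θ Y₀ i ω' ≤ s} fun _ => (1 : ℝ)) with hI
      have hIi : Integrable (fun ω => VA ω * I ω) P := hVAi.mul_bdd (c := 1)
        (integrable_center_of_integrable ((integrable_const _).indicator (hB s))).1
        (Filter.Eventually.of_forall (abs_center_indicator_le (P := P) _ (hB s)))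
      have := clipSum_abs_integral_mul_center_le (P := P) hIi (hθ.measurable_orbit j)
        (fun t => by
          have := abs_integral_pair_le_alphaCoeff (P := P) hθ.le hθ.measurable_orbit hi hj hA s t
          simpa only [mul_assoc] using this) ha hf hm
      refine le_trans (le_of_eq ?_) (this.trans (le_of_eq (by ring)))
      congr 1
      refine integral_congr_ae (Filter.Eventually.of_forall fun ω => ?_)
      simp only [hC]
      ring
    have := clipSum_abs_integral_mul_center_le (P := P) (hmul _ hVAi j) (hθ.measurable_orbit i)
      step ha hf hm
    refine le_trans (le_of_eq ?_) (this.trans (le_of_eq (by ring)))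
    congr 1
    refine integral_congr_ae (Filter.Eventually.of_forall fun ω => ?_)
    simp only [hC]
    ring
  · refine (hmul _ (hCi i) j).bdd_mul (c := 1) h1.1 (Filter.Eventually.of_forall fun ω => ?_)
    by_cases h : ω ∈ A <;> simp [h]

/-- The prediction of a product of two truncated combinations from a past at distance `q` is close
in `L¹` to its mean. -/
lemma integral_abs_condExp_clipSum_mul_le (hθ : IsStationarySetup M₀ P θ Y₀)
    (ha : ∑ l, |a l| ≤ 1) (hf : ∀ l, OrdLevels (f l)) {m : ℝ} (hm : 0 ≤ m) {q p i j : ℕ}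
    (hi : p + q ≤ i) (hj : p + q ≤ j) :
    ∫ ω, |P[fun ω => center P (fun ω => clipSum a f m (orbit θ Y₀ i ω)) ω
          * center P (fun ω => clipSum a f m (orbit θ Y₀ j ω)) ω |
          MeasurableSpace.comap (θ^[p]) M₀] ω
        - ∫ ω', center P (fun ω => clipSum a f m (orbit θ Y₀ i ω)) ω'
          * center P (fun ω => clipSum a f m (orbit θ Y₀ j ω)) ω' ∂P| ∂P
      ≤ 16 * m ^ 2 * (alphaCoeff M₀ P (orbit θ Y₀) 2 q).toReal := by
  obtain ⟨i, rfl⟩ : ∃ i', i = i' + p := ⟨i - p, by omega⟩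
  obtain ⟨j, rfl⟩ : ∃ j', j = j' + p := ⟨j - p, by omega⟩
  have hm' := hθ.measurable_clipSum_orbit (a := a) hf m
  have h := integral_abs_condExp_sub_le (P := P) (hθ.comap_le p)
    ((hθ.isBoundedAdapted ha hf hm).integrable_center_mul (P := P) (i + p) (j + p))
    (K := 8 * m ^ 2 * (alphaCoeff M₀ P (orbit θ Y₀) 2 q).toReal) fun A hA => by
      simp only [orbit_add]
      simp only [hθ.center_comp_iterate p (hm' i), hθ.center_comp_iterate p (hm' j)]
      exact hθ.abs_setIntegral_center_comap_le p
        (W := fun ω => center P (fun ω => clipSum a f m (orbit θ Y₀ i ω)) ω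
          * center P (fun ω => clipSum a f m (orbit θ Y₀ j ω)) ω)
        (((hm' i).sub_const _).mul ((hm' j).sub_const _))
        (fun A' hA' => hθ.abs_setIntegral_clipSum_mul_le ha hf hm (by omega) (by omega) hA') hA
  linarith

/-! ### Covariances -/

/-- Covariance of truncated combinations: one variable is conditioned on the other. -/
lemma abs_integral_clipSum_mul_le (hθ : IsStationarySetup M₀ P θ Y₀) (ha : ∑ l, |a l| ≤ 1)
    (hf : ∀ l, OrdLevels (f l)) {m : ℝ} (hm : 0 ≤ m) (d : ℕ) :
    |∫ ω, center P (fun ω => clipSum a f m (orbit θ Y₀ 0 ω)) ω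
        * center P (fun ω => clipSum a f m (orbit θ Y₀ d ω)) ω ∂P|
      ≤ 4 * m ^ 2 * (alphaCoeff M₀ P (orbit θ Y₀) 1 d).toReal := by
  have hi := hθ.integrable_clipSum_orbit ha hf hm
  have hZ := integrable_center_of_integrable (hi d)
  have hm' := hθ.measurable_clipSum_orbit (a := a) hf m 0
  have h := clipSum_abs_integral_mul_le (P := P) ha hf hm (hθ.measurable_orbit 0) hZ fun J hJ =>
    hθ.abs_setIntegral_clipSum_le ha hf hm le_rfl le_rfl
      (A := orbit θ Y₀ 0 ⁻¹' J) (hθ.meas hJ.measurableSet)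
  have hb : ∀ ω, |clipSum a f m (orbit θ Y₀ 0 ω)| ≤ m := fun ω => abs_clipSum_le ha f hm _
  have hbd : ∀ ω, |center P (fun ω => clipSum a f m (orbit θ Y₀ d ω)) ω| ≤ 2 * m :=
    abs_center_le_of_abs_le fun ω => abs_clipSum_le ha f hm _
  have e : ∫ ω, center P (fun ω => clipSum a f m (orbit θ Y₀ 0 ω)) ω
        * center P (fun ω => clipSum a f m (orbit θ Y₀ d ω)) ω ∂P
      = ∫ ω, center P (fun ω => clipSum a f m (orbit θ Y₀ d ω)) ω
        * clipSum a f m (orbit θ Y₀ 0 ω) ∂P := by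
    rw [← integral_mul_center (hi 0) hZ ((hi 0).mul_bdd hZ.1 (Filter.Eventually.of_forall hbd))]
    refine integral_congr_ae (Filter.Eventually.of_forall fun ω => ?_)
    have h0 := integral_center_eq_zero (hi d)
    have hcc : center P (center P fun ω => clipSum a f m (orbit θ Y₀ d ω)) ω
        = center P (fun ω => clipSum a f m (orbit θ Y₀ d ω)) ω := by
      rw [center, h0, sub_zero]
    dsimp only
    rw [hcc, mul_comm]
  rw [e]
  exact h.trans (le_of_eq (by ring))

end IsStationarySetup

lemma abs_integral_center_mul_le {Ω : Type*} [MeasurableSpace Ω] {P : Measure Ω}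
    [IsProbabilityMeasure P] {V W : Ω → ℝ} {m τ : ℝ} (hV : Measurable V) (hVm : ∀ ω, |V ω| ≤ m)
    (hW : Integrable W P) (hτ : ∫ ω, |W ω| ∂P ≤ τ) :
    |∫ ω, center P V ω * center P W ω ∂P| ≤ 2 * m * τ := by
  have hVi : Integrable V P :=
    Integrable.of_bound hV.aestronglyMeasurable m (Filter.Eventually.of_forall hVm)
  have hCi := integrable_center_of_integrable hVi
  have hCb := abs_center_le_of_abs_le (P := P) hVm
  have hm : 0 ≤ m := by
    obtain ⟨ω⟩ : Nonempty Ω := nonempty_of_isProbabilityMeasure P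
    exact (abs_nonneg _).trans (hVm ω)
  have hcc : center P (center P V) = center P V := by
    ext ω
    rw [center, integral_center_eq_zero hVi, sub_zero]
  rw [integral_mul_center hCi hW (hW.bdd_mul hCi.1 (Filter.Eventually.of_forall hCb)), hcc]
  calc |∫ ω, center P V ω * W ω ∂P| ≤ ∫ ω, |center P V ω * W ω| ∂P := abs_integral_le_integral_abs
    _ ≤ ∫ ω, 2 * m * |W ω| ∂P := by
        refine integral_mono (hW.bdd_mul hCi.1 (Filter.Eventually.of_forall hCb)).abs
          (hW.abs.const_mul _) fun ω => ?_
        dsimp only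
        rw [abs_mul]
        exact mul_le_mul_of_nonneg_right (hCb ω) (abs_nonneg _)
    _ ≤ 2 * m * τ := by
        rw [integral_const_mul]
        exact mul_le_mul_of_nonneg_left hτ (by positivity)

lemma integral_center_sq_le {Ω : Type*} [MeasurableSpace Ω] {P : Measure Ω}
    [IsProbabilityMeasure P] {W : Ω → ℝ} (hW : Integrable W P)
    (hW2 : Integrable (fun ω => W ω ^ 2) P) :
    ∫ ω, center P W ω ^ 2 ∂P ≤ ∫ ω, W ω ^ 2 ∂P := by
  set e := ∫ ω, W ω ∂P with he
  have h : ∀ ω, center P W ω ^ 2 = W ω ^ 2 - 2 * e * W ω + e ^ 2 := fun ω => by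
    rw [center, ← he]; ring
  simp only [h]
  have h3 : Integrable (fun ω => W ω ^ 2 - 2 * e * W ω) P := hW2.sub (hW.const_mul _)
  rw [integral_add h3 (integrable_const _), integral_sub hW2 (hW.const_mul _), integral_const_mul,
    ← he]
  simp only [integral_const, probReal_univ, smul_eq_mul, one_mul]
  nlinarith [sq_nonneg e]

/-! ### Truncation errors -/

section Truncation

variable {Q : ℝ → ℝ≥0∞} {μ : Measure ℝ} {L : ℕ} {a : Fin L → ℝ} {f : Fin L → ℝ → ℝ} {m M : ℝ}

/-- The combination `∑ |a_ℓ| (|f_ℓ| - m)₊`, which dominates all truncation errors at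
levels at least `m`. It is a subconvex combination, as only `∑ |a_ℓ| ≤ 1` is required. -/
noncomputable def excessSum (a : Fin L → ℝ) (f : Fin L → ℝ → ℝ) (m y : ℝ) : ℝ :=
  ∑ l, |a l| * max (|f l y| - m) 0

lemma abs_clipSum_sub_clipSum_le (hm : 0 ≤ m) (hmM : m ≤ M) (y : ℝ) :
    |clipSum a f M y - clipSum a f m y| ≤ excessSum a f m y := by
  rw [clipSum, clipSum, ← Finset.sum_sub_distrib]
  refine (Finset.abs_sum_le_sum_abs _ _).trans (Finset.sum_le_sum fun l _ => ?_)
  rw [← mul_sub, abs_mul]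
  exact mul_le_mul_of_nonneg_left (abs_clip_sub_clip_le hm hmM _) (abs_nonneg _)

lemma abs_sum_sub_clipSum_le (hm : 0 ≤ m) (y : ℝ) :
    |∑ l, a l * f l y - clipSum a f m y| ≤ excessSum a f m y := by
  rw [clipSum, ← Finset.sum_sub_distrib]
  refine (Finset.abs_sum_le_sum_abs _ _).trans (Finset.sum_le_sum fun l _ => ?_)
  rw [← mul_sub, abs_mul]
  exact mul_le_mul_of_nonneg_left (abs_sub_clip hm _).le (abs_nonneg _)

lemma sum_abs_mul_le (ha : ∑ l, |a l| ≤ 1) {b : Fin L → ℝ} {K : ℝ} (hK : 0 ≤ K)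
    (hb : ∀ l, b l ≤ K) : ∑ l, |a l| * b l ≤ K :=
  calc ∑ l, |a l| * b l ≤ ∑ l, |a l| * K := by gcongr with l; exact hb l
    _ ≤ K := by rw [← Finset.sum_mul]; nlinarith

variable [IsProbabilityMeasure μ]

lemma integral_excessSum_le (hQ : IsQuantileFunction Q)
    (hQ2 : ∫⁻ u in Set.Icc (0 : ℝ) 1, Q u ^ 2 < ∞) (ha : ∑ l, |a l| ≤ 1)
    (hf : ∀ l, f l ∈ MonClass Q μ) (hm : 0 ≤ m) :
    Integrable (excessSum a f m) μ ∧
      ∫ y, excessSum a f m y ∂μ ≤ ∫ u in Set.Ioc 0 1, max (realQuantile Q u - m) 0 := by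
  have h := fun l => integral_excess_le hQ hQ2 (μ := μ) (X := fun y => |f l y|)
    (continuous_abs.measurable.comp (MonClass.ordLevels (hf l)).measurable).aemeasurable
    (hf l).2 hm
  refine ⟨integrable_finsetSum _ fun l _ => (h l).1.const_mul _, ?_⟩
  unfold excessSum
  rw [integral_finsetSum _ fun l _ => (h l).1.const_mul _]
  simp only [integral_const_mul]
  exact sum_abs_mul_le ha (integral_nonneg fun _ => le_max_right _ _) fun l => (h l).2

lemma integral_excessSum_sq_le (hQ : IsQuantileFunction Q)
    (hQ2 : ∫⁻ u in Set.Icc (0 : ℝ) 1, Q u ^ 2 < ∞) (ha : ∑ l, |a l| ≤ 1)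
    (hf : ∀ l, f l ∈ MonClass Q μ) (hm : 0 ≤ m) :
    Integrable (fun y => excessSum a f m y ^ 2) μ ∧
      ∫ y, excessSum a f m y ^ 2 ∂μ
        ≤ ∫ u in Set.Ioc 0 1, max (realQuantile Q u - m) 0 ^ 2 := by
  have h := fun l => integral_excess_sq_le hQ hQ2 (μ := μ) (X := fun y => |f l y|)
    (continuous_abs.measurable.comp (MonClass.ordLevels (hf l)).measurable).aemeasurable
    (hf l).2 hm
  have hi : Integrable (fun y => ∑ l, |a l| * max (|f l y| - m) 0 ^ 2) μ :=
    integrable_finsetSum _ fun l _ => (h l).1.const_mul _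
  -- Cauchy–Schwarz for the weights `|a_ℓ|`, whose total mass is at most one.
  have hle : ∀ y, excessSum a f m y ^ 2 ≤ ∑ l, |a l| * max (|f l y| - m) 0 ^ 2 := fun y => by
    have h1 := Finset.sum_sq_le_sum_mul_sum_of_sq_le_mul Finset.univ
      (r := fun l => |a l| * max (|f l y| - m) 0) (f := fun l => |a l|)
      (g := fun l => |a l| * max (|f l y| - m) 0 ^ 2) (fun _ _ => abs_nonneg _)
      (fun _ _ => by positivity) (fun _ _ => le_of_eq (by ring))
    refine h1.trans (mul_le_of_le_one_left (Finset.sum_nonneg fun _ _ => by positivity) ha)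
  have hi2 : Integrable (fun y => excessSum a f m y ^ 2) μ := by
    refine hi.mono' ((integral_excessSum_le hQ hQ2 ha hf hm).1.1.pow 2)
      (Filter.Eventually.of_forall fun y => ?_)
    rw [Real.norm_of_nonneg (sq_nonneg _)]
    exact hle y
  refine ⟨hi2, (integral_mono hi2 hi hle).trans ?_⟩
  rw [integral_finsetSum _ fun l _ => (h l).1.const_mul _]
  simp only [integral_const_mul]
  exact sum_abs_mul_le ha (integral_nonneg fun _ => sq_nonneg _) fun l => (h l).2

end Truncation

namespace IsStationarySetup

variable {Ω : Type*} {M₀ : MeasurableSpace Ω} [mΩ : MeasurableSpace Ω] {P : Measure Ω}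
  [IsProbabilityMeasure P] {θ : Ω → Ω} {Y₀ : Ω → ℝ} {L : ℕ} {a : Fin L → ℝ} {f : Fin L → ℝ → ℝ}
  {Q : ℝ → ℝ≥0∞}

lemma isProbabilityMeasure_map (hθ : IsStationarySetup M₀ P θ Y₀) :
    IsProbabilityMeasure (P.map Y₀) :=
  Measure.isProbabilityMeasure_map (hθ.meas.mono hθ.le le_rfl).aemeasurable

/-- Covariance of truncated combinations, with a second truncation at a lower level `m`: the parts
below `m` are handled by mixing, and the remainders by their first two moments. -/
lemma integral_clipSum_mul_le_of_le (hθ : IsStationarySetup M₀ P θ Y₀)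
    (hQ : IsQuantileFunction Q) (hQ2 : ∫⁻ u in Set.Icc (0 : ℝ) 1, Q u ^ 2 < ∞)
    (ha : ∑ l, |a l| ≤ 1) (hf : ∀ l, f l ∈ MonClass Q (P.map Y₀)) {m M : ℝ} (hm : 0 ≤ m)
    (hmM : m ≤ M) (d : ℕ) :
    ∫ ω, center P (fun ω => clipSum a f M (orbit θ Y₀ 0 ω)) ω
        * center P (fun ω => clipSum a f M (orbit θ Y₀ d ω)) ω ∂P
      ≤ 4 * m ^ 2 * (alphaCoeff M₀ P (orbit θ Y₀) 1 d).toReal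
        + 4 * m * (∫ u in Set.Ioc 0 1, max (realQuantile Q u - m) 0)
        + ∫ u in Set.Ioc 0 1, max (realQuantile Q u - m) 0 ^ 2 := by
  have := hθ.isProbabilityMeasure_map
  have hl : ∀ l, OrdLevels (f l) := fun l => MonClass.ordLevels (hf l)
  obtain ⟨hG, hG1⟩ := integral_excessSum_le hQ hQ2 ha hf hm
  obtain ⟨hG2i, hG2⟩ := integral_excessSum_sq_le hQ hQ2 ha hf hm
  set τ₁ := ∫ u in Set.Ioc 0 1, max (realQuantile Q u - m) 0
  set τ₂ := ∫ u in Set.Ioc 0 1, max (realQuantile Q u - m) 0 ^ 2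
  set ρ : ℝ → ℝ := fun y => clipSum a f M y - clipSum a f m y with hρ
  have hρm : Measurable ρ := (measurable_clipSum a hl M).sub (measurable_clipSum a hl m)
  have hρle : ∀ y, |ρ y| ≤ excessSum a f m y := abs_clipSum_sub_clipSum_le hm hmM
  have hρi : Integrable ρ (P.map Y₀) := hG.mono' hρm.aestronglyMeasurable
    (Filter.Eventually.of_forall hρle)
  have hρ2i : Integrable (fun y => ρ y ^ 2) (P.map Y₀) := by
    refine hG2i.mono' (hρm.pow_const 2).aestronglyMeasurable
      (Filter.Eventually.of_forall fun y => ?_)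
    rw [Real.norm_of_nonneg (sq_nonneg _), ← sq_abs]
    exact pow_le_pow_left₀ (abs_nonneg _) (hρle y) 2
  have hE1 : ∀ i, ∫ ω, |ρ (orbit θ Y₀ i ω)| ∂P ≤ τ₁ := fun i => by
    rw [hθ.integral_orbit i (F := fun y => |ρ y|) hρi.abs.1]
    exact (integral_mono hρi.abs hG hρle).trans hG1
  have hE2 : ∀ i, ∫ ω, ρ (orbit θ Y₀ i ω) ^ 2 ∂P ≤ τ₂ := fun i => by
    rw [hθ.integral_orbit i (F := fun y => ρ y ^ 2) hρ2i.1]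
    refine (integral_mono hρ2i hG2i fun y => ?_).trans hG2
    dsimp only
    rw [← sq_abs]
    exact pow_le_pow_left₀ (abs_nonneg _) (hρle y) 2
  set C : ℕ → Ω → ℝ := fun i => center P (fun ω => clipSum a f m (orbit θ Y₀ i ω)) with hC
  set D : ℕ → Ω → ℝ := fun i => center P (fun ω => ρ (orbit θ Y₀ i ω)) with hD
  have hCD : ∀ i ω, center P (fun ω => clipSum a f M (orbit θ Y₀ i ω)) ω = C i ω + D i ω := by
    intro i ω
    simp only [hC, hD, hρ, center]
    rw [integral_sub (hθ.integrable_clipSum_orbit ha hl (hm.trans hmM) i)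
      (hθ.integrable_clipSum_orbit ha hl hm i)]
    ring
  have hρo : ∀ i, Integrable (fun ω => ρ (orbit θ Y₀ i ω)) P := fun i => hθ.integrable_orbit i hρi
  have hCi : ∀ i, Integrable (C i) P := fun i =>
    integrable_center_of_integrable (hθ.integrable_clipSum_orbit ha hl hm i)
  have hDi : ∀ i, Integrable (D i) P := fun i => integrable_center_of_integrable (hρo i)
  have hCb : ∀ i ω, |C i ω| ≤ 2 * m := fun i =>
    abs_center_le_of_abs_le fun ω => abs_clipSum_le ha f hm _
  have hDb : ∀ i ω, |D i ω| ≤ 2 * (M + m) := fun i =>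
    abs_center_le_of_abs_le fun ω => (abs_sub _ _).trans
      (add_le_add (abs_clipSum_le ha f (hm.trans hmM) _) (abs_clipSum_le ha f hm _))
  have iCC : Integrable (fun ω => C 0 ω * C d ω) P :=
    (hCi 0).mul_bdd (hCi d).1 (Filter.Eventually.of_forall (hCb d))
  have iCD : Integrable (fun ω => C 0 ω * D d ω) P :=
    (hCi 0).mul_bdd (hDi d).1 (Filter.Eventually.of_forall (hDb d))
  have iDC : Integrable (fun ω => D 0 ω * C d ω) P :=
    (hDi 0).mul_bdd (hCi d).1 (Filter.Eventually.of_forall (hCb d))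
  have iDD : Integrable (fun ω => D 0 ω * D d ω) P :=
    (hDi 0).mul_bdd (hDi d).1 (Filter.Eventually.of_forall (hDb d))
  have iD2 : ∀ i, Integrable (fun ω => D i ω ^ 2) P := fun i => by
    simpa only [sq] using (hDi i).mul_bdd (hDi i).1 (Filter.Eventually.of_forall (hDb i))
  have bCC := (le_abs_self _).trans (hθ.abs_integral_clipSum_mul_le ha hl hm d)
  have bCD : ∫ ω, C 0 ω * D d ω ∂P ≤ 2 * m * τ₁ := (le_abs_self _).trans
    (abs_integral_center_mul_le (hθ.measurable_clipSum_orbit hl m 0)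
      (fun ω => abs_clipSum_le ha f hm _) (hρo d) (hE1 d))
  have bDC : ∫ ω, D 0 ω * C d ω ∂P ≤ 2 * m * τ₁ := by
    have := (le_abs_self _).trans
      (abs_integral_center_mul_le (hθ.measurable_clipSum_orbit (a := a) hl m d)
      (fun ω => abs_clipSum_le ha f hm _) (hρo 0) (hE1 0))
    refine le_trans (le_of_eq ?_) this
    exact integral_congr_ae (Filter.Eventually.of_forall fun ω => mul_comm _ _)
  have bD2 : ∀ i, ∫ ω, D i ω ^ 2 ∂P ≤ τ₂ := fun i =>
    (integral_center_sq_le (hρo i) (hθ.integrable_orbit i hρ2i)).trans (hE2 i)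
  have bDD : ∫ ω, D 0 ω * D d ω ∂P ≤ τ₂ := by
    have h1 : ∫ ω, D 0 ω * D d ω ∂P ≤ ∫ ω, (1 / 2 * D 0 ω ^ 2 + 1 / 2 * D d ω ^ 2) ∂P :=
      integral_mono iDD (((iD2 0).const_mul _).add ((iD2 d).const_mul _)) fun ω => by
        dsimp only
        nlinarith [sq_nonneg (D 0 ω - D d ω)]
    rw [integral_add ((iD2 0).const_mul _) ((iD2 d).const_mul _), integral_const_mul,
      integral_const_mul] at h1
    linarith [bD2 0, bD2 d]
  have e : ∀ ω, center P (fun ω => clipSum a f M (orbit θ Y₀ 0 ω)) ω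
      * center P (fun ω => clipSum a f M (orbit θ Y₀ d ω)) ω
      = (C 0 ω * C d ω + C 0 ω * D d ω) + (D 0 ω * C d ω + D 0 ω * D d ω) := fun ω => by
    rw [hCD, hCD]; ring
  simp only [e]
  have i1 : Integrable (fun ω => C 0 ω * C d ω + C 0 ω * D d ω) P := iCC.add iCD
  have i2 : Integrable (fun ω => D 0 ω * C d ω + D 0 ω * D d ω) P := iDC.add iDD
  rw [integral_add i1 i2, integral_add iCC iCD, integral_add iDC iDD]
  linarith

/-- The covariance inequality: truncation at the level `Q(α₁(d))` balances the contribution of the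
mixing coefficient and that of the tails. -/
lemma integral_clipSum_mul_le (hθ : IsStationarySetup M₀ P θ Y₀)
    (hQ : IsQuantileFunction Q) (hQ2 : ∫⁻ u in Set.Icc (0 : ℝ) 1, Q u ^ 2 < ∞)
    (ha : ∑ l, |a l| ≤ 1) (hf : ∀ l, f l ∈ MonClass Q (P.map Y₀)) {M : ℝ} (hM : 0 ≤ M) (d : ℕ) :
    ∫ ω, center P (fun ω => clipSum a f M (orbit θ Y₀ 0 ω)) ω
        * center P (fun ω => clipSum a f M (orbit θ Y₀ d ω)) ω ∂P
      ≤ 4 * ∫ u in Set.Ioc 0 (alphaCoeff M₀ P (orbit θ Y₀) 1 d).toReal, realQuantile Q u ^ 2 := by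
  have hl : ∀ l, OrdLevels (f l) := fun l => MonClass.ordLevels (hf l)
  have hdirect := (le_abs_self _).trans (hθ.abs_integral_clipSum_mul_le ha hl hM d)
  have hα1 : (alphaCoeff M₀ P (orbit θ Y₀) 1 d).toReal ≤ 1 :=
    ENNReal.toReal_le_of_le_ofReal zero_le_one
      (by simpa using alphaCoeff_one_le_one hθ.le hθ.measurable_orbit d)
  have hα0 : 0 ≤ (alphaCoeff M₀ P (orbit θ Y₀) 1 d).toReal := ENNReal.toReal_nonneg
  have hlow := hθ.integral_clipSum_mul_le_of_le hQ hQ2 ha hf (M := M)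
    (realQuantile_nonneg Q (alphaCoeff M₀ P (orbit θ Y₀) 1 d).toReal)
  replace hlow := fun h => hlow h d
  generalize (alphaCoeff M₀ P (orbit θ Y₀) 1 d).toReal = α at *
  rcases hα0.eq_or_lt with h0 | hpos
  · subst h0
    simp only [mul_zero] at hdirect
    simpa using hdirect
  have hαt : Q α ≠ ∞ := hQ.ne_top ⟨hpos, hα1⟩
  have hα : α ∈ Set.Icc (0 : ℝ) 1 := ⟨hα0, hα1⟩
  have hm := realQuantile_nonneg Q α
  have h1 := mul_le_integral_realQuantile hQ hQ2 hα hαt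
  have h2 := mul_integral_le_integral_sq hQ hQ2 hα
  have h3 := mul_le_mul_of_nonneg_left h1 hm
  -- If `M` is already below `Q(α)`, no second truncation is needed.
  rcases le_total (realQuantile Q α) M with hle | hle
  · have h := hlow hle
    rw [integral_excess_eq hQ hQ2 hα hαt, integral_excess_sq_eq hQ hQ2 hα hαt] at h
    nlinarith
  · have h4 : M ^ 2 ≤ realQuantile Q α ^ 2 := pow_le_pow_left₀ hM hle 2
    have h5 := mul_le_mul_of_nonneg_right h4 hα0
    nlinarith

/-! ### Approximation of the closed class -/

/-- A function of the closed class is, up to an arbitrarily small error in `L¹`, a combination of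
functions of the class; truncating the latter at the level `M` costs at most the integral
of `(Q - M)₊`. -/
lemma exists_clipSum_approx (hθ : IsStationarySetup M₀ P θ Y₀)
    (hQ : IsQuantileFunction Q) (hQ2 : ∫⁻ u in Set.Icc (0 : ℝ) 1, Q u ^ 2 < ∞) {F : ℝ → ℝ}
    (hF : MemClosedClass Q (P.map Y₀) F) {ε : ℝ} (hε : 0 < ε) :
    ∃ (L : ℕ) (a : Fin L → ℝ) (f : Fin L → ℝ → ℝ), ∑ l, |a l| ≤ 1 ∧
      (∀ l, f l ∈ MonClass Q (P.map Y₀)) ∧ ∀ M, 0 ≤ M → ∀ i,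
        Integrable (fun ω => center P (fun ω => F (orbit θ Y₀ i ω)) ω
          - center P (fun ω => clipSum a f M (orbit θ Y₀ i ω)) ω) P ∧
        ∫ ω, |center P (fun ω => F (orbit θ Y₀ i ω)) ω
          - center P (fun ω => clipSum a f M (orbit θ Y₀ i ω)) ω| ∂P
        ≤ 2 * (ε + ∫ u in Set.Ioc 0 1, max (realQuantile Q u - M) 0) := by
  have := hθ.isProbabilityMeasure_map
  obtain ⟨g, hg, hFg⟩ := hF
  obtain ⟨g', ⟨L, a, f, ha, hf, hg'⟩, hdist⟩ := Metric.mem_closure_iff.1 hg ε hε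
  refine ⟨L, a, f, ha, hf, fun M hM i => ?_⟩
  have hl : ∀ l, OrdLevels (f l) := fun l => MonClass.ordLevels (hf l)
  obtain ⟨hG, hG1⟩ := integral_excessSum_le hQ hQ2 ha hf hM
  have hgi : Integrable g (P.map Y₀) := L1.integrable_coeFn g
  have hgi' : Integrable g' (P.map Y₀) := L1.integrable_coeFn g'
  have hFi : Integrable F (P.map Y₀) := hgi.congr hFg.symm
  have hclip : Integrable (clipSum a f M) (P.map Y₀) :=
    Integrable.of_bound (measurable_clipSum a hl M).aestronglyMeasurable M
      (Filter.Eventually.of_forall fun y => abs_clipSum_le ha f hM y)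
  have hdiff : ∫ y, |F y - clipSum a f M y| ∂(P.map Y₀)
      ≤ ε + ∫ u in Set.Ioc 0 1, max (realQuantile Q u - M) 0 := by
    have h1 : ∫ y, |g y - g' y| ∂(P.map Y₀) ≤ ε := by
      rw [dist_eq_norm, L1.norm_eq_integral_norm] at hdist
      refine le_trans (le_of_eq ?_) hdist.le
      refine integral_congr_ae ?_
      filter_upwards [Lp.coeFn_sub g g'] with y hy
      rw [hy]
      rfl
    calc ∫ y, |F y - clipSum a f M y| ∂(P.map Y₀)
        ≤ ∫ y, (|g y - g' y| + excessSum a f M y) ∂(P.map Y₀) := by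
          refine integral_mono_ae (hFi.sub hclip).abs ((hgi.sub hgi').abs.add hG) ?_
          filter_upwards [hFg, hg'] with y h1 h2
          have h3 := abs_sum_sub_clipSum_le (a := a) (f := f) hM y
          rw [← h2] at h3
          rw [h1]
          exact (abs_sub_le _ (g' y) _).trans (add_le_add_right h3 _)
      _ = ∫ y, |g y - g' y| ∂(P.map Y₀) + ∫ y, excessSum a f M y ∂(P.map Y₀) :=
          integral_add (hgi.sub hgi').abs hG
      _ ≤ _ := add_le_add h1 hG1
  have hi1 : Integrable (fun ω => F (orbit θ Y₀ i ω)) P := hθ.integrable_orbit i hFi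
  have hi2 := hθ.integrable_clipSum_orbit ha hl hM i
  set W : Ω → ℝ := fun ω => F (orbit θ Y₀ i ω) - clipSum a f M (orbit θ Y₀ i ω) with hW
  have hWi : Integrable W P := hi1.sub hi2
  have hWe : ∫ ω, |W ω| ∂P ≤ ε + ∫ u in Set.Ioc 0 1, max (realQuantile Q u - M) 0 := by
    have h := hθ.integral_orbit i (F := fun y => |F y - clipSum a f M y|) (hFi.sub hclip).abs.1
    exact h.le.trans hdiff
  have e : (fun ω => center P (fun ω => F (orbit θ Y₀ i ω)) ω
      - center P (fun ω => clipSum a f M (orbit θ Y₀ i ω)) ω) = center P W := by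
    ext ω
    simp only [center, hW]
    rw [integral_sub hi1 hi2]
    ring
  have e' := fun ω => congrFun e ω
  simp only [e']
  refine ⟨integrable_center_of_integrable hWi, ?_⟩
  calc ∫ ω, |center P W ω| ∂P ≤ ∫ ω, (|W ω| + ∫ ω', |W ω'| ∂P) ∂P := by
        refine integral_mono (integrable_center_of_integrable hWi).abs
          (hWi.abs.add (integrable_const _)) fun ω => ?_
        exact (abs_sub _ _).trans (add_le_add_right abs_integral_le_integral_abs _)
    _ = 2 * ∫ ω, |W ω| ∂P := by
        rw [integral_add hWi.abs (integrable_const _)]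
        simp [two_mul]
    _ ≤ _ := by linarith

end IsStationarySetup

/-! ### The deviation inequality -/

lemma partialSum_eq {Ω : Type*} [MeasurableSpace Ω] (P : Measure Ω) (Y : ℕ → Ω → ℝ) (f : ℝ → ℝ)
    (k : ℕ) (ω : Ω) :
    partialSum P Y f k ω = ∑ i ∈ Finset.Ioc 0 k, center P (fun ω' => f (Y i ω')) ω := rfl

/-- The exponent produced by Freedman's inequality for the level `3x/2`, the conditional variance
`3s²` and the bound `2x/r` is at least the one of the theorem. -/
lemma exponent_le {x r s : ℝ} (hx : 0 < x) (hr : 0 < r) (hs : 0 < s) :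
    r ^ 2 * s ^ 2 / (8 * x ^ 2) * h (2 * x ^ 2 / (r * s ^ 2))
      ≤ (2 * s ^ 2 + s ^ 2) / (2 * x / r) ^ 2
        * h (3 / 2 * x * (2 * x / r) / (2 * s ^ 2 + s ^ 2)) := by
  have e1 : 3 / 2 * x * (2 * x / r) / (2 * s ^ 2 + s ^ 2) = x ^ 2 / (r * s ^ 2) := by
    field_simp
    ring
  have e2 : 2 * x ^ 2 / (r * s ^ 2) = 2 * (x ^ 2 / (r * s ^ 2)) := by ring
  have e3 : (2 * s ^ 2 + s ^ 2) / (2 * x / r) ^ 2 = r ^ 2 * s ^ 2 / (8 * x ^ 2) * 6 := by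
    field_simp
    ring
  rw [e1, e2, e3, mul_assoc]
  exact mul_le_mul_of_nonneg_left (h_two_mul_le (by positivity)) (by positivity)

namespace IsStationarySetup

variable {Ω : Type*} {M₀ : MeasurableSpace Ω} [mΩ : MeasurableSpace Ω] {P : Measure Ω}
  [IsProbabilityMeasure P] {θ : Ω → Ω} {Y₀ : Ω → ℝ} {Q : ℝ → ℝ≥0∞} {F : ℝ → ℝ}

/-- The inequality when blocks of a positive length `q ≤ n` are available. -/
lemma measure_partialSum_le_of_block (hθ : IsStationarySetup M₀ P θ Y₀)
    (hQ : IsQuantileFunction Q) (hQ2 : ∫⁻ u in Set.Icc (0 : ℝ) 1, Q u ^ 2 < ∞)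
    (hF : MemClosedClass Q (P.map Y₀) F) {n q : ℕ} {x r s v : ℝ} (hx : 0 < x) (hr : 1 ≤ r)
    (hs : 0 < s)
    (hsn : 4 * n * ∑ i ∈ Finset.range n, ∫ u in Set.Ioc 0
      (alphaCoeff M₀ P (orbit θ Y₀) 1 i).toReal, realQuantile Q u ^ 2 ≤ s ^ 2)
    (hv : v ∈ Set.Icc (0 : ℝ) 1) (hvt : Q v ≠ ∞) (hq : 0 < q) (hqn : q ≤ n)
    (hqv : q * realQuantile Q v ≤ x / r)
    (hα : q < n → (alphaCoeff M₀ P (orbit θ Y₀) 2 q).toReal ≤ v) {ε : ℝ} (hε : 0 < ε) :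
    P.real {ω | ∃ k ∈ Finset.Icc 1 n, 5 * x ≤ |partialSum P (orbit θ Y₀) F k ω|}
      ≤ 4 * Real.exp (-(r ^ 2 * s ^ 2 / (8 * x ^ 2)) * h (2 * x ^ 2 / (r * s ^ 2)))
        + n * (6 / x + 16 * x / (r * s ^ 2)) * (∫ u in Set.Ioc 0 v, realQuantile Q u)
        + 2 * n * ε / x := by
  obtain ⟨L, a, f, ha, hf, happ⟩ := hθ.exists_clipSum_approx hQ hQ2 hF hε
  have hl : ∀ l, OrdLevels (f l) := fun l => MonClass.ordLevels (hf l)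
  have hM := realQuantile_nonneg Q v
  have hJ := mul_le_integral_realQuantile hQ hQ2 hv hvt
  have hτ := integral_excess_eq hQ hQ2 hv hvt
  replace happ := happ _ hM
  rw [hτ] at happ
  set M := realQuantile Q v with hMdef
  set J := ∫ u in Set.Ioc 0 v, realQuantile Q u with hJdef
  have hr0 : 0 < r := by linarith
  have hv0 := hv.1
  set X : ℕ → Ω → ℝ := fun i ω => clipSum a f M (orbit θ Y₀ i ω) with hX
  set δ : ℕ → Ω → ℝ := fun i ω => center P (fun ω => F (orbit θ Y₀ i ω)) ω - center P (X i) ω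
    with hδ
  set Err : Ω → ℝ := fun ω => ∑ i ∈ Finset.Ioc 0 n, |δ i ω| with hErr
  have hErri : Integrable Err P := integrable_finsetSum _ fun i _ => (happ i).1.abs
  have hErr1 : ∫ ω, Err ω ∂P ≤ n * (2 * (ε + (J - M * v))) := by
    simp only [hErr]
    rw [integral_finsetSum _ fun i _ => (happ i).1.abs]
    refine (Finset.sum_le_card_nsmul _ _ _ fun i _ => (happ i).2).trans (le_of_eq ?_)
    simp
  have hmain := (hθ.isBoundedAdapted (a := a) ha hl hM).measure_max_le (P := P) hq hqn
    (x := x) (c := 2 * x / r) (s₂ := s ^ 2) (V := 2 * s ^ 2) (K₁ := 4 * M * v)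
    (K₂ := 16 * M ^ 2 * v) (Err := Err)
    (κ := fun d => 4 * ∫ u in Set.Ioc 0
      (alphaCoeff M₀ P (orbit θ Y₀) 1 d).toReal, realQuantile Q u ^ 2)
    hx (by positivity) (by positivity)
    (hqv.trans (div_le_self hx.le hr)) (by rw [mul_div_assoc]; linarith)
    (fun d => mul_nonneg (by norm_num) (integral_nonneg fun u => sq_nonneg _))
    (fun i d => by
      rw [hθ.integral_center_mul_orbit_add (measurable_clipSum a hl M) (measurable_clipSum a hl M)]
      exact hθ.integral_clipSum_mul_le hQ hQ2 ha hf hM d)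
    (by
      rw [← Finset.mul_sum]
      linarith)
    (fun p i hpi hin => (hθ.integral_abs_condExp_clipSum_le ha hl hM one_le_two hpi.le).trans
      (mul_le_mul_of_nonneg_left (hα (by omega)) (by positivity)))
    (by positivity)
    (fun p i i' hpi hpi' hin _ =>
      (hθ.integral_abs_condExp_clipSum_mul_le ha hl hM hpi.le hpi'.le).trans
      (mul_le_mul_of_nonneg_left (hα (by omega)) (by positivity)))
    (by positivity) hErri (fun ω => Finset.sum_nonneg fun i _ => abs_nonneg _)
  have hsub : {ω | ∃ k ∈ Finset.Icc 1 n, 5 * x ≤ |partialSum P (orbit θ Y₀) F k ω|}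
      ⊆ {ω | ∃ k ≤ n, 5 * x ≤ |∑ i ∈ Finset.Ioc 0 k, center P (X i) ω| + Err ω} := by
    rintro ω ⟨k, hk, h5⟩
    have hkn := (Finset.mem_Icc.1 hk).2
    refine ⟨k, hkn, h5.trans ?_⟩
    rw [partialSum_eq]
    have e : ∑ i ∈ Finset.Ioc 0 k, center P (fun ω' => F (orbit θ Y₀ i ω')) ω
        = ∑ i ∈ Finset.Ioc 0 k, center P (X i) ω + ∑ i ∈ Finset.Ioc 0 k, δ i ω := by
      rw [← Finset.sum_add_distrib]
      exact Finset.sum_congr rfl fun i _ => by simp only [hδ]; ring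
    rw [e]
    refine (abs_add_le _ _).trans (add_le_add_right ?_ _)
    exact (Finset.abs_sum_le_sum_abs _ _).trans (Finset.sum_le_sum_of_subset_of_nonneg
      (Finset.Ioc_subset_Ioc_right hkn) fun _ _ _ => abs_nonneg _)
  refine (measureReal_mono hsub (measure_ne_top P _)).trans (hmain.trans ?_)
  have hexp := Real.exp_le_exp.2 (neg_le_neg (exponent_le hx hr0 hs))
  rw [← neg_mul (r ^ 2 * s ^ 2 / (8 * x ^ 2))] at hexp
  have hn : (0 : ℝ) ≤ n := Nat.cast_nonneg n
  have hmarkov : ((∫ ω, Err ω ∂P) + n * (4 * M * v)) / x ≤ n * (6 / x) * J + 2 * n * ε / x := by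
    have e : n * (6 / x) * J + 2 * n * ε / x = (n * (6 * J) + 2 * n * ε) / x := by ring
    rw [e]
    refine div_le_div_of_nonneg_right ?_ hx.le
    have hJ0 : 0 ≤ J := le_trans (by positivity) hJ
    nlinarith [mul_le_mul_of_nonneg_left hJ hn, mul_nonneg hn hJ0]
  have hvar : n * (q * (16 * M ^ 2 * v)) / s ^ 2 ≤ n * (16 * x / (r * s ^ 2)) * J := by
    have e : n * (16 * x / (r * s ^ 2)) * J = (n * (16 * (x / r * J))) / s ^ 2 := by
      field_simp
    rw [e]
    refine div_le_div_of_nonneg_right (mul_le_mul_of_nonneg_left ?_ hn) (by positivity)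
    have := mul_le_mul hqv hJ (by positivity) (by positivity)
    nlinarith
  linarith

/-- The inequality when `α₂(0) ≤ u`: the variables themselves are small, and Markov's inequality
suffices. -/
lemma measure_partialSum_le_of_degenerate (hθ : IsStationarySetup M₀ P θ Y₀)
    (hQ : IsQuantileFunction Q) (hQ2 : ∫⁻ u in Set.Icc (0 : ℝ) 1, Q u ^ 2 < ∞)
    (hF : MemClosedClass Q (P.map Y₀) F) {n : ℕ} {x u : ℝ} (hx : 0 < x)
    (hu : u ∈ Set.Icc (0 : ℝ) 1) (hut : Q u ≠ ∞)
    (hα : (alphaCoeff M₀ P (orbit θ Y₀) 2 0).toReal ≤ u) {ε : ℝ} (hε : 0 < ε) :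
    P.real {ω | ∃ k ∈ Finset.Icc 1 n, 5 * x ≤ |partialSum P (orbit θ Y₀) F k ω|}
      ≤ n * (6 / x) * (∫ w in Set.Ioc 0 u, realQuantile Q w) + 2 * n * ε / x := by
  obtain ⟨L, a, f, ha, hf, happ⟩ := hθ.exists_clipSum_approx hQ hQ2 hF hε
  have hl : ∀ l, OrdLevels (f l) := fun l => MonClass.ordLevels (hf l)
  have hM := realQuantile_nonneg Q u
  have hJ := mul_le_integral_realQuantile hQ hQ2 hu hut
  have hτ := integral_excess_eq hQ hQ2 hu hut
  replace happ := happ _ hM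
  rw [hτ] at happ
  set M := realQuantile Q u with hMdef
  set J := ∫ w in Set.Ioc 0 u, realQuantile Q w with hJdef
  have hu0 := hu.1
  set X : ℕ → Ω → ℝ := fun i ω => clipSum a f M (orbit θ Y₀ i ω) with hX
  set G : ℕ → Ω → ℝ := fun i => center P (fun ω => F (orbit θ Y₀ i ω)) with hG
  have hadapt := hθ.isBoundedAdapted (a := a) ha hl hM
  have hXi : ∀ i, Integrable (center P (X i)) P := fun i => hadapt.integrable_center i
  have hX1 : ∀ i, ∫ ω, |center P (X i) ω| ∂P ≤ 4 * M * u := fun i => by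
    -- At distance `0` the variable is its own prediction.
    have h1 := hθ.integral_abs_condExp_clipSum_le ha hl hM (k := 2) (q := 0) (p := i) (i := i)
      one_le_two le_rfl
    rw [condExp_of_stronglyMeasurable (hθ.comap_le i) (hadapt.measurable_center i) (hXi i)] at h1
    exact h1.trans (mul_le_mul_of_nonneg_left hα (by positivity))
  have hGi : ∀ i, Integrable (G i) P := fun i => by
    have := (happ i).1.add (hXi i)
    refine this.congr (Filter.Eventually.of_forall fun ω => ?_)
    simp only [Pi.add_apply, hX, hG]
    ring
  have hG1 : ∀ i, ∫ ω, |G i ω| ∂P ≤ 2 * (ε + (J - M * u)) + 4 * M * u := fun i => by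
    calc ∫ ω, |G i ω| ∂P ≤ ∫ ω, (|G i ω - center P (X i) ω| + |center P (X i) ω|) ∂P := by
          refine integral_mono (hGi i).abs ((happ i).1.abs.add (hXi i).abs) fun ω => ?_
          have := abs_add_le (G i ω - center P (X i) ω) (center P (X i) ω)
          simpa using this
      _ = ∫ ω, |G i ω - center P (X i) ω| ∂P + ∫ ω, |center P (X i) ω| ∂P :=
          integral_add (happ i).1.abs (hXi i).abs
      _ ≤ _ := add_le_add (happ i).2 (hX1 i)
  have hmarkov := mul_meas_ge_le_integral_of_nonneg (μ := P)
    (f := fun ω => ∑ i ∈ Finset.Ioc 0 n, |G i ω|)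
    (Filter.Eventually.of_forall fun ω => Finset.sum_nonneg fun i _ => abs_nonneg _)
    (integrable_finsetSum _ fun i _ => (hGi i).abs) (5 * x)
  rw [integral_finsetSum _ fun i _ => (hGi i).abs] at hmarkov
  have hsum : ∑ i ∈ Finset.Ioc 0 n, ∫ ω, |G i ω| ∂P
      ≤ n * (2 * (ε + (J - M * u)) + 4 * M * u) := by
    refine (Finset.sum_le_card_nsmul _ _ _ fun i _ => hG1 i).trans (le_of_eq ?_)
    rw [Nat.card_Ioc, nsmul_eq_mul, Nat.sub_zero]
  have hsub : {ω | ∃ k ∈ Finset.Icc 1 n, 5 * x ≤ |partialSum P (orbit θ Y₀) F k ω|}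
      ⊆ {ω | 5 * x ≤ ∑ i ∈ Finset.Ioc 0 n, |G i ω|} := by
    rintro ω ⟨k, hk, h5⟩
    refine h5.trans ?_
    rw [partialSum_eq]
    exact (Finset.abs_sum_le_sum_abs _ _).trans (Finset.sum_le_sum_of_subset_of_nonneg
      (Finset.Ioc_subset_Ioc_right (Finset.mem_Icc.1 hk).2) fun _ _ _ => abs_nonneg _)
  refine (measureReal_mono hsub (measure_ne_top P _)).trans ?_
  have e : n * (6 / x) * J + 2 * n * ε / x = (n * (6 * J) + 2 * n * ε) / x := by ring
  rw [e, le_div_iff₀ hx]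
  have hn : (0 : ℝ) ≤ n := Nat.cast_nonneg n
  have hJ0 : 0 ≤ J := le_trans (by positivity) hJ
  have hp : 0 ≤ P.real {ω | 5 * x ≤ ∑ i ∈ Finset.Ioc 0 n, |G i ω|} * x :=
    mul_nonneg measureReal_nonneg hx.le
  nlinarith [mul_le_mul_of_nonneg_left hJ hn, mul_nonneg hn hJ0, mul_nonneg hn hε.le]

/-- The deviation inequality for real-valued integrals. -/
lemma measure_partialSum_le (hθ : IsStationarySetup M₀ P θ Y₀)
    (hQ : IsQuantileFunction Q) (hQ2 : ∫⁻ u in Set.Icc (0 : ℝ) 1, Q u ^ 2 < ∞)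
    (hF : MemClosedClass Q (P.map Y₀) F) {n : ℕ} {x r s : ℝ} (hx : 0 < x) (hr : 1 ≤ r)
    (hs : 0 < s)
    (hsn : 4 * n * ∑ i ∈ Finset.range n, ∫ u in Set.Ioc 0
      (alphaCoeff M₀ P (orbit θ Y₀) 1 i).toReal, realQuantile Q u ^ 2 ≤ s ^ 2)
    {v : ℝ} (hv : v = S (alphaCoeff M₀ P (orbit θ Y₀) 2) n Q (x / r)) :
    P.real {ω | ∃ k ∈ Finset.Icc 1 n, 5 * x ≤ |partialSum P (orbit θ Y₀) F k ω|}
      ≤ 4 * Real.exp (-(r ^ 2 * s ^ 2 / (8 * x ^ 2)) * h (2 * x ^ 2 / (r * s ^ 2)))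
        + n * (6 / x + 16 * x / (r * s ^ 2)) * (∫ u in Set.Ioc 0 v, realQuantile Q u) := by
  have hr0 : 0 < r := by linarith
  have hanti : Antitone (alphaCoeff M₀ P (orbit θ Y₀) 2) := alphaCoeff_antitone _ _
  obtain ⟨hv01, hRv⟩ := S_mem (n := n) hQ hanti (x / r)
  rw [← hv] at hv01 hRv
  rw [R_eq] at hRv
  set q := blockLength (alphaCoeff M₀ P (orbit θ Y₀) 2) n v with hqdef
  have hJ0 : ∀ u, 0 ≤ ∫ w in Set.Ioc 0 u, realQuantile Q w := fun u =>
    integral_nonneg fun w => realQuantile_nonneg Q w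
  rcases Nat.eq_zero_or_pos n with hn0 | hnpos
  · subst hn0
    have : {ω | ∃ k ∈ Finset.Icc 1 0, 5 * x ≤ |partialSum P (orbit θ Y₀) F k ω|} = ∅ := by
      ext ω; simp
    rw [this]
    simp only [measureReal_empty, Nat.cast_zero, zero_mul, add_zero]
    positivity
  have hn : (0 : ℝ) < n := by exact_mod_cast hnpos
  refine le_of_forall_pos_le_add fun δ hδ => ?_
  -- The error is split between the `L¹` approximation and the choice of `u` near `v`.
  set ε := δ * x / (4 * n) with hε
  have hε0 : 0 < ε := by positivity
  have hεe : 2 * n * ε / x = δ / 2 := by rw [hε]; field_simp; ring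
  have hα : q < n → (alphaCoeff M₀ P (orbit θ Y₀) 2 q).toReal ≤ v := fun hqn =>
    ENNReal.toReal_le_of_le_ofReal hv01.1 (coeff_blockLength_le hanti hqn)
  rcases Nat.eq_zero_or_pos q with hq0 | hqpos
  · have hα0 := hα (by omega)
    rw [hq0] at hα0
    obtain ⟨u, hu, hvu, hut, hJu⟩ : ∃ u ∈ Set.Icc (0 : ℝ) 1, v ≤ u ∧ Q u ≠ ∞ ∧
        n * (6 / x) * (∫ w in Set.Ioc 0 u, realQuantile Q w)
          ≤ n * (6 / x) * (∫ w in Set.Ioc 0 v, realQuantile Q w) + δ / 2 := by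
      rcases hv01.1.eq_or_lt with h0 | hpos
      · -- `Q 0` may be infinite, but the integral of `Q` over `(0, u]` vanishes as `u → 0`.
        have hi : IntegrableOn (realQuantile Q) (Set.Icc 0 1) :=
          (integrableOn_Icc_iff_integrableOn_Ioc (by simp)).2 (integrable_realQuantile hQ hQ2)
        have hc := (intervalIntegral.continuousOn_primitive hi) 0 (by simp)
        have hlim : Filter.Tendsto
            (fun u => n * (6 / x) * ∫ w in Set.Ioc 0 u, realQuantile Q w)
            (nhdsWithin 0 (Set.Ioc 0 1)) (nhds (n * (6 / x) * 0)) := by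
          refine Filter.Tendsto.const_mul _ ?_
          have := hc.mono Set.Ioc_subset_Icc_self
          simpa [ContinuousWithinAt] using this
        rw [mul_zero] at hlim
        have hne : (nhdsWithin (0 : ℝ) (Set.Ioc 0 1)).NeBot := by
          rw [nhdsWithin_Ioc_eq_nhdsGT one_pos]
          infer_instance
        obtain ⟨u, hu1, hu2⟩ := ((hlim.eventually (gt_mem_nhds (half_pos hδ))).and
          self_mem_nhdsWithin).exists
        refine ⟨u, ⟨hu2.1.le, hu2.2⟩, h0 ▸ hu2.1.le, hQ.ne_top hu2, hu1.le.trans ?_⟩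
        have := mul_nonneg (by positivity : (0 : ℝ) ≤ n * (6 / x)) (hJ0 v)
        linarith
      · exact ⟨v, hv01, le_rfl, hQ.ne_top ⟨hpos, hv01.2⟩, by linarith⟩
    have hmain := hθ.measure_partialSum_le_of_degenerate hQ hQ2 hF (n := n) hx hu hut
      (hα0.trans hvu) hε0
    have h1 : 0 ≤ n * (16 * x / (r * s ^ 2)) * (∫ w in Set.Ioc 0 v, realQuantile Q w) :=
      mul_nonneg (by positivity) (hJ0 v)
    have h2 := Real.exp_pos (-(r ^ 2 * s ^ 2 / (8 * x ^ 2)) * h (2 * x ^ 2 / (r * s ^ 2)))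
    linarith
  · have hvt : Q v ≠ ∞ := fun htop => by
      rw [htop, ENNReal.mul_top (by exact_mod_cast hqpos.ne')] at hRv
      exact ENNReal.ofReal_ne_top (top_le_iff.1 hRv)
    have hqv : q * realQuantile Q v ≤ x / r := by
      have := ENNReal.toReal_le_of_le_ofReal (by positivity) hRv
      rwa [ENNReal.toReal_mul, ENNReal.toReal_natCast] at this
    have hmain := hθ.measure_partialSum_le_of_block hQ hQ2 hF hx hr hs hsn hv01 hvt hqpos
      (blockLength_le _ _ _) hqv hα hε0
    linarith

end IsStationarySetup

end FukNagaev

theorem mainTheorem8 {Ω : Type*} (M₀ : MeasurableSpace Ω) [mΩ : MeasurableSpace Ω]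
    (P : Measure Ω) [IsProbabilityMeasure P]
    (θ : Ω ≃ᵐ Ω) (hθ : MeasurePreserving θ P P)
    (hM₀ : M₀ ≤ mΩ) (hM₀θ : M₀ ≤ MeasurableSpace.comap θ M₀)
    (Y₀ : Ω → ℝ) (hY₀ : Measurable[M₀] Y₀)
    (Q : ℝ → ℝ≥0∞) (hQ : FukNagaev.IsQuantileFunction Q)
    (hQ2 : ∫⁻ u in Set.Icc (0 : ℝ) 1, Q u ^ 2 < ∞)
    (f : ℝ → ℝ) (hf : FukNagaev.MemClosedClass Q (P.map Y₀) f)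
    (n : ℕ) (x r s : ℝ) (hx : 0 < x) (hr : 1 ≤ r) (hs : 0 < s)
    (hsn : 4 * (n : ℝ≥0∞) * ∑ i ∈ Finset.range n,
        ∫⁻ u in Set.Icc (0 : ℝ)
          (FukNagaev.alphaCoeff M₀ P (FukNagaev.orbit θ Y₀) 1 i).toReal, Q u ^ 2
      ≤ ENNReal.ofReal (s ^ 2)) :
    P {ω | ∃ k ∈ Finset.Icc 1 n,
        5 * x ≤ |FukNagaev.partialSum P (FukNagaev.orbit θ Y₀) f k ω|}
      ≤ ENNReal.ofReal
          (4 * Real.exp (-(r ^ 2 * s ^ 2 / (8 * x ^ 2)) * FukNagaev.h (2 * x ^ 2 / (r * s ^ 2))))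
        + ENNReal.ofReal (n * (6 / x + 16 * x / (r * s ^ 2))) *
          ∫⁻ u in Set.Icc (0 : ℝ)
            (FukNagaev.S (FukNagaev.alphaCoeff M₀ P (FukNagaev.orbit θ Y₀) 2) n Q (x / r)),
            Q u := by
  have hsetup : FukNagaev.IsStationarySetup M₀ P θ Y₀ := ⟨hθ, hM₀, hM₀θ, hY₀⟩
  have hα1 : ∀ i, (FukNagaev.alphaCoeff M₀ P (FukNagaev.orbit θ Y₀) 1 i).toReal ≤ 1 := fun i =>
    ENNReal.toReal_le_of_le_ofReal zero_le_one
      (by simpa using FukNagaev.alphaCoeff_one_le_one hM₀ hsetup.measurable_orbit i)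
  have hsn' : 4 * n * ∑ i ∈ Finset.range n, ∫ u in Set.Ioc 0
      (FukNagaev.alphaCoeff M₀ P (FukNagaev.orbit θ Y₀) 1 i).toReal,
      FukNagaev.realQuantile Q u ^ 2 ≤ s ^ 2 := by
    rw [Finset.sum_congr rfl fun i _ => FukNagaev.setLIntegral_sq_eq_ofReal hQ hQ2 (hα1 i),
      ← ENNReal.ofReal_sum_of_nonneg fun i _ => integral_nonneg fun u => sq_nonneg _] at hsn
    have e : 4 * (n : ℝ≥0∞) = ENNReal.ofReal (4 * n) := by
      rw [ENNReal.ofReal_mul (by norm_num), ENNReal.ofReal_natCast]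
      simp
    rw [e, ← ENNReal.ofReal_mul (by positivity)] at hsn
    exact (ENNReal.ofReal_le_ofReal_iff (sq_nonneg s)).1 hsn
  have hv := (FukNagaev.S_mem (n := n) hQ
    (FukNagaev.alphaCoeff_antitone (M₀ := M₀) (P := P) (FukNagaev.orbit θ Y₀) 2) (x / r)).1
  have hmain := hsetup.measure_partialSum_le hQ hQ2 hf hx hr hs hsn' rfl
  rw [FukNagaev.setLIntegral_eq_ofReal hQ hQ2 hv.2, ← ENNReal.ofReal_mul (by positivity),
    ← ENNReal.ofReal_add (by positivity) (mul_nonneg (by positivity)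
      (integral_nonneg fun u => FukNagaev.realQuantile_nonneg Q u)), ← ofReal_measureReal]
  exact ENNReal.ofReal_le_ofReal hmain
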